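/- Let $n\ge 2$ and consider $\mathbb R^{n+1}=\mathbb R^n\times\mathbb R$ with points $(x,t)$, origin $o$, and homogeneous dimension $Q=n+2$. Put $$\nabla_G=(\nabla_x,\,|x|\partial_t),\qquad \mathcal L_G=\Delta_x+|x|^2\partial_t^2,\qquad \varrho(x,t)=(|x|^4+4t^2)^{1/4},$$ and, for $0<R\le\infty$, $B_R(o)=\{\varrho<R\}$. A function is radial if it depends only on $\varrho$. For a function $u$, $u_\varrho$ denotes the radial derivative in polar coordinates, that is $u_\varrho(p)=\frac{d}{ds}\big|_{s=\varrho(p)}u\big(\delta_{s/\varrho(p)}p\big)$ for $p\ne o$, where $\delta_\lambda(x,t)=(\lambda x,\lambda^2t)$. A pair $(V,\widetilde W)$ of real-valued $C^1$ functions on $(0,R)$ is a $D$-dimensional Bessel pair on $(0,R)$ if the equation $(r^{D-1}Vy')'+r^{D-1}\widetilde Wy=0$ has a positive solution on $(0,R)$; a solution is a $C^1$ function $y$ such that $r^{D-1}Vy'$ is differentiable and the equation holds at every point. **Proposition 7.1.** Let $0<R\le\infty$ and suppose that $\big(V(r),\,W(r)+Q\frac{V_r(r)}{r}\big)$ is a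 $(Q+2)$-dimensional Bessel pair on $(0,R)$ with positive solution $f$. (i) For every radial real-valued $u\in C_c^\infty(B_R(o)\setminus\{o\})$ the three integrals below converge absolutely and $$\int_{B_R(o)}V(\varrho)\frac{(\mathcal L_Gu)^2}{|\nabla_G\varrho|^2}\,dx\,dt=\int_{B_R(o)}W(\varrho)|\nabla_Gu|^2\,dx\,dt+\int_{B_R(o)}V(\varrho)\Big|\nabla_G\Big(\frac{u_\varrho}{\varrho f(\varrho)}\Big)\Big|^2\varrho^2f(\varrho)^2\,dx\,dt .$$ (ii) If, moreover, $V\ge 0$ on $(0,R)$, $V_r$ is differentiable on $(0,R)$, and $$(Q-5)\frac{V(r)}{r^2}+3\frac{V_r(r)}{r}-V_{rr}(r)\ge 0\qquad\text{for all } r\in(0,R),$$ then for every real-valued $u\in C_c^\infty(B_R(o)\setminus\{o\})$ the two integrals on the right converge absolutely and $$\int_{B_R(o)}V(\varrho)\frac{(\mathcal L_Gu)^2}{|\nabla_G\varrho|^2}\,dx\,dt\ \ge\ \int_{B_R(o)}W(\varrho)|\nabla_Gu|^2\,dx\,dt+\int_{B_R(o)}V(\varrho)\Big|\nabla_G\Big(\frac{u_\varrho}{\varrho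 f(\varrho)}\Big)\Big|^2\varrho^2f(\varrho)^2\,dx\,dt ,$$ where the left-hand side, the integral of a nonnegative function, is allowed to be $+\infty$. -/

import Mathlib

open MeasureTheory Set
open scoped ContDiff

noncomputable section

namespace Grushin

/-- The underlying space `ℝⁿ⁺¹ = ℝⁿ × ℝ` of the Grushin space, with points `(x, t)`. -/
abbrev Space (n : ℕ) : Type := EuclideanSpace ℝ (Fin n) × ℝ

/-- The homogeneous dimension `Q = n + 2`. -/
def homDim (n : ℕ) : ℕ := n + 2

/-- The anisotropic dilation `δ_s (x, t) = (s x, s² t)`. -/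
def dilation {n : ℕ} (s : ℝ) (p : Space n) : Space n := (s • p.1, s ^ 2 * p.2)

/-- The gauge `ϱ(x, t) = (|x|⁴ + 4 t²)^(1/4)`. -/
def gaugeNorm {n : ℕ} (p : Space n) : ℝ := (‖p.1‖ ^ 4 + 4 * p.2 ^ 2) ^ (1 / 4 : ℝ)

/-- The interval `(0, R)` for an extended real `R`. -/
def radialInterval (R : EReal) : Set ℝ := {r | 0 < r ∧ (r : EReal) < R}

/-- The `ϱ`-gauge ball of radius `R` (possibly `R = ∞`) around the origin. -/
def gaugeBall (n : ℕ) (R : EReal) : Set (Space n) := {p | (gaugeNorm p : EReal) < R}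

/-- The partial derivative `∂u/∂xᵢ`. -/
def partialX {n : ℕ} (i : Fin n) (u : Space n → ℝ) (p : Space n) : ℝ :=
  fderiv ℝ u p (EuclideanSpace.single i 1, 0)

/-- The partial derivative `∂u/∂t`. -/
def partialT {n : ℕ} (u : Space n → ℝ) (p : Space n) : ℝ :=
  fderiv ℝ u p (0, 1)

/-- `|∇_G u|²` where `∇_G u = (∂u/∂x₁, …, ∂u/∂xₙ, |x| ∂u/∂t)`. -/
def gradSq {n : ℕ} (u : Space n → ℝ) (p : Space n) : ℝ :=
  ∑ i, partialX i u p ^ 2 + (‖p.1‖ * partialT u p) ^ 2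

/-- The Grushin operator `L_G u = Δₓ u + |x|² ∂²u/∂t²`. -/
def grushinOp {n : ℕ} (u : Space n → ℝ) (p : Space n) : ℝ :=
  ∑ i, partialX i (partialX i u) p + ‖p.1‖ ^ 2 * partialT (partialT u) p

/-- The derivative `u_ϱ` in the polar coordinates `p = δ_ϱ(σ)`, `ϱ = ϱ(p)`, `ϱ(σ) = 1`: the
derivative of `s ↦ u (δ_s σ)` at `s = ϱ`. -/
def radialDeriv {n : ℕ} (u : Space n → ℝ) (p : Space n) : ℝ :=
  deriv (fun s : ℝ => u (dilation (s / gaugeNorm p) p)) (gaugeNorm p)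

/-- `u` depends only on the gauge `ϱ`. -/
def IsRadial {n : ℕ} (u : Space n → ℝ) : Prop :=
  ∀ p q : Space n, gaugeNorm p = gaugeNorm q → u p = u q

/-- `u ∈ C_c^∞(B_R(o) \ {o})`, extended by zero to the whole space. -/
structure IsTestFunction {n : ℕ} (R : EReal) (u : Space n → ℝ) : Prop where
  smooth : ContDiff ℝ ∞ u
  compact : HasCompactSupport u
  support_subset : tsupport u ⊆ gaugeBall n R \ {0}

/-- `f` is a positive solution on `(0, R)` of `(r^(D-1) V y')' + r^(D-1) W y = 0`. A solution
is a `C¹` function for which `r^(D-1) V y'` is differentiable and the equation holds. -/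
structure IsPositiveSolution (D : ℕ) (R : EReal) (V W f : ℝ → ℝ) : Prop where
  contDiffOn : ContDiffOn ℝ 1 f (radialInterval R)
  pos : ∀ r ∈ radialInterval R, 0 < f r
  ode : ∀ r ∈ radialInterval R,
    DifferentiableAt ℝ (fun s => s ^ (D - 1) * V s * deriv f s) r ∧
      deriv (fun s => s ^ (D - 1) * V s * deriv f s) r + r ^ (D - 1) * W r * f r = 0

/-- `(V, W)` is a `D`-dimensional Bessel pair on `(0, R)`. -/
structure IsBesselPair (D : ℕ) (R : EReal) (V W : ℝ → ℝ) : Prop where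
  contDiffOn_left : ContDiffOn ℝ 1 V (radialInterval R)
  contDiffOn_right : ContDiffOn ℝ 1 W (radialInterval R)
  exists_solution : ∃ f : ℝ → ℝ, IsPositiveSolution D R V W f

/-- The integrand `V(ϱ) (L_G u)² / |∇_G ϱ|²`. -/
def rellichTerm {n : ℕ} (V : ℝ → ℝ) (u : Space n → ℝ) (p : Space n) : ℝ :=
  V (gaugeNorm p) * (grushinOp u p ^ 2 / gradSq gaugeNorm p)

/-- The integrand `W(ϱ) |∇_G u|²`. -/
def hardyTerm {n : ℕ} (W : ℝ → ℝ) (u : Space n → ℝ) (p : Space n) : ℝ :=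
  W (gaugeNorm p) * gradSq u p

/-- The integrand `V(ϱ) |∇_G (u_ϱ / (ϱ f(ϱ)))|² ϱ² f(ϱ)²`. -/
def remainderTerm {n : ℕ} (V f : ℝ → ℝ) (u : Space n → ℝ) (p : Space n) : ℝ :=
  V (gaugeNorm p) * gradSq (fun q => radialDeriv u q / (gaugeNorm q * f (gaugeNorm q))) p *
    gaugeNorm p ^ 2 * f (gaugeNorm p) ^ 2

end Grushin

end

noncomputable section

namespace Grushin

/-! Let Z be the generator of the dilations (`euler`), so that Zu = ϱ u_ϱ, and let ψ = |∇_G ϱ|² =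
|x|²/ϱ² (`angularWeight`), which is constant along rays. Removing from ∇_G u its component along ∇_G
ϱ leaves a quadratic form Γ (`angularForm`) with ϱ²|∇_G u|² = ψ(Zu)² + Γ(u,u). Correspondingly ϱ²
L_G = ψ(Z² + nZ) + M with n = Q − 2. Since Γ annihilates radial functions, ∫ w h Mu = −∫ w Γ(h,u)
for every radial weight w (`integral_radial_mul_angularOp`). With B = Z²u + nZu and v = V/ϱ⁴ the
Rellich integrand is v(ψB + Mu)²/ψ = vψB² + 2vB·Mu + v(Mu)²/ψ.

The term vψB² lives on rays. For y = u_ϱ, factoring y = (rf)·(y/(rf)) and using the equation of f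
turns the one-dimensional integrand into an exact derivative (`integral_radial_rellich`). The
dimension is Q + 2 because the ground state f is compared with y/r, which raises the weight r^(Q−1)
by r². If u is radial, then Γ(u,·) = 0, and testing Mu against itself gives Mu = 0 almost
everywhere, so this identity is already (i).

For general u the cross term integrates to −2∫vΓ(B,u), and v(Mu)²/ψ is bounded below by completing
the square in Mu + (n+1)ψ(u − m), where m is the ψ-mean of u over gauge spheres. Together with a
Poincaré inequality with constant n + 1 on gauge spheres this contributes at least (n+1)∫vΓ(u,u)
(`integral_rellichMinorant_ge`), and (Mu)²/ψ itself never has to be integrated. It remains to see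
that −2∫vΓ(B,u) + (n+1)∫vΓ(u,u) dominates the angular parts of the Hardy and remainder terms. The
components of the angular gradient commute with Z, so this is again a one-dimensional inequality on
rays, applied to each component (`integral_angular_nonneg`). The condition on V is the sign of the
zeroth-order term left over there.

The Poincaré inequality (`gaugeSphere_poincare`) has the constant suggested by the functions x_i:
they satisfy L_G x_i = 0 and Z x_i = x_i, hence M x_i = −(n+1)ψ x_i. In coordinates ξ ∈ S^(n−1) and
τ = 2t/|x|² the gauge sphere is a weighted cylinder. A function on it splits into its mean over ξ,
handled by a weighted Poincaré inequality in τ, and a part with zero mean on every sphere, handled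
by the Poincaré inequality of S^(n−1) and a ground-state inequality in τ. The inequality on S^(n−1)
comes from the Gaussian one, which tensorizes from dimension one, applied to extensions homogeneous
of degree one. -/

lemma isOpen_radialInterval (R : EReal) : IsOpen (radialInterval R) := by
  have h : radialInterval R = Ioi 0 ∩ (fun r : ℝ => (r : EReal)) ⁻¹' Iio R := rfl
  rw [h]
  exact isOpen_Ioi.inter (isOpen_Iio.preimage continuous_coe_real_ereal)

/-! ### One-dimensional identities and inequalities along a ray. -/

section Ray

variable {n : ℕ} {R : EReal} {V W f : ℝ → ℝ}

lemma hasDerivAt_of_contDiffOn {g : ℝ → ℝ} (hg : ContDiffOn ℝ 1 g (radialInterval R)) {r : ℝ}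
    (hr : r ∈ radialInterval R) : HasDerivAt g (deriv g r) r :=
  ((hg.contDiffAt ((isOpen_radialInterval R).mem_nhds hr)).differentiableAt one_ne_zero).hasDerivAt

lemma continuousOn_deriv_of_contDiffOn {g : ℝ → ℝ} (hg : ContDiffOn ℝ 1 g (radialInterval R)) :
    ContinuousOn (deriv g) (radialInterval R) :=
  hg.continuousOn_deriv_of_isOpen (isOpen_radialInterval R) le_rfl

lemma IsPositiveSolution.hasDerivAt_flux
    (hf : IsPositiveSolution (homDim n + 2) R V
      (fun r => W r + (homDim n : ℝ) * (deriv V r / r)) f) {r : ℝ} (hr : r ∈ radialInterval R) :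
    HasDerivAt (fun s => s ^ (n + 3) * V s * deriv f s)
      (-(r ^ (n + 3) * (W r + ((n : ℝ) + 2) * (deriv V r / r)) * f r)) r := by
  obtain ⟨h1, h2⟩ := hf.ode r hr
  have h3 := h1.hasDerivAt
  rw [eq_neg_of_add_eq_zero_left h2] at h3
  simpa [homDim] using h3

lemma continuousOn_weight (hV : ContDiffOn ℝ 1 V (radialInterval R))
    (hW : ContDiffOn ℝ 1 (fun r => W r + (homDim n : ℝ) * (deriv V r / r)) (radialInterval R)) :
    ContinuousOn W (radialInterval R) := by
  have h1 : ContinuousOn (fun r => (homDim n : ℝ) * (deriv V r / r)) (radialInterval R) :=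
    continuousOn_const.mul ((continuousOn_deriv_of_contDiffOn hV).div continuousOn_id
      fun r hr => hr.1.ne')
  exact (hW.continuousOn.sub h1).congr fun r _ => by simp

/-- The one-dimensional Rellich identity along a ray. -/
lemma integral_radial_rellich (hV : ContDiffOn ℝ 1 V (radialInterval R))
    (hW : ContinuousOn W (radialInterval R))
    (hf : IsPositiveSolution (homDim n + 2) R V
      (fun r => W r + (homDim n : ℝ) * (deriv V r / r)) f)
    {a b : ℝ} (hab : a ≤ b) (hsub : Icc a b ⊆ radialInterval R) {y y' : ℝ → ℝ}
    (hy : ∀ r ∈ Icc a b, HasDerivAt y (y' r) r) (hy' : ContinuousOn y' (Icc a b))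
    (ha : y a = 0) (hb : y b = 0) :
    ∫ r in a..b, (V r * (y' r + (n + 1) * y r / r) ^ 2 - W r * y r ^ 2 -
      V r * ((y' r * r * f r - y r * (f r + r * deriv f r)) / (r * f r) ^ 2) ^ 2 *
        r ^ 2 * f r ^ 2) * r ^ (n + 1) = 0 := by
  have hyc : ContinuousOn y (Icc a b) := fun r hr => (hy r hr).continuousAt.continuousWithinAt
  have hVc : ContinuousOn V (Icc a b) := hV.continuousOn.mono hsub
  have hWc : ContinuousOn W (Icc a b) := hW.mono hsub
  have hfc : ContinuousOn f (Icc a b) := hf.contDiffOn.continuousOn.mono hsub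
  have hfc' : ContinuousOn (deriv f) (Icc a b) :=
    (continuousOn_deriv_of_contDiffOn hf.contDiffOn).mono hsub
  have h0 : ∀ r ∈ Icc a b, r ≠ 0 := fun r hr => (hsub hr).1.ne'
  have hf0 : ∀ r ∈ Icc a b, r * f r ≠ 0 := fun r hr =>
    mul_ne_zero (h0 r hr) (hf.pos r (hsub hr)).ne'
  have hf2 : ∀ r ∈ Icc a b, (r * f r) ^ 2 ≠ 0 := fun r hr => pow_ne_zero 2 (hf0 r hr)
  -- The integrand has an explicit primitive. The derivative of its first term absorbs the cross
  -- term of the square and produces the shift Q V_r/r of the potential. The second term comes from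
  -- the ground-state substitution and is grouped around the flux r^(n+3) V f', because only this
  -- product, and not f', is known to be differentiable.
  have key : ∀ r ∈ uIcc a b, HasDerivAt
      (fun r => (n + 2) * (V r * r ^ n * y r ^ 2) +
        (r ^ (n + 3) * V r * deriv f r) * y r ^ 2 / (r ^ 2 * f r))
      ((V r * (y' r + (n + 1) * y r / r) ^ 2 - W r * y r ^ 2 -
        V r * ((y' r * r * f r - y r * (f r + r * deriv f r)) / (r * f r) ^ 2) ^ 2 *
        r ^ 2 * f r ^ 2) * r ^ (n + 1)) r := by
    intro r hr
    rw [uIcc_of_le hab] at hr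
    have hr' := hsub hr
    have hr0 := h0 r hr
    have hfp := (hf.pos r hr').ne'
    have d1 := (((hasDerivAt_of_contDiffOn hV hr').mul (hasDerivAt_pow n r)).mul
      ((hy r hr).pow 2)).const_mul ((n : ℝ) + 2)
    have d2 := ((hf.hasDerivAt_flux hr').mul ((hy r hr).pow 2)).div
      ((hasDerivAt_pow 2 r).mul (hasDerivAt_of_contDiffOn hf.contDiffOn hr'))
      (mul_ne_zero (pow_ne_zero 2 hr0) hfp)
    refine (d1.add d2).congr_deriv ?_
    -- The exponent n − 1 is truncated; the factor n makes the formula correct at n = 0 as well.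
    have hn : (n : ℝ) * r ^ (n - 1) = n * r ^ n / r := by
      rcases n with _ | m
      · simp
      · field_simp; simp [pow_succ]
    simp only [Pi.mul_apply, Pi.pow_apply]
    rw [hn]
    field_simp
    push_cast
    ring
  have hcont : ContinuousOn (fun r => (V r * (y' r + (n + 1) * y r / r) ^ 2 - W r * y r ^ 2 -
      V r * ((y' r * r * f r - y r * (f r + r * deriv f r)) / (r * f r) ^ 2) ^ 2 *
        r ^ 2 * f r ^ 2) * r ^ (n + 1)) (uIcc a b) := by
    rw [uIcc_of_le hab]
    fun_prop (disch := assumption)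
  rw [intervalIntegral.integral_eq_sub_of_hasDerivAt key hcont.intervalIntegrable]
  simp [ha, hb]

/-- The one-dimensional inequality along a ray for the angular part. -/
lemma integral_angular_nonneg (hV : ContDiffOn ℝ 1 V (radialInterval R))
    (hW : ContinuousOn W (radialInterval R))
    (hf : IsPositiveSolution (homDim n + 2) R V
      (fun r => W r + (homDim n : ℝ) * (deriv V r / r)) f)
    (hV0 : ∀ r ∈ radialInterval R, 0 ≤ V r)
    (hV' : ∀ r ∈ radialInterval R, DifferentiableAt ℝ (deriv V) r)
    (hVV : ∀ r ∈ radialInterval R,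
      0 ≤ ((homDim n : ℝ) - 5) * (V r / r ^ 2) + 3 * (deriv V r / r) - deriv (deriv V) r)
    {a b : ℝ} (hab : a ≤ b) (hsub : Icc a b ⊆ radialInterval R) {g g₁ g₂ : ℝ → ℝ}
    (hg : ∀ r ∈ Icc a b, HasDerivAt g (g₁ r / r) r)
    (hg₁ : ∀ r ∈ Icc a b, HasDerivAt g₁ (g₂ r / r) r) (hg₂ : ContinuousOn g₂ (Icc a b))
    (ha : g a = 0) (hb : g b = 0) :
    0 ≤ ∫ r in a..b, (-2 * V r * g r * (g₂ r + n * g₁ r) / r ^ 4 +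
      (n + 1) * V r * g r ^ 2 / r ^ 4 - W r * g r ^ 2 / r ^ 2 - V r * g₁ r ^ 2 / r ^ 4) *
        r ^ (n + 1) := by
  have hgc : ContinuousOn g (Icc a b) := fun r hr => (hg r hr).continuousAt.continuousWithinAt
  have hgc₁ : ContinuousOn g₁ (Icc a b) := fun r hr => (hg₁ r hr).continuousAt.continuousWithinAt
  have hVc : ContinuousOn V (Icc a b) := hV.continuousOn.mono hsub
  have hWc : ContinuousOn W (Icc a b) := hW.mono hsub
  have h0 : ∀ r ∈ Icc a b, r ≠ 0 := fun r hr => (hsub hr).1.ne'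
  have h02 : ∀ r ∈ Icc a b, r ^ 2 ≠ 0 := fun r hr => pow_ne_zero 2 (h0 r hr)
  have h04 : ∀ r ∈ Icc a b, r ^ 4 ≠ 0 := fun r hr => pow_ne_zero 4 (h0 r hr)
  -- Here g₁ and g₂ stand for r g' and r g₁'. The first two terms of the primitive integrate −2Vg(g₂
  -- + n g₁) by parts, and the third completes the square of (g/r²)' − (f'/f)(g/r²), where (g₁ −
  -- 2g)/r³ = (g/r²)'. What is left over is the assumed nonnegative expression in V times g².
  have key : ∀ r ∈ Icc a b, HasDerivAt
      (fun r => (-2) * (V r * r ^ n * (g r * g₁ r) / r ^ 2) +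
        deriv V r * r ^ n * g r ^ 2 / r +
        (r ^ (n + 3) * V r * deriv f r) * g r ^ 2 / (r ^ 4 * f r))
      ((-2 * V r * g r * (g₂ r + n * g₁ r) / r ^ 4 +
      (n + 1) * V r * g r ^ 2 / r ^ 4 - W r * g r ^ 2 / r ^ 2 - V r * g₁ r ^ 2 / r ^ 4) *
        r ^ (n + 1) - (V r * r ^ (n + 3) * ((g₁ r - 2 * g r) / r ^ 3 -
          deriv f r / f r * (g r / r ^ 2)) ^ 2 + (((homDim n : ℝ) - 5) * (V r / r ^ 2) +
          3 * (deriv V r / r) - deriv (deriv V) r) * (g r ^ 2 * r ^ (n + 1) / r ^ 2))) r := by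
    intro r hr
    have hr' := hsub hr
    have hr0 := h0 r hr
    have hfp := (hf.pos r hr').ne'
    have dV := hasDerivAt_of_contDiffOn hV hr'
    have d1 := (((dV.mul (hasDerivAt_pow n r)).mul ((hg r hr).mul (hg₁ r hr))).div
      (hasDerivAt_pow 2 r) (h02 r hr)).const_mul (-2 : ℝ)
    have d2 := (((hV' r hr').hasDerivAt.mul (hasDerivAt_pow n r)).mul ((hg r hr).pow 2)).div
      (hasDerivAt_id r) hr0
    have d3 := ((hf.hasDerivAt_flux hr').mul ((hg r hr).pow 2)).div
      ((hasDerivAt_pow 4 r).mul (hasDerivAt_of_contDiffOn hf.contDiffOn hr'))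
      (mul_ne_zero (h04 r hr) hfp)
    refine ((d1.add d2).add d3).congr_deriv ?_
    have hn : (n : ℝ) * r ^ (n - 1) = n * r ^ n / r := by
      rcases n with _ | m
      · simp
      · field_simp; simp [pow_succ]
    simp only [Pi.mul_apply, Pi.pow_apply, homDim, id]
    rw [hn]
    field_simp
    push_cast
    ring
  have hcont : ContinuousOn (fun r => (-2 * V r * g r * (g₂ r + n * g₁ r) / r ^ 4 +
      (n + 1) * V r * g r ^ 2 / r ^ 4 - W r * g r ^ 2 / r ^ 2 - V r * g₁ r ^ 2 / r ^ 4) *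
        r ^ (n + 1)) (Icc a b) := by
    fun_prop (disch := assumption)
  -- V'' exists only pointwise and need not be integrable, so the exact derivative is never
  -- integrated. It is bounded above by the continuous integrand, and the one-sided fundamental
  -- theorem suffices.
  have := intervalIntegral.sub_le_integral_of_hasDeriv_right_of_le hab
    (fun r hr => (key r hr).continuousAt.continuousWithinAt)
    (fun r hr => (key r (Ioo_subset_Icc_self hr)).hasDerivWithinAt)
    hcont.integrableOn_Icc (fun r hr => by
      have hr' := hsub (Ioo_subset_Icc_self hr)
      have h1 := hV0 r hr'
      have h2 := hVV r hr'
      have h3 := hr'.1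
      refine sub_le_self _ (add_nonneg (by positivity) (mul_nonneg h2 (by positivity))))
  simpa [ha, hb] using this

end Ray

/-! ### The gauge norm and its first derivatives. -/

section Gauge

variable {n : ℕ}

lemma gaugeNorm_nonneg (p : Space n) : 0 ≤ gaugeNorm p := by
  unfold gaugeNorm; positivity

lemma gaugeNorm_pow_four (p : Space n) : gaugeNorm p ^ 4 = ‖p.1‖ ^ 4 + 4 * p.2 ^ 2 := by
  unfold gaugeNorm
  rw [← Real.rpow_natCast, ← Real.rpow_mul (by positivity)]
  norm_num

lemma gaugeNorm_pos {p : Space n} (hp : p ≠ 0) : 0 < gaugeNorm p := by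
  refine lt_of_le_of_ne (gaugeNorm_nonneg p) fun h => hp ?_
  have h1 := gaugeNorm_pow_four p
  rw [← h] at h1
  have h2 : ‖p.1‖ ^ 4 = 0 := by nlinarith [sq_nonneg p.2, pow_nonneg (norm_nonneg p.1) 4]
  have h3 : p.2 ^ 2 = 0 := by nlinarith [sq_nonneg p.2, pow_nonneg (norm_nonneg p.1) 4]
  exact Prod.ext (by simpa using h2) (by simpa using h3)

lemma gaugeNorm_zero : gaugeNorm (0 : Space n) = 0 := by
  simp [gaugeNorm]

lemma ne_zero_of_gaugeNorm_pos {p : Space n} (hp : 0 < gaugeNorm p) : p ≠ 0 := by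
  rintro rfl
  simp [gaugeNorm_zero] at hp

lemma continuous_gaugeNorm : Continuous (gaugeNorm (n := n)) := by
  unfold gaugeNorm
  exact Continuous.rpow_const (by fun_prop) fun _ => Or.inr (by norm_num)

lemma gaugeNorm_dilation {s : ℝ} (hs : 0 ≤ s) (p : Space n) :
    gaugeNorm (dilation s p) = s * gaugeNorm p := by
  refine (pow_left_inj₀ (gaugeNorm_nonneg _) (mul_nonneg hs (gaugeNorm_nonneg _))
    (n := 4) (by norm_num)).1 ?_
  rw [mul_pow, gaugeNorm_pow_four, gaugeNorm_pow_four]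
  simp only [dilation, norm_smul, Real.norm_eq_abs, abs_of_nonneg hs]
  ring

lemma norm_fst_le_gaugeNorm (p : Space n) : ‖p.1‖ ≤ gaugeNorm p := by
  refine le_of_pow_le_pow_left₀ (n := 4) (by norm_num) (gaugeNorm_nonneg p) ?_
  rw [gaugeNorm_pow_four]
  nlinarith [sq_nonneg p.2]

lemma abs_snd_le_gaugeNorm_sq (p : Space n) : |p.2| ≤ gaugeNorm p ^ 2 := by
  refine abs_le_of_sq_le_sq ?_ (by positivity)
  rw [← pow_mul, gaugeNorm_pow_four]
  nlinarith [sq_nonneg p.2, pow_nonneg (norm_nonneg p.1) 4]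

lemma isCompact_gaugeNorm_le (b : ℝ) : IsCompact {p : Space n | gaugeNorm p ≤ b} := by
  refine Metric.isCompact_of_isClosed_isBounded
    (isClosed_le continuous_gaugeNorm continuous_const) ?_
  refine ((Metric.isBounded_closedBall (x := (0 : EuclideanSpace ℝ (Fin n))) (r := b)).prod
    (Metric.isBounded_closedBall (x := (0 : ℝ)) (r := b ^ 2))).subset fun p hp => ?_
  have hp' : gaugeNorm p ≤ b := hp
  refine ⟨?_, ?_⟩
  · simpa using (norm_fst_le_gaugeNorm p).trans hp'
  · simpa using (abs_snd_le_gaugeNorm_sq p).trans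
      (pow_le_pow_left₀ (gaugeNorm_nonneg p) hp' 2)

lemma contDiffAt_gaugeNorm {p : Space n} (hp : p ≠ 0) {k : WithTop ℕ∞} :
    ContDiffAt ℝ k (gaugeNorm (n := n)) p := by
  have h0 : (‖p.1‖ ^ 4 + 4 * p.2 ^ 2) ≠ 0 := by
    rw [← gaugeNorm_pow_four]
    exact pow_ne_zero 4 (gaugeNorm_pos hp).ne'
  have h1 : ContDiff ℝ k (fun p : Space n => ‖p.1‖ ^ 4 + 4 * p.2 ^ 2) := by
    have h2 : ContDiff ℝ k (fun p : Space n => (‖p.1‖ ^ 2) ^ 2 + 4 * p.2 ^ 2) :=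
      ((contDiff_fst.norm_sq ℝ).pow 2).add (contDiff_const.mul (contDiff_snd.pow 2))
    simpa only [← pow_mul] using h2
  exact h1.contDiffAt.rpow_const_of_ne h0

lemma fderiv_gaugeNorm {p : Space n} (hp : p ≠ 0) (v : Space n) :
    fderiv ℝ gaugeNorm p v =
      (‖p.1‖ ^ 2 * inner ℝ p.1 v.1 + 2 * p.2 * v.2) / gaugeNorm p ^ 3 := by
  have hd : HasFDerivAt gaugeNorm (fderiv ℝ gaugeNorm p) p :=
    ((contDiffAt_gaugeNorm hp (k := 1)).differentiableAt one_ne_zero).hasFDerivAt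
  -- The formula comes from comparing two derivatives of ϱ⁴: the chain rule gives 4ϱ³Dϱ, and the
  -- polynomial expression is differentiated directly.
  have h1 := hd.pow 4
  have h2 : HasFDerivAt (fun p : Space n => gaugeNorm p ^ 4) _ p := h1
  have h3 : (fun p : Space n => gaugeNorm p ^ 4) = fun p => (‖p.1‖ ^ 2) ^ 2 + 4 * p.2 ^ 2 := by
    ext p; rw [gaugeNorm_pow_four]; ring
  rw [h3] at h2
  have h4 := (((hasFDerivAt_fst (𝕜 := ℝ) (p := p)).norm_sq).pow 2).add
    (((hasFDerivAt_snd (𝕜 := ℝ) (p := p)).pow 2).const_mul 4)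
  have h5 := congrArg (fun L => L v) (h2.unique h4)
  have h6 := gaugeNorm_pos hp
  simp at h5
  field_simp
  nlinarith [h5]

lemma partialX_gaugeNorm {p : Space n} (hp : p ≠ 0) (i : Fin n) :
    partialX i gaugeNorm p = ‖p.1‖ ^ 2 * p.1 i / gaugeNorm p ^ 3 := by
  rw [partialX, fderiv_gaugeNorm hp]
  simp [EuclideanSpace.inner_single_right]

lemma partialT_gaugeNorm {p : Space n} (hp : p ≠ 0) :
    partialT gaugeNorm p = 2 * p.2 / gaugeNorm p ^ 3 := by
  rw [partialT, fderiv_gaugeNorm hp]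
  simp

end Gauge

/-! ### The radial field Z, the angular form Γ, and their behaviour under dilations. -/

section Calculus

variable {n : ℕ}

/-- The generator of the dilations, `Z u = x · ∇ₓ u + 2 t ∂ₜ u = ϱ u_ϱ`. -/
def euler (u : Space n → ℝ) (p : Space n) : ℝ := fderiv ℝ u p (p.1, 2 * p.2)

lemma fderiv_eq_sum (u : Space n → ℝ) (p v : Space n) :
    fderiv ℝ u p v = ∑ i, v.1 i * partialX i u p + v.2 * partialT u p := by
  have h1 : v = ∑ i, v.1 i • ((EuclideanSpace.single i 1, 0) : Space n) +
      v.2 • ((0, 1) : Space n) := by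
    have h2 := (EuclideanSpace.basisFun (Fin n) ℝ).sum_repr v.1
    simp only [EuclideanSpace.basisFun_apply, EuclideanSpace.basisFun_repr] at h2
    refine Prod.ext ?_ ?_
    · simp [Prod.fst_sum, h2]
    · simp [Prod.snd_sum]
  conv_lhs => rw [h1]
  simp only [map_add, map_sum, map_smul, smul_eq_mul, partialX, partialT]

lemma euler_eq_sum (u : Space n → ℝ) (p : Space n) :
    euler u p = ∑ i, p.1 i * partialX i u p + 2 * p.2 * partialT u p :=
  fderiv_eq_sum u p _

lemma euler_gaugeNorm {p : Space n} (hp : p ≠ 0) : euler gaugeNorm p = gaugeNorm p := by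
  rw [euler, fderiv_gaugeNorm hp]
  have h := gaugeNorm_pow_four p
  have h0 := gaugeNorm_pos hp
  simp only [real_inner_self_eq_norm_sq]
  field_simp
  linarith

lemma sum_sq_eq_norm_sq (x : EuclideanSpace ℝ (Fin n)) : ∑ i, x i ^ 2 = ‖x‖ ^ 2 := by
  simp [EuclideanSpace.norm_sq_eq]

/-- The weight `|∇_G ϱ|² = |x|² / ϱ²`. -/
def angularWeight (p : Space n) : ℝ := ‖p.1‖ ^ 2 / gaugeNorm p ^ 2

lemma gradSq_gaugeNorm {p : Space n} (hp : p ≠ 0) :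
    gradSq gaugeNorm p = angularWeight p := by
  simp only [gradSq, partialX_gaugeNorm hp, partialT_gaugeNorm hp, angularWeight, div_pow, mul_pow,
    ← Finset.sum_div, ← Finset.mul_sum, sum_sq_eq_norm_sq]
  have h := gaugeNorm_pow_four p
  have h0 := gaugeNorm_pos hp
  field_simp
  rw [h]
  ring

/-- The bilinear form `ϱ² ∇_G h · ∇_G u - |∇_G ϱ|² Zh Zu` of the angular part of the gradient. -/
def angularForm (h u : Space n → ℝ) (p : Space n) : ℝ :=
  gaugeNorm p ^ 2 * (∑ i, partialX i h p * partialX i u p +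
    ‖p.1‖ ^ 2 * (partialT h p * partialT u p)) - angularWeight p * (euler h p * euler u p)

lemma angularForm_comm (h u : Space n → ℝ) (p : Space n) :
    angularForm h u p = angularForm u h p := by
  simp only [angularForm, mul_comm (partialX _ h p), mul_comm (partialT h p),
    mul_comm (euler h p)]

lemma gradSq_eq_angularForm (u : Space n → ℝ) {p : Space n} (hp : p ≠ 0) :
    gradSq u p = angularWeight p * (euler u p / gaugeNorm p) ^ 2 +
      angularForm u u p / gaugeNorm p ^ 2 := by
  have h0 := gaugeNorm_pos hp
  simp only [gradSq, angularForm, mul_pow]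
  field_simp
  ring

/-- The component of the angular gradient in the direction of `xᵢ`. -/
def angularX (i : Fin n) (u : Space n → ℝ) (p : Space n) : ℝ :=
  gaugeNorm p * partialX i u p - ‖p.1‖ ^ 2 * p.1 i / gaugeNorm p ^ 3 * euler u p

/-- The component of the angular gradient in the direction of `t`. -/
def angularT (u : Space n → ℝ) (p : Space n) : ℝ :=
  ‖p.1‖ * (gaugeNorm p * partialT u p - 2 * p.2 / gaugeNorm p ^ 3 * euler u p)

/-- The components are those of ϱ(∇_G u − (Zu/ϱ)∇_G ϱ). Since ∇_G ϱ · ∇_G u = ψZu/ϱ and |∇_G ϱ|² =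
ψ, this is ϱ times the orthogonal projection of ∇_G u off ∇_G ϱ. Writing Γ as a sum of products
allows one-dimensional inequalities to be applied component by component. -/
lemma angularForm_eq_sum (h u : Space n → ℝ) {p : Space n} (hp : p ≠ 0) :
    angularForm h u p = ∑ i, angularX i h p * angularX i u p + angularT h p * angularT u p := by
  have h0 := gaugeNorm_pos hp
  have h4 := gaugeNorm_pow_four p
  have hh := euler_eq_sum h p
  have hu := euler_eq_sum u p
  have e1 : ∀ i, angularX i h p * angularX i u p =
      gaugeNorm p ^ 2 * (partialX i h p * partialX i u p) -
      ‖p.1‖ ^ 2 / gaugeNorm p ^ 2 * euler h p * (p.1 i * partialX i u p) -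
      ‖p.1‖ ^ 2 / gaugeNorm p ^ 2 * euler u p * (p.1 i * partialX i h p) +
      ‖p.1‖ ^ 4 / gaugeNorm p ^ 6 * euler h p * euler u p * p.1 i ^ 2 := by
    intro i
    simp only [angularX]
    field_simp
    ring
  simp only [e1, Finset.sum_add_distrib, Finset.sum_sub_distrib, ← Finset.mul_sum,
    sum_sq_eq_norm_sq, angularForm, angularT, angularWeight]
  rw [eq_sub_of_add_eq hh.symm, eq_sub_of_add_eq hu.symm]
  generalize ∑ i, partialX i h p * partialX i u p = S
  generalize euler h p = a
  generalize euler u p = b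
  generalize partialT h p = c
  generalize partialT u p = d
  have h4' : gaugeNorm p ^ 4 - ‖p.1‖ ^ 4 - 4 * p.2 ^ 2 = 0 := by linarith
  field_simp
  linear_combination (a * b * ‖p.1‖ ^ 2) * h4'

lemma hasFDerivAt_radial_mul {w : ℝ → ℝ} {w' : ℝ} {h : Space n → ℝ} {p : Space n} (hp : p ≠ 0)
    (hw : HasDerivAt w w' (gaugeNorm p)) (hh : DifferentiableAt ℝ h p) :
    HasFDerivAt (fun q => w (gaugeNorm q) * h q)
      (w (gaugeNorm p) • fderiv ℝ h p + h p • w' • fderiv ℝ gaugeNorm p) p := by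
  have h1 := ((contDiffAt_gaugeNorm hp (k := 1)).differentiableAt one_ne_zero).hasFDerivAt
  exact (hw.comp_hasFDerivAt p h1).mul hh.hasFDerivAt

lemma euler_radial_mul {w : ℝ → ℝ} {w' : ℝ} {h : Space n → ℝ} {p : Space n} (hp : p ≠ 0)
    (hw : HasDerivAt w w' (gaugeNorm p)) (hh : DifferentiableAt ℝ h p) :
    euler (fun q => w (gaugeNorm q) * h q) p =
      w (gaugeNorm p) * euler h p + w' * gaugeNorm p * h p := by
  rw [euler, (hasFDerivAt_radial_mul hp hw hh).fderiv]
  have := euler_gaugeNorm hp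
  simp only [euler] at this
  simp only [add_apply, smul_apply, smul_eq_mul, this, euler]
  ring

/-- Γ is a derivation in its first slot and Γ(ϱ,u) = 0, because ϱ²∇_G ϱ · ∇_G u = ϱψZu and Zϱ = ϱ.
Hence radial factors pass through Γ. -/
lemma angularForm_radial_mul {w : ℝ → ℝ} {w' : ℝ} {h : Space n → ℝ} (u : Space n → ℝ)
    {p : Space n} (hp : p ≠ 0)
    (hw : HasDerivAt w w' (gaugeNorm p)) (hh : DifferentiableAt ℝ h p) :
    angularForm (fun q => w (gaugeNorm q) * h q) u p =
      w (gaugeNorm p) * angularForm h u p := by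
  have h0 := gaugeNorm_pos hp
  have e1 : ∀ i, partialX i (fun q => w (gaugeNorm q) * h q) p * partialX i u p =
      w (gaugeNorm p) * (partialX i h p * partialX i u p) +
      h p * w' * ‖p.1‖ ^ 2 / gaugeNorm p ^ 3 * (p.1 i * partialX i u p) := by
    intro i
    have := partialX_gaugeNorm hp i
    rw [partialX] at this
    rw [partialX, (hasFDerivAt_radial_mul hp hw hh).fderiv]
    simp only [add_apply, smul_apply, smul_eq_mul, this, partialX]
    ring
  have e2 : partialT (fun q => w (gaugeNorm q) * h q) p =
      w (gaugeNorm p) * partialT h p + h p * w' * (2 * p.2 / gaugeNorm p ^ 3) := by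
    have := partialT_gaugeNorm hp
    rw [partialT] at this
    rw [partialT, (hasFDerivAt_radial_mul hp hw hh).fderiv]
    simp only [add_apply, smul_apply, smul_eq_mul, this, partialT]
    ring
  have hu := euler_eq_sum u p
  simp only [angularForm, e1, e2, euler_radial_mul hp hw hh, Finset.sum_add_distrib,
    ← Finset.mul_sum, angularWeight]
  rw [eq_sub_of_add_eq hu.symm]
  field_simp
  ring

lemma contDiff_fderiv_apply {u : Space n → ℝ} (hu : ContDiff ℝ ∞ u) (v : Space n) :
    ContDiff ℝ ∞ (fun p => fderiv ℝ u p v) :=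
  (hu.fderiv_right (m := ∞) (by simp)).clm_apply contDiff_const

lemma contDiff_partialX {u : Space n → ℝ} (hu : ContDiff ℝ ∞ u) (i : Fin n) :
    ContDiff ℝ ∞ (partialX i u) := contDiff_fderiv_apply hu _

lemma contDiff_partialT {u : Space n → ℝ} (hu : ContDiff ℝ ∞ u) :
    ContDiff ℝ ∞ (partialT u) := contDiff_fderiv_apply hu _

lemma contDiff_euler {u : Space n → ℝ} (hu : ContDiff ℝ ∞ u) : ContDiff ℝ ∞ (euler u) :=
  (hu.fderiv_right (m := ∞) (by simp)).clm_apply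
    (contDiff_fst.prodMk (contDiff_const.mul contDiff_snd))

/-- The commutator of a constant field with Z only sees the linear map (x,t) ↦ (x,2t); the
second-order terms agree by symmetry of the Hessian. -/
lemma fderiv_euler_apply {u : Space n → ℝ} (hu : ContDiff ℝ ∞ u) (p v : Space n) :
    fderiv ℝ (euler u) p v =
      euler (fun q => fderiv ℝ u q v) p + fderiv ℝ u p (v.1, 2 * v.2) := by
  have hd : DifferentiableAt ℝ (fderiv ℝ u) p :=
    (hu.fderiv_right (m := ∞) (by simp)).differentiable (by simp) p
  let ζ : Space n →L[ℝ] Space n :=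
    (ContinuousLinearMap.fst ℝ _ _).prod ((2 : ℝ) • ContinuousLinearMap.snd ℝ _ _)
  have h1 : HasFDerivAt (euler u) _ p := hd.hasFDerivAt.clm_apply ζ.hasFDerivAt
  have h2 : HasFDerivAt (fun q => fderiv ℝ u q v) _ p :=
    hd.hasFDerivAt.clm_apply (hasFDerivAt_const v p)
  have hs : IsSymmSndFDerivAt ℝ u p := (contDiff_infty.1 hu 2).contDiffAt.isSymmSndFDerivAt (by simp)
  rw [h1.fderiv, euler, h2.fderiv]
  have := hs.eq v (p.1, 2 * p.2)
  simp [ζ, this, add_comm]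

lemma partialX_euler {u : Space n → ℝ} (hu : ContDiff ℝ ∞ u) (i : Fin n) (p : Space n) :
    partialX i (euler u) p = euler (partialX i u) p + partialX i u p := by
  have := fderiv_euler_apply hu p (EuclideanSpace.single i 1, 0)
  rwa [mul_zero] at this

lemma partialT_euler {u : Space n → ℝ} (hu : ContDiff ℝ ∞ u) (p : Space n) :
    partialT (euler u) p = euler (partialT u) p + 2 * partialT u p := by
  have := fderiv_euler_apply hu p (0, 1)
  have h2 : ((0, 2 * 1) : Space n) = (2 : ℝ) • (0, 1) := by simp
  simp only [partialT, this, h2, map_smul, smul_eq_mul]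
  rfl

lemma hasDerivAt_dilation (s : ℝ) (p : Space n) :
    HasDerivAt (fun s : ℝ => dilation s p) (p.1, 2 * s * p.2) s := by
  have h1 : HasDerivAt (fun s : ℝ => s • p.1) p.1 s := by
    simpa using (hasDerivAt_id s).smul_const p.1
  have h2 : HasDerivAt (fun s : ℝ => s ^ 2 * p.2) (2 * s * p.2) s := by
    simpa using (hasDerivAt_pow 2 s).mul_const p.2
  exact h1.prodMk h2

lemma hasDerivAt_comp_dilation {u : Space n → ℝ} {s : ℝ} (hs : s ≠ 0) {p : Space n}
    (hu : DifferentiableAt ℝ u (dilation s p)) :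
    HasDerivAt (fun s => u (dilation s p)) (euler u (dilation s p) / s) s := by
  have h1 := hu.hasFDerivAt.comp_hasDerivAt s (hasDerivAt_dilation s p)
  refine h1.congr_deriv ?_
  rw [euler, div_eq_inv_mul, ← smul_eq_mul s⁻¹, ← map_smul]
  congr 1
  simp only [dilation, Prod.smul_mk, smul_smul, inv_mul_cancel₀ hs, one_smul, smul_eq_mul]
  field_simp

lemma dilation_one (p : Space n) : dilation 1 p = p := by simp [dilation]

lemma radialDeriv_eq {u : Space n → ℝ} (hu : Differentiable ℝ u) (p : Space n) :
    radialDeriv u p = euler u p / gaugeNorm p := by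
  -- At the origin ϱ = 0, and division by zero makes both sides zero: the differentiated function is
  -- constant on the left, and the quotient vanishes on the right.
  by_cases hp : p = 0
  · subst hp
    simp [radialDeriv, gaugeNorm_zero, dilation]
  have h0 := (gaugeNorm_pos hp).ne'
  have h1 : HasDerivAt (fun s => u (dilation s p)) (euler u p / 1)
      (gaugeNorm p / gaugeNorm p) := by
    have := hasDerivAt_comp_dilation (p := p) (u := u) one_ne_zero (hu _)
    rw [dilation_one] at this
    rwa [div_self h0]
  have h2 := HasDerivAt.comp (h := fun s => s / gaugeNorm p) (gaugeNorm p) h1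
    ((hasDerivAt_id' _).div_const (gaugeNorm p))
  have h3 := h2.deriv
  simp only [Function.comp_def] at h3
  rw [radialDeriv, h3]
  ring

/-- The operator ϱ∂ᵢ − (|x|²xᵢ/ϱ³)Z is homogeneous of degree zero under dilations, hence commutes
with Z. The same reason applies to the t-component, where |x|ϱ has degree 2 and ∂ₜ has degree −2. -/
lemma hasDerivAt_angularX_dilation {u : Space n → ℝ} (hu : ContDiff ℝ ∞ u) (i : Fin n) {s : ℝ}
    (hs : 0 < s) {p : Space n} (hp : p ≠ 0) :
    HasDerivAt (fun s => angularX i u (dilation s p)) (angularX i (euler u) (dilation s p) / s)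
      s := by
  have h0 := gaugeNorm_pos hp
  have e : ∀ v : Space n → ℝ, ∀ r : ℝ, 0 < r → angularX i v (dilation r p) =
      r * gaugeNorm p * partialX i v (dilation r p) -
        ‖p.1‖ ^ 2 * p.1 i / gaugeNorm p ^ 3 * euler v (dilation r p) := by
    intro v r hr
    rw [angularX, gaugeNorm_dilation hr.le]
    simp only [dilation, norm_smul, Real.norm_eq_abs, abs_of_pos hr, PiLp.smul_apply, smul_eq_mul]
    field_simp
  have d1 := ((hasDerivAt_id s).mul_const (gaugeNorm p)).mul (hasDerivAt_comp_dilation (p := p) hs.ne'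
    ((contDiff_partialX hu i).differentiable (by simp) _))
  have d2 := (hasDerivAt_comp_dilation (p := p) hs.ne'
    ((contDiff_euler hu).differentiable (by simp) _)).const_mul
      (‖p.1‖ ^ 2 * p.1 i / gaugeNorm p ^ 3)
  refine ((d1.sub d2).congr_of_eventuallyEq ?_).congr_deriv ?_
  · filter_upwards [lt_mem_nhds hs] with r hr
    exact e u r hr
  · rw [e _ s hs, partialX_euler hu]
    simp only [id]
    field_simp
    ring

lemma hasDerivAt_angularT_dilation {u : Space n → ℝ} (hu : ContDiff ℝ ∞ u) {s : ℝ}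
    (hs : 0 < s) {p : Space n} (hp : p ≠ 0) :
    HasDerivAt (fun s => angularT u (dilation s p)) (angularT (euler u) (dilation s p) / s)
      s := by
  have h0 := gaugeNorm_pos hp
  have e : ∀ v : Space n → ℝ, ∀ r : ℝ, 0 < r → angularT v (dilation r p) =
      ‖p.1‖ * (gaugeNorm p * (r ^ 2 * partialT v (dilation r p)) -
        2 * p.2 / gaugeNorm p ^ 3 * euler v (dilation r p)) := by
    intro v r hr
    rw [angularT, gaugeNorm_dilation hr.le]
    simp only [dilation, norm_smul, Real.norm_eq_abs, abs_of_pos hr]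
    field_simp
  have d1 := ((hasDerivAt_pow 2 s).mul (hasDerivAt_comp_dilation (p := p) hs.ne'
    ((contDiff_partialT hu).differentiable (by simp) _))).const_mul (gaugeNorm p)
  have d2 := (hasDerivAt_comp_dilation (p := p) hs.ne'
    ((contDiff_euler hu).differentiable (by simp) _)).const_mul
      (2 * p.2 / gaugeNorm p ^ 3)
  refine (((d1.sub d2).const_mul ‖p.1‖).congr_of_eventuallyEq ?_).congr_deriv ?_
  · filter_upwards [lt_mem_nhds hs] with r hr
    exact e u r hr
  · rw [e _ s hs, partialT_euler hu]
    field_simp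
    push_cast
    ring

end Calculus

/-! ### Functions supported in a gauge annulus. -/

section Support

variable {n : ℕ} {a b : ℝ} {u h : Space n → ℝ}

/-- `u` vanishes off the gauge annulus `a ≤ ϱ ≤ b`. -/
def SupportedIn (a b : ℝ) (u : Space n → ℝ) : Prop := ∀ p, gaugeNorm p ∉ Icc a b → u p = 0

lemma SupportedIn.eventuallyEq (hu : SupportedIn a b u) {p : Space n}
    (hp : gaugeNorm p ∉ Icc a b) : u =ᶠ[nhds p] fun _ => 0 := by
  have : IsOpen {q : Space n | gaugeNorm q ∉ Icc a b} :=
    (isClosed_Icc.preimage continuous_gaugeNorm).isOpen_compl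
  filter_upwards [this.mem_nhds hp] with q hq
  exact hu q hq

lemma SupportedIn.fderiv_eq (hu : SupportedIn a b u) {p : Space n}
    (hp : gaugeNorm p ∉ Icc a b) : fderiv ℝ u p = 0 := by
  rw [(hu.eventuallyEq hp).fderiv_eq]
  simp

lemma SupportedIn.partialX (hu : SupportedIn a b u) (i : Fin n) :
    SupportedIn a b (Grushin.partialX i u) := fun p hp => by
  simp [Grushin.partialX, hu.fderiv_eq hp]

lemma SupportedIn.partialT (hu : SupportedIn a b u) :
    SupportedIn a b (Grushin.partialT u) := fun p hp => by
  simp [Grushin.partialT, hu.fderiv_eq hp]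

lemma SupportedIn.euler (hu : SupportedIn a b u) :
    SupportedIn a b (Grushin.euler u) := fun p hp => by
  simp [Grushin.euler, hu.fderiv_eq hp]

lemma SupportedIn.angularForm (hu : SupportedIn a b u) (h : Space n → ℝ) :
    SupportedIn a b (Grushin.angularForm h u) := fun p hp => by
  simp [Grushin.angularForm, hu.partialX _ p hp, hu.partialT p hp, hu.euler p hp]

lemma SupportedIn.grushinOp (hu : SupportedIn a b u) :
    SupportedIn a b (Grushin.grushinOp u) := fun p hp => by
  simp [Grushin.grushinOp, (hu.partialX _).partialX _ p hp, hu.partialT.partialT p hp]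

lemma SupportedIn.mul_left (hu : SupportedIn a b u) (h : Space n → ℝ) :
    SupportedIn a b (fun p => h p * u p) := fun p hp => by simp [hu p hp]

lemma SupportedIn.continuous (hu : SupportedIn a b u)
    (hc : ∀ p, gaugeNorm p ∈ Icc a b → ContinuousAt u p) : Continuous u := by
  refine continuous_iff_continuousAt.2 fun p => ?_
  by_cases hp : gaugeNorm p ∈ Icc a b
  · exact hc p hp
  · exact continuousAt_const.congr (hu.eventuallyEq hp).symm

lemma SupportedIn.contDiff (hu : SupportedIn a b u) {k : WithTop ℕ∞}
    (hc : ∀ p, gaugeNorm p ∈ Icc a b → ContDiffAt ℝ k u p) : ContDiff ℝ k u := by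
  refine contDiff_iff_contDiffAt.2 fun p => ?_
  by_cases hp : gaugeNorm p ∈ Icc a b
  · exact hc p hp
  · exact contDiffAt_const.congr_of_eventuallyEq (hu.eventuallyEq hp)

lemma SupportedIn.hasCompactSupport (hu : SupportedIn a b u) : HasCompactSupport u :=
  HasCompactSupport.intro (isCompact_gaugeNorm_le b) fun p hp => hu p fun h => hp h.2

lemma SupportedIn.integrable (hu : SupportedIn a b u)
    (hc : ∀ p, gaugeNorm p ∈ Icc a b → ContinuousAt u p) : Integrable u :=
  (hu.continuous hc).integrable_of_hasCompactSupport hu.hasCompactSupport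

/-- Two nested annuli are needed: the support lies in [a₁,b₁], so all boundary terms of the ray
integrals over [a,b] vanish, while [a,b] still lies inside (0,R). -/
lemma IsTestFunction.exists_supportedIn {R : EReal} (hR : 0 < R) (hu : IsTestFunction R u) :
    ∃ a a₁ b₁ b : ℝ, 0 < a ∧ a < a₁ ∧ a₁ ≤ b₁ ∧ b₁ < b ∧ Icc a b ⊆ radialInterval R ∧
      SupportedIn a₁ b₁ u := by
  obtain ⟨r₀, hr₀, hr₀R⟩ := EReal.lt_iff_exists_real_btwn.1 hR
  have hr₀' : (0 : ℝ) < r₀ := by exact_mod_cast hr₀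
  -- The extra radius r₀ keeps the compact set nonempty when u = 0.
  have hK : IsCompact (gaugeNorm '' tsupport u ∪ {r₀}) :=
    (IsCompact.image hu.compact continuous_gaugeNorm).union isCompact_singleton
  have hne : (gaugeNorm '' tsupport u ∪ {r₀}).Nonempty := ⟨r₀, by simp⟩
  have hsub : gaugeNorm '' tsupport u ∪ {r₀} ⊆ radialInterval R := by
    rintro r (⟨p, hp, rfl⟩ | rfl)
    · obtain ⟨h1, h2⟩ := hu.support_subset hp
      exact ⟨gaugeNorm_pos h2, h1⟩
    · exact ⟨hr₀', hr₀R⟩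
  obtain ⟨a₁, ha₁, ha₁'⟩ := hK.exists_isLeast hne
  obtain ⟨b₁, hb₁, hb₁'⟩ := hK.exists_isGreatest hne
  obtain ⟨b, hb, hbR⟩ := EReal.lt_iff_exists_real_btwn.1 (hsub hb₁).2
  have ha₁0 := (hsub ha₁).1
  refine ⟨a₁ / 2, a₁, b₁, b, by linarith, by linarith, ha₁' hb₁, by exact_mod_cast hb, ?_, ?_⟩
  · intro r hr
    refine ⟨lt_of_lt_of_le (by linarith) hr.1, lt_of_le_of_lt ?_ hbR⟩
    exact_mod_cast hr.2
  · intro p hp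
    by_contra hup
    have : gaugeNorm p ∈ gaugeNorm '' tsupport u ∪ {r₀} :=
      Or.inl ⟨p, subset_tsupport u hup, rfl⟩
    exact hp ⟨ha₁' this, hb₁' this⟩

end Support

/-! ### Integration by parts for the angular operator M. -/

section Divergence

variable {n : ℕ} {a b : ℝ} {u h : Space n → ℝ}

/-- The operator `ϱ² L_G - |∇_G ϱ|² (Z² + (Q - 2) Z)`, the angular part of `ϱ² L_G`. -/
def angularOp (u : Space n → ℝ) (p : Space n) : ℝ :=
  gaugeNorm p ^ 2 * grushinOp u p - angularWeight p * (euler (euler u) p + n * euler u p)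

lemma SupportedIn.angularOp (hu : SupportedIn a b u) :
    SupportedIn a b (Grushin.angularOp u) := fun p hp => by
  simp [Grushin.angularOp, hu.grushinOp p hp, hu.euler p hp, hu.euler.euler p hp]

lemma contDiffAt_angularWeight {p : Space n} (hp : p ≠ 0) {k : WithTop ℕ∞} :
    ContDiffAt ℝ k (angularWeight (n := n)) p :=
  ((contDiff_fst.norm_sq ℝ).contDiffAt).div ((contDiffAt_gaugeNorm hp).pow 2)
    (pow_ne_zero 2 (gaugeNorm_pos hp).ne')

lemma angularWeight_dilation {s : ℝ} (hs : 0 < s) (p : Space n) :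
    angularWeight (dilation s p) = angularWeight p := by
  simp only [angularWeight, gaugeNorm_dilation hs.le]
  simp only [dilation, norm_smul, Real.norm_eq_abs, abs_of_pos hs, mul_pow]
  exact mul_div_mul_left _ _ (by positivity)

/-- ψ is homogeneous of degree zero, so its derivative along the dilation orbit vanishes. -/
lemma euler_angularWeight {p : Space n} (hp : p ≠ 0) : euler angularWeight p = 0 := by
  have h1 : DifferentiableAt ℝ (angularWeight (n := n)) (dilation 1 p) := by
    rw [dilation_one]
    exact (contDiffAt_angularWeight hp (k := 1)).differentiableAt one_ne_zero
  have h2 := hasDerivAt_comp_dilation one_ne_zero h1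
  have h3 : HasDerivAt (fun s => angularWeight (dilation s p)) 0 1 := by
    refine (hasDerivAt_const 1 (angularWeight p)).congr_of_eventuallyEq ?_
    filter_upwards [lt_mem_nhds one_pos] with s hs
    exact angularWeight_dilation hs p
  have h4 := h2.unique h3
  rwa [div_one, dilation_one] at h4

lemma contDiff_grushinOp (hu : ContDiff ℝ ∞ u) : ContDiff ℝ ∞ (grushinOp u) :=
  (ContDiff.sum fun i _ => contDiff_partialX (contDiff_partialX hu i) i).add
    ((contDiff_fst.norm_sq ℝ).mul (contDiff_partialT (contDiff_partialT hu)))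

lemma contDiffAt_angularOp (hu : ContDiff ℝ ∞ u) {p : Space n} (hp : p ≠ 0) :
    ContDiffAt ℝ ∞ (angularOp u) p :=
  (((contDiffAt_gaugeNorm hp).pow 2).mul (contDiff_grushinOp hu).contDiffAt).sub
    ((contDiffAt_angularWeight hp).mul
      ((contDiff_euler (contDiff_euler hu)).contDiffAt.add
        (contDiffAt_const.mul (contDiff_euler hu).contDiffAt)))

instance isAddHaarMeasure_volume_space : (volume : Measure (Space n)).IsAddHaarMeasure :=
  inferInstanceAs (Measure.IsAddHaarMeasure
    ((volume : Measure (EuclideanSpace ℝ (Fin n))).prod (volume : Measure ℝ)))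

lemma integral_fderiv_eq_zero {F : Space n → ℝ} (hF : ContDiff ℝ 1 F) (hc : HasCompactSupport F)
    (v : Space n) : ∫ p, fderiv ℝ F p v = 0 := by
  have hi : Integrable (fun p => fderiv ℝ F p v) :=
    ((hF.continuous_fderiv one_ne_zero).clm_apply continuous_const).integrable_of_hasCompactSupport
      (hc.fderiv_apply ℝ v)
  have := integral_mul_fderiv_eq_neg_fderiv_mul_of_integrable (μ := (volume : Measure (Space n)))
    (f := fun _ => (1 : ℝ)) (g := F) (v := v) (by simp) (by simpa using hi)
    (by simpa using hF.continuous.integrable_of_hasCompactSupport hc)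
    (fun _ _ => differentiableAt_const _) (fun p _ => hF.differentiable one_ne_zero p)
  simpa using this

/-- For h = 1 the field is ϱ²(∇ₓu, |x|²uₜ) − ψ Zu · (x,2t). The divergence of its first part is
ϱ²L_G u + 2ψZu, since ∇_G ϱ · ∇_G u = ψZu/ϱ. The dilation field has divergence n + 2 and Zψ = 0, so
the second part contributes −ψ(Z²u + (n+2)Zu). The sum is Mu, which explains the coefficient n in M;
differentiating h adds Γ(h,u). -/
lemma divergence_angularField (hu : ContDiff ℝ ∞ u) {p : Space n} (hp : p ≠ 0)
    (hh : DifferentiableAt ℝ h p) :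
    ∑ i, partialX i (fun q => h q * gaugeNorm q ^ 2 * partialX i u q -
        h q * (angularWeight q * euler u q) * q.1 i) p +
      partialT (fun q => h q * gaugeNorm q ^ 2 * (‖q.1‖ ^ 2 * partialT u q) -
        h q * (angularWeight q * euler u q) * (2 * q.2)) p =
      h p * angularOp u p + angularForm h u p := by
  have hρ : DifferentiableAt ℝ (gaugeNorm (n := n)) p :=
    (contDiffAt_gaugeNorm hp (k := 1)).differentiableAt one_ne_zero
  have hψ : DifferentiableAt ℝ (angularWeight (n := n)) p :=
    (contDiffAt_angularWeight hp (k := 1)).differentiableAt one_ne_zero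
  have hZ : DifferentiableAt ℝ (euler u) p := (contDiff_euler hu).differentiable (by simp) p
  have hX : ∀ i, DifferentiableAt ℝ (partialX i u) p := fun i =>
    (contDiff_partialX hu i).differentiable (by simp) p
  have hT : DifferentiableAt ℝ (partialT u) p := (contDiff_partialT hu).differentiable (by simp) p
  have hB : HasFDerivAt (fun q => h q * gaugeNorm q ^ 2) _ p :=
    hh.hasFDerivAt.mul (hρ.hasFDerivAt.pow 2)
  have hA : HasFDerivAt (fun q => h q * (angularWeight q * euler u q)) _ p :=
    hh.hasFDerivAt.mul (hψ.hasFDerivAt.mul hZ.hasFDerivAt)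
  have hx : ∀ i, HasFDerivAt (fun q : Space n => q.1 i)
      ((EuclideanSpace.proj i : EuclideanSpace ℝ (Fin n) →L[ℝ] ℝ).comp
        (ContinuousLinearMap.fst ℝ _ _)) p := fun i =>
    (EuclideanSpace.proj i : EuclideanSpace ℝ (Fin n) →L[ℝ] ℝ).hasFDerivAt.comp p hasFDerivAt_fst
  have hN : HasFDerivAt (fun q : Space n => ‖q.1‖ ^ 2) _ p := (hasFDerivAt_fst (𝕜 := ℝ)).norm_sq
  have e1 : ∀ i, partialX i (fun q => h q * gaugeNorm q ^ 2 * partialX i u q -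
        h q * (angularWeight q * euler u q) * q.1 i) p =
      h p * gaugeNorm p ^ 2 * partialX i (partialX i u) p +
      gaugeNorm p ^ 2 * (partialX i h p * partialX i u p) +
      2 * h p * gaugeNorm p * (‖p.1‖ ^ 2 / gaugeNorm p ^ 3) * (p.1 i * partialX i u p) -
      h p * angularWeight p * euler u p -
      h p * angularWeight p * (p.1 i * partialX i (euler u) p) -
      h p * euler u p * (p.1 i * partialX i angularWeight p) -
      angularWeight p * euler u p * (p.1 i * partialX i h p) := by
    intro i
    have := partialX_gaugeNorm hp i
    rw [partialX] at this
    have hpi : (EuclideanSpace.proj i : EuclideanSpace ℝ (Fin n) →L[ℝ] ℝ)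
      (EuclideanSpace.single i 1) = 1 := by simp
    refine (congrArg (fun L : Space n →L[ℝ] ℝ => L (EuclideanSpace.single i 1, 0))
      ((hB.mul (hX i).hasFDerivAt).sub (hA.mul (hx i))).fderiv).trans ?_
    simp only [sub_apply, add_apply, smul_apply, smul_eq_mul, partialX,
      ContinuousLinearMap.comp_apply, ContinuousLinearMap.coe_fst', hpi, this, nsmul_eq_mul]
    push_cast
    ring
  have e2 : partialT (fun q => h q * gaugeNorm q ^ 2 * (‖q.1‖ ^ 2 * partialT u q) -
        h q * (angularWeight q * euler u q) * (2 * q.2)) p =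
      h p * gaugeNorm p ^ 2 * (‖p.1‖ ^ 2 * partialT (partialT u) p) +
      gaugeNorm p ^ 2 * (‖p.1‖ ^ 2 * (partialT h p * partialT u p)) +
      2 * h p * gaugeNorm p * (2 * p.2 / gaugeNorm p ^ 3) * ‖p.1‖ ^ 2 * partialT u p -
      2 * h p * angularWeight p * euler u p -
      h p * angularWeight p * (2 * p.2 * partialT (euler u) p) -
      h p * euler u p * (2 * p.2 * partialT angularWeight p) -
      angularWeight p * euler u p * (2 * p.2 * partialT h p) := by
    have := partialT_gaugeNorm hp
    rw [partialT] at this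
    refine (congrArg (fun L : Space n →L[ℝ] ℝ => L (0, 1))
      ((hB.mul (hN.mul hT.hasFDerivAt)).sub
        (hA.mul ((hasFDerivAt_snd (𝕜 := ℝ)).const_mul 2))).fderiv).trans ?_
    simp only [sub_apply, add_apply, smul_apply, smul_eq_mul, partialT,
      ContinuousLinearMap.comp_apply, ContinuousLinearMap.coe_fst', ContinuousLinearMap.coe_snd',
      this, nsmul_eq_mul, map_zero, Pi.mul_apply]
    push_cast
    ring
  have hψ0 := euler_angularWeight hp
  rw [euler_eq_sum] at hψ0
  have h0 := gaugeNorm_pos hp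
  simp only [e1, e2, Finset.sum_add_distrib, Finset.sum_sub_distrib, ← Finset.mul_sum]
  rw [eq_neg_of_add_eq_zero_left hψ0, eq_sub_of_add_eq (euler_eq_sum (euler u) p).symm,
    eq_sub_of_add_eq (euler_eq_sum h p).symm, eq_sub_of_add_eq (euler_eq_sum u p).symm]
  simp only [angularOp, angularForm, grushinOp, Finset.sum_const, Finset.card_univ,
    Fintype.card_fin, nsmul_eq_mul]
  have hψd : angularWeight p = ‖p.1‖ ^ 2 / gaugeNorm p ^ 2 := rfl
  rw [hψd]
  field_simp
  ring

/-- Integration by parts for the angular operator. -/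
lemma integral_mul_angularOp (hu : ContDiff ℝ ∞ u) (ha : 0 < a) (hs : SupportedIn a b u)
    (hh : ∀ p, gaugeNorm p ∈ Icc a b → ContDiffAt ℝ 1 h p) :
    ∫ p, (h p * angularOp u p + angularForm h u p) = 0 := by
  have hne : ∀ p : Space n, gaugeNorm p ∈ Icc a b → p ≠ 0 := fun p hp =>
    ne_zero_of_gaugeNorm_pos (ha.trans_le hp.1)
  -- The field vanishes off the annulus together with u, so C¹ regularity of h, ϱ and ψ on the
  -- annulus alone makes it globally C¹ with compact support.
  set X : Fin n → Space n → ℝ := fun i q => h q * gaugeNorm q ^ 2 * partialX i u q -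
        h q * (angularWeight q * euler u q) * q.1 i with hX
  set Y : Space n → ℝ := fun q => h q * gaugeNorm q ^ 2 * (‖q.1‖ ^ 2 * partialT u q) -
        h q * (angularWeight q * euler u q) * (2 * q.2) with hY
  have sX : ∀ i, SupportedIn a b (X i) := fun i p hp => by
    simp [hX, hs.partialX i p hp, hs.euler p hp]
  have sY : SupportedIn a b Y := fun p hp => by
    simp [hY, hs.partialT p hp, hs.euler p hp]
  have hZ1 : ContDiff ℝ 1 (euler u) := (contDiff_euler hu).of_le (by simp)
  have cX : ∀ i, ContDiff ℝ 1 (X i) := fun i => (sX i).contDiff fun p hp => by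
    have hp0 := hne p hp
    have h1 : ContDiff ℝ 1 (partialX i u) := (contDiff_partialX hu i).of_le (by simp)
    have h2 : ContDiff ℝ 1 (fun q : Space n => q.1 i) := by fun_prop
    exact (((hh p hp).mul ((contDiffAt_gaugeNorm hp0).pow 2)).mul h1.contDiffAt).sub
      (((hh p hp).mul ((contDiffAt_angularWeight hp0).mul hZ1.contDiffAt)).mul h2.contDiffAt)
  have cY : ContDiff ℝ 1 Y := sY.contDiff fun p hp => by
    have hp0 := hne p hp
    have h1 : ContDiff ℝ 1 (partialT u) := (contDiff_partialT hu).of_le (by simp)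
    have h2 : ContDiff ℝ 1 (fun q : Space n => 2 * q.2) := by fun_prop
    exact (((hh p hp).mul ((contDiffAt_gaugeNorm hp0).pow 2)).mul
      ((contDiff_fst.norm_sq ℝ).contDiffAt.mul h1.contDiffAt)).sub
      (((hh p hp).mul ((contDiffAt_angularWeight hp0).mul hZ1.contDiffAt)).mul h2.contDiffAt)
  have heq : ∀ p, h p * angularOp u p + angularForm h u p =
      ∑ i, partialX i (X i) p + partialT Y p := by
    intro p
    by_cases hp : gaugeNorm p ∈ Icc a b
    · exact (divergence_angularField hu (hne p hp)
        ((hh p hp).differentiableAt one_ne_zero)).symm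
    · simp [hs.angularOp p hp, hs.angularForm h p hp, (sX _).partialX _ p hp, sY.partialT p hp]
  have hi : ∀ {F : Space n → ℝ}, SupportedIn a b F → ContDiff ℝ 1 F → ∀ v : Space n,
      Integrable (fun p => fderiv ℝ F p v) := fun sF cF v =>
    ((cF.continuous_fderiv one_ne_zero).clm_apply continuous_const).integrable_of_hasCompactSupport
      (sF.hasCompactSupport.fderiv_apply ℝ v)
  simp only [heq, partialX, partialT]
  rw [integral_add (integrable_finsetSum _ fun i _ => hi (sX i) (cX i) _) (hi sY cY _),
    integral_finsetSum _ fun i _ => hi (sX i) (cX i) _]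
  simp [integral_fderiv_eq_zero (cX _) (sX _).hasCompactSupport,
    integral_fderiv_eq_zero cY sY.hasCompactSupport]

end Divergence

/-! ### Polar coordinates adapted to the gauge. -/

section Polar

variable {n : ℕ}

/-- The unit sphere of `ℝⁿ`. -/
abbrev Sph (n : ℕ) : Type := Metric.sphere (0 : EuclideanSpace ℝ (Fin n)) 1

/-- The surface measure of the unit sphere of `ℝⁿ`. -/
abbrev sphereMeasure (n : ℕ) : Measure (Sph n) :=
  (volume : Measure (EuclideanSpace ℝ (Fin n))).toSphere

/-- The function `(1 + τ²)^(-1/4)`, the size of `|x|` on the unit gauge sphere at `τ = 2t/|x|²`. -/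
def latitude (τ : ℝ) : ℝ := (1 + τ ^ 2) ^ (-1 / 4 : ℝ)

lemma latitude_pos (τ : ℝ) : 0 < latitude τ := by
  unfold latitude; positivity

lemma latitude_pow_four (τ : ℝ) : latitude τ ^ 4 * (1 + τ ^ 2) = 1 := by
  have h : (0 : ℝ) < 1 + τ ^ 2 := by positivity
  unfold latitude
  rw [← Real.rpow_natCast, ← Real.rpow_mul h.le]
  norm_num
  rw [Real.rpow_neg_one]
  exact inv_mul_cancel₀ h.ne'

lemma continuous_latitude : Continuous latitude := by
  unfold latitude
  exact Continuous.rpow_const (by fun_prop) fun τ => Or.inl (by positivity)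

/-- The point of the unit gauge sphere with direction `ξ` and `2t/|x|² = τ`. -/
def spherePt (θ : Sph n × ℝ) : Space n :=
  (latitude θ.2 • (θ.1 : EuclideanSpace ℝ (Fin n)), θ.2 * latitude θ.2 ^ 2 / 2)

lemma continuous_spherePt : Continuous (spherePt (n := n)) := by
  have := continuous_latitude
  unfold spherePt
  fun_prop

lemma gaugeNorm_spherePt (θ : Sph n × ℝ) : gaugeNorm (spherePt θ) = 1 := by
  refine (pow_left_inj₀ (gaugeNorm_nonneg _) zero_le_one (n := 4) (by norm_num)).1 ?_
  have h1 : ‖(θ.1 : EuclideanSpace ℝ (Fin n))‖ = 1 := by simp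
  rw [gaugeNorm_pow_four]
  simp only [spherePt, norm_smul, h1, Real.norm_eq_abs, abs_of_pos (latitude_pos _)]
  linear_combination latitude_pow_four θ.2

lemma spherePt_ne_zero (θ : Sph n × ℝ) : spherePt θ ≠ 0 :=
  ne_zero_of_gaugeNorm_pos (by rw [gaugeNorm_spherePt]; exact one_pos)

lemma angularWeight_spherePt (θ : Sph n × ℝ) :
    angularWeight (spherePt θ) = latitude θ.2 ^ 2 := by
  have h1 : ‖(θ.1 : EuclideanSpace ℝ (Fin n))‖ = 1 := by simp
  rw [angularWeight, gaugeNorm_spherePt]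
  simp [spherePt, norm_smul, abs_of_pos (latitude_pos _)]

/-- The measure on the unit gauge sphere in polar coordinates. -/
def angleMeasure (n : ℕ) : Measure (Sph n × ℝ) :=
  (sphereMeasure n).prod
    ((volume : Measure ℝ).withDensity fun τ => ENNReal.ofReal (latitude τ ^ (n + 2) / 2))

/-- The radial measure `r^(Q-1) dr` in polar coordinates. -/
def radialMeasure (n : ℕ) : Measure ℝ :=
  (volume.restrict (Ioi 0)).withDensity fun r => ENNReal.ofReal (r ^ (n + 1))

instance : SFinite (angleMeasure n) := by unfold angleMeasure; infer_instance
instance : SFinite (radialMeasure n) := by unfold radialMeasure; infer_instance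

lemma lintegral_comp_mul_pos {c : ℝ} (hc : 0 < c) (G : ℝ → ENNReal) :
    ∫⁻ t, G t = ∫⁻ τ, G (c * τ) * ENNReal.ofReal c := by
  have h1 := Real.map_volume_mul_left hc.ne'
  have h2 : MeasurableEmbedding (fun x : ℝ => c * x) :=
    (Homeomorph.mulLeft₀ c hc.ne').measurableEmbedding
  have h3 := h2.lintegral_map (μ := volume) G
  rw [h1, lintegral_smul_measure, abs_of_pos (inv_pos.2 hc)] at h3
  rw [lintegral_mul_const' _ _ ENNReal.ofReal_ne_top, ← h3, smul_eq_mul, mul_comm, ← mul_assoc,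
    ← ENNReal.ofReal_mul hc.le, mul_inv_cancel₀ hc.ne']
  simp

lemma setLIntegral_Ioi_comp_mul_pos {c : ℝ} (hc : 0 < c) (G : ℝ → ENNReal) :
    ∫⁻ s in Ioi 0, G s = ∫⁻ r in Ioi 0, G (c * r) * ENNReal.ofReal c := by
  rw [← lintegral_indicator measurableSet_Ioi, ← lintegral_indicator measurableSet_Ioi,
    lintegral_comp_mul_pos hc]
  refine lintegral_congr fun r => ?_
  by_cases hr : 0 < r
  · have h : 0 < c * r := by positivity
    simp [indicator, hr, h]
  · have h : ¬ 0 < c * r := fun h => hr (pos_of_mul_pos_right h hc.le)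
    simp [indicator, hr, h]

lemma lintegral_eq_lintegral_toSphere (hn : 1 ≤ n) {H : EuclideanSpace ℝ (Fin n) → ENNReal}
    (hH : Measurable H) :
    ∫⁻ x, H x = ∫⁻ ξ, (∫⁻ s in Ioi (0 : ℝ), H (s • (ξ : EuclideanSpace ℝ (Fin n))) *
      ENNReal.ofReal (s ^ (n - 1))) ∂(sphereMeasure n) := by
  have : Nonempty (Fin n) := ⟨⟨0, hn⟩⟩
  set μ := (volume : Measure (EuclideanSpace ℝ (Fin n)))
  have h1 : ∫⁻ x, H x = ∫⁻ x : ({(0)}ᶜ : Set (EuclideanSpace ℝ (Fin n))), H x ∂(μ.comap (↑)) := by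
    rw [lintegral_subtype_comap (measurableSet_singleton _).compl, restrict_compl_singleton]
  have h2 : ∀ x : ({(0)}ᶜ : Set (EuclideanSpace ℝ (Fin n))),
      H x = (fun z : Sph n × Ioi (0 : ℝ) => H ((z.2 : ℝ) • (z.1 : EuclideanSpace ℝ (Fin n))))
        (homeomorphUnitSphereProd _ x) := by
    intro x
    have hx : ‖(x : EuclideanSpace ℝ (Fin n))‖ ≠ 0 := norm_ne_zero_iff.2 x.2
    simp [smul_smul, mul_inv_cancel₀ hx]
  have hm : Measurable
      (fun z : Sph n × Ioi (0 : ℝ) => H ((z.2 : ℝ) • (z.1 : EuclideanSpace ℝ (Fin n)))) :=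
    hH.comp (by fun_prop)
  rw [h1, lintegral_congr h2, μ.measurePreserving_homeomorphUnitSphereProd.lintegral_comp hm,
    lintegral_prod _ hm.aemeasurable]
  refine lintegral_congr fun ξ => ?_
  have hm' : Measurable (fun s : Ioi (0 : ℝ) => H ((s : ℝ) • (ξ : EuclideanSpace ℝ (Fin n)))) :=
    hm.comp measurable_prodMk_left
  rw [Measure.volumeIoiPow, lintegral_withDensity_eq_lintegral_mul _ (by fun_prop) hm']
  simp only [Pi.mul_apply, finrank_euclideanSpace, Fintype.card_fin]
  rw [lintegral_subtype_comap measurableSet_Ioi (fun s : ℝ =>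
    ENNReal.ofReal (s ^ (n - 1)) * H (s • (ξ : EuclideanSpace ℝ (Fin n))))]
  simp only [mul_comm]

lemma measurable_polar :
    Measurable (fun z : (Sph n × ℝ) × ℝ => dilation z.2 (spherePt z.1)) := by
  have h := (continuous_spherePt (n := n)).comp (continuous_fst (Y := ℝ))
  exact ((continuous_snd.smul h.fst).prodMk ((continuous_snd.pow 2).mul h.snd)).measurable

/-- Ordinary polar coordinates x = sξ, then t = (s²/2)τ, then s = q(τ)r with q = `latitude`. The
Jacobian s^(n−1) · s²/2 · q becomes r^(n+1) · q^(n+2)/2, which gives the two measures. -/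
lemma lintegral_polar (hn : 1 ≤ n) {F : Space n → ENNReal} (hF : Measurable F) :
    ∫⁻ p, F p = ∫⁻ z, F (dilation z.2 (spherePt z.1)) ∂((angleMeasure n).prod (radialMeasure n)) := by
  have hlat : Measurable latitude := continuous_latitude.measurable
  have hG : Measurable (fun z : (Sph n × ℝ) × ℝ => F (dilation z.2 (spherePt z.1))) :=
    hF.comp measurable_polar
  have hfin : SFinite ((volume : Measure ℝ).withDensity
    fun τ => ENNReal.ofReal (latitude τ ^ (n + 2) / 2)) := inferInstance
  have hR : ∫⁻ z, F (dilation z.2 (spherePt z.1)) ∂((angleMeasure n).prod (radialMeasure n)) =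
      ∫⁻ ξ, (∫⁻ τ, ∫⁻ r in Ioi (0 : ℝ), F (dilation r (spherePt (ξ, τ))) *
        ENNReal.ofReal (r ^ (n + 1)) * ENNReal.ofReal (latitude τ ^ (n + 2) / 2))
        ∂(sphereMeasure n) := by
    rw [lintegral_prod _ hG.aemeasurable, angleMeasure,
      lintegral_prod _ hG.lintegral_prod_right'.aemeasurable]
    refine lintegral_congr fun ξ => ?_
    have hG₁ : Measurable (fun τ : ℝ => ∫⁻ r, F (dilation r (spherePt (ξ, τ))) ∂(radialMeasure n)) :=
      hG.lintegral_prod_right'.comp measurable_prodMk_left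
    rw [lintegral_withDensity_eq_lintegral_mul _ (by fun_prop) hG₁]
    refine lintegral_congr fun τ => ?_
    have hG₂ : Measurable (fun r : ℝ => F (dilation r (spherePt (ξ, τ)))) :=
      hG.comp measurable_prodMk_left
    simp only [Pi.mul_apply]
    rw [radialMeasure, lintegral_withDensity_eq_lintegral_mul _ (by fun_prop) hG₂, mul_comm,
      ← lintegral_mul_const' _ _ ENNReal.ofReal_ne_top]
    refine lintegral_congr fun r => ?_
    simp only [Pi.mul_apply, mul_comm]
  have hH : Measurable (fun x : EuclideanSpace ℝ (Fin n) => ∫⁻ t, F (x, t)) :=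
    Measurable.lintegral_prod_right' hF
  rw [hR, show (volume : Measure (Space n)) = (volume : Measure (EuclideanSpace ℝ (Fin n))).prod
    (volume : Measure ℝ) from rfl, lintegral_prod _ hF.aemeasurable,
    lintegral_eq_lintegral_toSphere hn hH]
  refine lintegral_congr fun ξ => ?_
  have h1 : ∀ s ∈ Ioi (0 : ℝ), (∫⁻ t, F (s • (ξ : EuclideanSpace ℝ (Fin n)), t)) *
      ENNReal.ofReal (s ^ (n - 1)) = ∫⁻ τ, F (s • (ξ : EuclideanSpace ℝ (Fin n)), s ^ 2 / 2 * τ) *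
        ENNReal.ofReal (s ^ 2 / 2) * ENNReal.ofReal (s ^ (n - 1)) := by
    intro s hs
    have hs' : (0 : ℝ) < s := hs
    rw [lintegral_comp_mul_pos (c := s ^ 2 / 2) (by positivity),
      ← lintegral_mul_const' _ _ ENNReal.ofReal_ne_top]
  -- The last substitution s = q(τ)r depends on τ, so τ must become the outer variable.
  rw [setLIntegral_congr_fun measurableSet_Ioi h1, lintegral_lintegral_swap]
  · refine lintegral_congr fun τ => ?_
    have hq := latitude_pos τ
    rw [setLIntegral_Ioi_comp_mul_pos hq]
    refine setLIntegral_congr_fun measurableSet_Ioi fun r hr => ?_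
    have hr' : (0 : ℝ) < r := hr
    obtain ⟨m, rfl⟩ := Nat.exists_eq_add_of_le' hn
    have e1 : ((latitude τ * r) • (ξ : EuclideanSpace ℝ (Fin (m + 1))),
        (latitude τ * r) ^ 2 / 2 * τ) = dilation r (spherePt (ξ, τ)) := by
      simp only [dilation, spherePt, smul_smul, mul_comm]
      congr 1
      ring
    simp only [e1, mul_assoc]
    congr 1
    rw [← ENNReal.ofReal_mul (by positivity), ← ENNReal.ofReal_mul (by positivity),
      ← ENNReal.ofReal_mul (by positivity)]
    congr 1
    simp only [Nat.add_sub_cancel]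
    ring
  · refine Measurable.aemeasurable ?_
    refine Measurable.mul (Measurable.mul (hF.comp ?_) ?_) ?_ <;> fun_prop

/-- As an equality of measures, the formula for nonnegative functions transfers integrability and
signed integrals without further work. -/
lemma map_polar (hn : 1 ≤ n) :
    Measure.map (fun z : (Sph n × ℝ) × ℝ => dilation z.2 (spherePt z.1))
      ((angleMeasure n).prod (radialMeasure n)) = volume := by
  refine Measure.ext_of_lintegral _ fun F hF => ?_
  rw [lintegral_map hF measurable_polar, lintegral_polar hn hF]

lemma integrable_polar (hn : 1 ≤ n) {F : Space n → ℝ} (hF : Integrable F) :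
    Integrable (fun z : (Sph n × ℝ) × ℝ => F (dilation z.2 (spherePt z.1)))
      ((angleMeasure n).prod (radialMeasure n)) := by
  rw [← map_polar hn] at hF
  exact hF.comp_measurable measurable_polar

lemma integral_polar (hn : 1 ≤ n) {F : Space n → ℝ} (hF : Integrable F) :
    ∫ p, F p = ∫ z, F (dilation z.2 (spherePt z.1))
      ∂((angleMeasure n).prod (radialMeasure n)) := by
  have h := integral_map (μ := (angleMeasure n).prod (radialMeasure n)) (f := F)
    measurable_polar.aemeasurable (by rw [map_polar hn]; exact hF.aestronglyMeasurable)
  rwa [map_polar hn] at h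

lemma integral_radialMeasure (G : ℝ → ℝ) :
    ∫ r, G r ∂(radialMeasure n) = ∫ r in Ioi 0, G r * r ^ (n + 1) := by
  have h1 : Measurable (fun r : ℝ => Real.toNNReal (r ^ (n + 1))) := by fun_prop
  unfold radialMeasure ENNReal.ofReal
  rw [integral_withDensity_eq_integral_smul h1]
  refine setIntegral_congr_fun measurableSet_Ioi fun r hr => ?_
  have hr' : (0 : ℝ) < r := hr
  simp only [NNReal.smul_def, Real.coe_toNNReal _ (pow_nonneg hr'.le _), smul_eq_mul, mul_comm]

end Polar

lemma _root_.MeasureTheory.Integrable.fun_sub {α : Type*} [MeasurableSpace α] {μ : Measure α}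
    {f g : α → ℝ} (hf : Integrable f μ) (hg : Integrable g μ) :
    Integrable (fun x => f x - g x) μ := hf.sub hg

/-! ### Weighted Poincaré inequalities on the line. -/

section Poincare

variable {p e T T' v v' : ℝ → ℝ} {C : ℝ}

/-- Cauchy–Schwarz for v' = (v'/√T')·√T'. It follows from integrating (v' − cT')²/T' ≥ 0, where c is
the difference quotient of v against T. -/
lemma sq_sub_le_mul_integral (hT : ∀ x, HasDerivAt T (T' x) x) (hT' : Continuous T')
    (hpos : ∀ x, 0 < T' x) (hv : ∀ x, HasDerivAt v (v' x) x) (hv' : Continuous v')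
    {α β : ℝ} (h : β ≤ α) :
    (v α - v β) ^ 2 ≤ (T α - T β) * ∫ s in β..α, v' s ^ 2 / T' s := by
  have hc : Continuous (fun s => v' s ^ 2 / T' s) := (hv'.pow 2).div hT' fun s => (hpos s).ne'
  have e1 : ∫ s in β..α, v' s = v α - v β :=
    intervalIntegral.integral_eq_sub_of_hasDerivAt (fun x _ => hv x) (hv'.intervalIntegrable _ _)
  have e2 : ∫ s in β..α, T' s = T α - T β :=
    intervalIntegral.integral_eq_sub_of_hasDerivAt (fun x _ => hT x) (hT'.intervalIntegrable _ _)
  rcases h.eq_or_lt with rfl | hlt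
  · simp
  have hTpos : 0 < T α - T β := by
    rw [← e2]
    exact intervalIntegral.intervalIntegral_pos_of_pos (hT'.intervalIntegrable _ _) hpos hlt
  set c := (v α - v β) / (T α - T β) with hcdef
  have h0 : 0 ≤ ∫ s in β..α, (v' s - c * T' s) ^ 2 / T' s :=
    intervalIntegral.integral_nonneg h fun s _ => div_nonneg (sq_nonneg _) (hpos s).le
  have h1 : ∫ s in β..α, (v' s - c * T' s) ^ 2 / T' s =
      (∫ s in β..α, v' s ^ 2 / T' s) - 2 * c * (v α - v β) + c ^ 2 * (T α - T β) := by
    rw [← e1, ← e2, ← intervalIntegral.integral_const_mul, ← intervalIntegral.integral_const_mul,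
      ← intervalIntegral.integral_sub (hc.intervalIntegrable _ _)
        ((hv'.const_mul _).intervalIntegrable _ _),
      ← intervalIntegral.integral_add ((hc.fun_sub (hv'.const_mul _)).intervalIntegrable _ _)
        ((hT'.const_mul _).intervalIntegrable _ _)]
    congr 1
    ext s
    have := (hpos s).ne'
    field_simp
    ring
  rw [h1, hcdef] at h0
  set I := ∫ s in β..α, v' s ^ 2 / T' s
  have h2 : 0 ≤ (T α - T β) * (I - 2 * ((v α - v β) / (T α - T β)) * (v α - v β) +
      ((v α - v β) / (T α - T β)) ^ 2 * (T α - T β)) := mul_nonneg hTpos.le h0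
  have h3 : (T α - T β) * (I - 2 * ((v α - v β) / (T α - T β)) * (v α - v β) +
      ((v α - v β) / (T α - T β)) ^ 2 * (T α - T β)) = (T α - T β) * I - (v α - v β) ^ 2 := by
    field_simp
    ring
  linarith

/-- Let P be the mass of p below s and K the integral of Tp above s. Mean zero gives −K below s, so
the double integral is PK + K(∫p − P) = K∫p. -/
lemma lintegral_lintegral_sub_mul (hp : ∀ x, 0 ≤ p x) (hpi : Integrable p)
    (hmono : Monotone T) (hTp : Integrable (fun x => T x * p x)) (hmean : ∫ x, T x * p x = 0)
    (s : ℝ) :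
    ∫⁻ α in Ici s, ∫⁻ β in Iio s, ENNReal.ofReal ((T α - T β) * (p α * p β)) =
      ENNReal.ofReal ((∫ x, p x) * ∫ x in Ici s, T x * p x) := by
  set K := ∫ x in Ici s, T x * p x with hK
  set P := ∫ x in Iio s, p x with hP
  have hc : (Ici s)ᶜ = Iio s := by ext; simp
  have hK' : ∫ x in Iio s, T x * p x = -K := by
    have := integral_add_compl (μ := volume) (s := Ici s) measurableSet_Ici hTp
    rw [hc, hmean] at this
    linarith
  have hP' : ∫ x in Ici s, p x = (∫ x, p x) - P := by
    have := integral_add_compl (μ := volume) (s := Ici s) measurableSet_Ici hpi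
    rw [hc] at this
    linarith
  have h1 : ∀ α ∈ Ici s, ∫⁻ β in Iio s, ENNReal.ofReal ((T α - T β) * (p α * p β)) =
      ENNReal.ofReal (P * (T α * p α) + K * p α) := by
    intro α hα
    have hi : IntegrableOn (fun β => (T α - T β) * (p α * p β)) (Iio s) := by
      have := ((hpi.const_mul (T α * p α)).sub (hTp.const_mul (p α))).integrableOn (s := Iio s)
      refine this.congr_fun (fun β _ => ?_) measurableSet_Iio
      simp only [Pi.sub_apply]; ring
    rw [← ofReal_integral_eq_lintegral_ofReal hi]
    · congr 1
      have : ∀ β, (T α - T β) * (p α * p β) = T α * p α * p β - p α * (T β * p β) := by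
        intro β; ring
      simp only [this]
      rw [integral_sub (hpi.const_mul _).integrableOn (hTp.const_mul _).integrableOn,
        integral_const_mul, integral_const_mul, hK', ← hP]
      ring
    · filter_upwards [ae_restrict_mem measurableSet_Iio] with β hβ
      exact mul_nonneg (sub_nonneg.2 (hmono (le_of_lt (lt_of_lt_of_le hβ hα))))
        (mul_nonneg (hp _) (hp _))
  rw [setLIntegral_congr_fun measurableSet_Ici h1]
  have hi : IntegrableOn (fun α => P * (T α * p α) + K * p α) (Ici s) :=
    ((hTp.const_mul _).add (hpi.const_mul _)).integrableOn
  rw [← ofReal_integral_eq_lintegral_ofReal hi]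
  · congr 1
    rw [integral_add (hTp.const_mul _).integrableOn (hpi.const_mul _).integrableOn,
      integral_const_mul, integral_const_mul, ← hK, hP']
    ring
  · filter_upwards [ae_restrict_mem measurableSet_Ici] with α hα
    have h2 : P * (T α * p α) + K * p α = ∫ β in Iio s, (T α - T β) * (p α * p β) := by
      have : ∀ β, (T α - T β) * (p α * p β) = T α * p α * p β - p α * (T β * p β) := by
        intro β; ring
      simp only [this]
      rw [integral_sub (hpi.const_mul _).integrableOn (hTp.const_mul _).integrableOn,
        integral_const_mul, integral_const_mul, hK', ← hP]
      ring
    rw [Pi.zero_apply, h2]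
    refine setIntegral_nonneg measurableSet_Iio fun β hβ => ?_
    exact mul_nonneg (sub_nonneg.2 (hmono (le_of_lt (lt_of_lt_of_le hβ hα))))
        (mul_nonneg (hp _) (hp _))

/-- A one-dimensional weighted Poincaré inequality, in terms of differences. The weight `e` of the
energy controls the tail integrals of `T p` for some increasing `T` of mean zero. -/
lemma lintegral_sq_sub_le (hpc : Continuous p) (hp : ∀ x, 0 ≤ p x) (hpi : Integrable p)
    (hT : ∀ x, HasDerivAt T (T' x) x) (hT' : Continuous T') (hpos : ∀ x, 0 < T' x)
    (hTp : Integrable (fun x => T x * p x)) (hmean : ∫ x, T x * p x = 0)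
    (hK : ∀ s, ∫ x in Ici s, T x * p x ≤ C * (e s * T' s))
    (hv : ∀ x, HasDerivAt v (v' x) x) (hv' : Continuous v') :
    ∫⁻ α, ∫⁻ β, ENNReal.ofReal ((v α - v β) ^ 2 * (p α * p β)) ≤
      2 * ∫⁻ s, ENNReal.ofReal ((∫ x, p x) * C * (e s * v' s ^ 2)) := by
  have hTc : Continuous T := continuous_iff_continuousAt.2 fun x => (hT x).continuousAt
  have hmono : Monotone T := monotone_of_hasDerivAt_nonneg hT fun x => (hpos x).le
  have hc : Continuous (fun s => v' s ^ 2 / T' s) := (hv'.pow 2).div hT' fun s => (hpos s).ne'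
  have hc0 : ∀ s, 0 ≤ v' s ^ 2 / T' s := fun s => div_nonneg (sq_nonneg _) (hpos s).le
  -- The kernel lives on β < s ≤ α, so that Tonelli can move the energy variable s outside the pair
  -- (α,β).
  set k : ℝ → ℝ → ℝ → ENNReal := fun α β s =>
    {z : ℝ × ℝ × ℝ | z.2.1 < z.2.2 ∧ z.2.2 ≤ z.1}.indicator (fun z =>
      ENNReal.ofReal (v' z.2.2 ^ 2 / T' z.2.2) *
        ENNReal.ofReal ((T z.1 - T z.2.1) * (p z.1 * p z.2.1))) (α, β, s) with hk
  have hkm : Measurable (fun z : ℝ × ℝ × ℝ => k z.1 z.2.1 z.2.2) := by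
    refine Measurable.indicator ?_ ?_
    · have := hc.measurable
      have := hTc.measurable
      have := hpc.measurable
      refine Measurable.mul (ENNReal.measurable_ofReal.comp
        (hc.measurable.comp (by fun_prop))) (by fun_prop)
    · exact (measurableSet_lt (measurable_fst.comp measurable_snd)
        (measurable_snd.comp measurable_snd)).inter
        (measurableSet_le (measurable_snd.comp measurable_snd) measurable_fst)
  have hkm2 : Measurable (fun z : ℝ × ℝ => ∫⁻ s, k z.1 z.2 s) :=
    Measurable.lintegral_prod_right' (f := fun w : (ℝ × ℝ) × ℝ => k w.1.1 w.1.2 w.2)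
      (hkm.comp (by fun_prop : Measurable fun w : (ℝ × ℝ) × ℝ => (w.1.1, w.1.2, w.2)))
  have hpt : ∀ α β, β ≤ α → ENNReal.ofReal ((v α - v β) ^ 2 * (p α * p β)) ≤ ∫⁻ s, k α β s := by
    intro α β h
    have h1 : ∀ s, k α β s = (Ioc β α).indicator (fun s => ENNReal.ofReal (v' s ^ 2 / T' s)) s *
        ENNReal.ofReal ((T α - T β) * (p α * p β)) := by
      intro s
      by_cases hs : s ∈ Ioc β α
      · have : β < s ∧ s ≤ α := hs
        simp [hk, indicator, this]
      · have : ¬(β < s ∧ s ≤ α) := hs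
        simp [hk, indicator, this]
    simp only [h1]
    rw [lintegral_mul_const' _ _ ENNReal.ofReal_ne_top, lintegral_indicator measurableSet_Ioc,
      ← ofReal_integral_eq_lintegral_ofReal (hc.integrableOn_Ioc)
        (Filter.Eventually.of_forall hc0), ← ENNReal.ofReal_mul
        (integral_nonneg fun s => hc0 s)]
    refine ENNReal.ofReal_le_ofReal ?_
    have h2 := sq_sub_le_mul_integral hT hT' hpos hv hv' h
    rw [intervalIntegral.integral_of_le h] at h2
    have h3 := mul_le_mul_of_nonneg_right h2 (mul_nonneg (hp α) (hp β))
    linarith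
  -- The squared difference is symmetric, so the kernel in one of the two orders suffices. Adding
  -- both costs the factor 2, which is the factor in the polarized variance.
  have hpt2 : ∀ α β, ENNReal.ofReal ((v α - v β) ^ 2 * (p α * p β)) ≤
      (∫⁻ s, k α β s) + ∫⁻ s, k β α s := by
    intro α β
    rcases le_total β α with h | h
    · exact (hpt α β h).trans le_self_add
    · refine le_trans ?_ (le_add_self (a := ∫⁻ s, k β α s))
      rw [show (v α - v β) ^ 2 * (p α * p β) = (v β - v α) ^ 2 * (p β * p α) by ring]
      exact hpt β α h
  have hI : ∫⁻ α, ∫⁻ β, ∫⁻ s, k α β s ≤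
      ∫⁻ s, ENNReal.ofReal ((∫ x, p x) * C * (e s * v' s ^ 2)) := by
    have h1 : ∀ α, ∫⁻ β, ∫⁻ s, k α β s = ∫⁻ s, ∫⁻ β, k α β s := fun α =>
      lintegral_lintegral_swap (hkm.comp measurable_prodMk_left).aemeasurable
    simp only [h1]
    rw [lintegral_lintegral_swap]
    · refine lintegral_mono fun s => ?_
      have h2 : ∀ α β, k α β s = ENNReal.ofReal (v' s ^ 2 / T' s) *
          (Ici s).indicator (fun α => (Iio s).indicator (fun β =>
            ENNReal.ofReal ((T α - T β) * (p α * p β))) β) α := by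
        intro α β
        by_cases h1 : s ≤ α <;> by_cases h2 : β < s <;> simp [hk, indicator, h1, h2]
      simp only [h2]
      have h3 : ∀ α, ∫⁻ β, ENNReal.ofReal (v' s ^ 2 / T' s) *
          (Ici s).indicator (fun α => (Iio s).indicator (fun β =>
            ENNReal.ofReal ((T α - T β) * (p α * p β))) β) α =
          ENNReal.ofReal (v' s ^ 2 / T' s) * (Ici s).indicator (fun α => ∫⁻ β in Iio s,
            ENNReal.ofReal ((T α - T β) * (p α * p β))) α := by
        intro α
        rw [lintegral_const_mul' _ _ ENNReal.ofReal_ne_top]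
        congr 1
        by_cases h1 : α ∈ Ici s
        · simp only [indicator_of_mem h1, lintegral_indicator measurableSet_Iio]
        · simp only [indicator_of_notMem h1, lintegral_zero]
      simp only [h3]
      rw [lintegral_const_mul' _ _ ENNReal.ofReal_ne_top, lintegral_indicator measurableSet_Ici,
        lintegral_lintegral_sub_mul hp hpi hmono hTp hmean, ← ENNReal.ofReal_mul (hc0 s)]
      refine ENNReal.ofReal_le_ofReal ?_
      have h4 : 0 ≤ ∫ x, p x := integral_nonneg hp
      -- The T' in the tail bound cancels the 1/T' from Cauchy–Schwarz.
      have h5 := mul_le_mul_of_nonneg_left (mul_le_mul_of_nonneg_left (hK s) h4) (hc0 s)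
      refine h5.trans_eq ?_
      have := (hpos s).ne'
      field_simp
    · exact (Measurable.lintegral_prod_right' (f := fun w : (ℝ × ℝ) × ℝ => k w.1.1 w.2 w.1.2)
        (hkm.comp (by fun_prop : Measurable fun w : (ℝ × ℝ) × ℝ =>
          (w.1.1, w.2, w.1.2)))).aemeasurable
  calc ∫⁻ α, ∫⁻ β, ENNReal.ofReal ((v α - v β) ^ 2 * (p α * p β))
      ≤ ∫⁻ α, ∫⁻ β, ((∫⁻ s, k α β s) + ∫⁻ s, k β α s) :=
        lintegral_mono fun α => lintegral_mono fun β => hpt2 α β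
    _ = (∫⁻ α, ∫⁻ β, ∫⁻ s, k α β s) + ∫⁻ α, ∫⁻ β, ∫⁻ s, k β α s := by
        rw [← lintegral_add_left hkm2.lintegral_prod_right']
        refine lintegral_congr fun α => ?_
        exact lintegral_add_left (hkm2.comp measurable_prodMk_left) _
    _ = 2 * ∫⁻ α, ∫⁻ β, ∫⁻ s, k α β s := by
        rw [two_mul]
        congr 1
        exact lintegral_lintegral_swap (f := fun α β => ∫⁻ s, k β α s)
          (hkm2.comp measurable_swap).aemeasurable
    _ ≤ _ := by gcongr

/-- A one-dimensional weighted Poincaré inequality. -/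
lemma integral_sq_sub_sq_integral_le (hpc : Continuous p) (hp : ∀ x, 0 ≤ p x) (hpi : Integrable p)
    (hT : ∀ x, HasDerivAt T (T' x) x) (hT' : Continuous T') (hpos : ∀ x, 0 < T' x)
    (hTp : Integrable (fun x => T x * p x)) (hmean : ∫ x, T x * p x = 0)
    (hC : 0 ≤ C) (he : ∀ x, 0 ≤ e x)
    (hK : ∀ s, ∫ x in Ici s, T x * p x ≤ C * (e s * T' s))
    (hv : ∀ x, HasDerivAt v (v' x) x) (hv' : Continuous v')
    (hv2 : Integrable (fun x => v x ^ 2 * p x)) (hev : Integrable (fun x => e x * v' x ^ 2)) :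
    (∫ x, p x) * (∫ x, v x ^ 2 * p x) - (∫ x, v x * p x) ^ 2 ≤
      (∫ x, p x) * C * ∫ x, e x * v' x ^ 2 := by
  have hvc : Continuous v := continuous_iff_continuousAt.2 fun x => (hv x).continuousAt
  have hm : 0 ≤ ∫ x, p x := integral_nonneg hp
  have hv1 : Integrable (fun x => v x * p x) := by
    refine (hv2.add hpi).mono' (hvc.mul hpc).aestronglyMeasurable (Filter.Eventually.of_forall ?_)
    intro x
    have := hp x
    rw [Real.norm_eq_abs, abs_mul, abs_of_nonneg this]
    simp only [Pi.add_apply]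
    nlinarith [sq_nonneg (|v x| - 1), sq_abs (v x), abs_nonneg (v x)]
  have key := lintegral_sq_sub_le hpc hp hpi hT hT' hpos hTp hmean hK hv hv'
  -- Expanding the square turns the double integral into twice the left-hand side of the claim.
  have hexp : ∀ α β, (v α - v β) ^ 2 * (p α * p β) =
      v α ^ 2 * p α * p β - 2 * (v α * p α) * (v β * p β) + p α * (v β ^ 2 * p β) := by
    intro α β; ring
  have h1 : ∀ α, ∫⁻ β, ENNReal.ofReal ((v α - v β) ^ 2 * (p α * p β)) =
      ENNReal.ofReal (v α ^ 2 * p α * (∫ x, p x) - 2 * (v α * p α) * (∫ x, v x * p x) +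
        p α * ∫ x, v x ^ 2 * p x) := by
    intro α
    rw [← ofReal_integral_eq_lintegral_ofReal]
    · simp only [hexp]
      rw [integral_add (Integrable.fun_sub (hpi.const_mul _) (hv1.const_mul _)) (hv2.const_mul _),
        integral_sub (hpi.const_mul _) (hv1.const_mul _), integral_const_mul, integral_const_mul,
        integral_const_mul]
    · simp only [hexp]
      exact (Integrable.fun_sub (hpi.const_mul _) (hv1.const_mul _)).add (hv2.const_mul _)
    · exact Filter.Eventually.of_forall fun β =>
        mul_nonneg (sq_nonneg _) (mul_nonneg (hp _) (hp _))
  have hi : Integrable (fun α => v α ^ 2 * p α * (∫ x, p x) -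
      2 * (v α * p α) * (∫ x, v x * p x) + p α * ∫ x, v x ^ 2 * p x) :=
    ((hv2.mul_const _).sub ((hv1.const_mul 2).mul_const _)).add (hpi.mul_const _)
  simp only [h1] at key
  rw [← ofReal_integral_eq_lintegral_ofReal hi, ← ofReal_integral_eq_lintegral_ofReal
    (hev.const_mul _), ← ENNReal.ofReal_ofNat 2, ← ENNReal.ofReal_mul (by norm_num)] at key
  · rw [ENNReal.ofReal_le_ofReal_iff, integral_add (Integrable.fun_sub (hv2.mul_const _)
      ((hv1.const_mul 2).mul_const _)) (hpi.mul_const _), integral_sub (hv2.mul_const _)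
      ((hv1.const_mul 2).mul_const _), integral_mul_const, integral_mul_const, integral_mul_const,
      integral_const_mul, integral_const_mul] at key
    · nlinarith [key]
    · have : 0 ≤ ∫ x, (∫ x, p x) * C * (e x * v' x ^ 2) :=
        integral_nonneg fun x => mul_nonneg (mul_nonneg hm hC) (mul_nonneg (he x) (sq_nonneg _))
      linarith
  · exact Filter.Eventually.of_forall fun x =>
      mul_nonneg (mul_nonneg hm hC) (mul_nonneg (he x) (sq_nonneg _))
  · refine Filter.Eventually.of_forall fun α => ?_
    have : 0 ≤ ∫ β, (v α - v β) ^ 2 * (p α * p β) := integral_nonneg fun β =>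
      mul_nonneg (sq_nonneg _) (mul_nonneg (hp _) (hp _))
    simp only [hexp] at this
    rwa [integral_add (Integrable.fun_sub (hpi.const_mul _) (hv1.const_mul _)) (hv2.const_mul _),
        integral_sub (hpi.const_mul _) (hv1.const_mul _), integral_const_mul, integral_const_mul,
        integral_const_mul] at this

end Poincare

/-! ### Tensorization of the variance. -/

section Tensorization

lemma integrable_of_sq_le {α : Type*} [MeasurableSpace α] {μ : Measure α} {f g : α → ℝ}
    (hf : AEStronglyMeasurable f μ) (hg : Integrable g μ) (h : ∀ᵐ x ∂μ, f x ^ 2 ≤ g x) :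
    Integrable (fun x => f x ^ 2) μ := by
  refine hg.mono' (hf.pow 2) ?_
  filter_upwards [h] with x hx
  rwa [Real.norm_of_nonneg (sq_nonneg _)]

lemma integrable_mul_of_sq {α : Type*} [MeasurableSpace α] {μ : Measure α} {f g : α → ℝ}
    (hf : AEStronglyMeasurable f μ) (hg : AEStronglyMeasurable g μ)
    (hf2 : Integrable (fun x => f x ^ 2) μ) (hg2 : Integrable (fun x => g x ^ 2) μ) :
    Integrable (fun x => f x * g x) μ := by
  refine (hf2.add hg2).mono' (hf.mul hg) (Filter.Eventually.of_forall fun x => ?_)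
  rw [Real.norm_eq_abs, abs_le]
  simp only [Pi.add_apply]
  constructor <;> nlinarith [sq_nonneg (f x + g x), sq_nonneg (f x - g x), sq_nonneg (f x),
    sq_nonneg (g x)]

lemma integrable_of_integrable_sq {α : Type*} [MeasurableSpace α] {μ : Measure α}
    [IsFiniteMeasure μ] {f : α → ℝ}
    (hf : AEStronglyMeasurable f μ) (hf2 : Integrable (fun x => f x ^ 2) μ) : Integrable f μ := by
  have := integrable_mul_of_sq hf (g := fun _ => 1) aestronglyMeasurable_const hf2 (by simp)
  simpa using this

lemma sq_integral_le_integral_sq {α : Type*} [MeasurableSpace α] {μ : Measure α}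
    [IsProbabilityMeasure μ] {f : α → ℝ} (hf : Integrable f μ)
    (hf2 : Integrable (fun x => f x ^ 2) μ) : (∫ x, f x ∂μ) ^ 2 ≤ ∫ x, f x ^ 2 ∂μ := by
  set m := ∫ x, f x ∂μ with hm
  have h : 0 ≤ ∫ x, (f x - m) ^ 2 ∂μ := integral_nonneg fun x => sq_nonneg _
  have h2 : ∀ x, (f x - m) ^ 2 = f x ^ 2 - 2 * m * f x + m ^ 2 := fun x => by ring
  simp only [h2] at h
  rw [integral_add (hf2.fun_sub (hf.const_mul _)) (integrable_const _),
    integral_sub hf2 (hf.const_mul _), integral_const_mul, ← hm] at h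
  simp at h
  nlinarith

/-- The variance of a function on a product is at most the sum of the mean partial variances. -/
lemma variance_prod_le {α β : Type*} [MeasurableSpace α] [MeasurableSpace β] {μ : Measure α}
    {ν : Measure β} [IsProbabilityMeasure μ] [IsProbabilityMeasure ν] {H : α × β → ℝ}
    (hm : Measurable H) (h2 : Integrable (fun z => H z ^ 2) (μ.prod ν)) :
    ∫ z, H z ^ 2 ∂(μ.prod ν) - (∫ z, H z ∂(μ.prod ν)) ^ 2 ≤
      ∫ x, (∫ y, H (x, y) ^ 2 ∂ν - (∫ y, H (x, y) ∂ν) ^ 2) ∂μ +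
      ∫ y, (∫ x, H (x, y) ^ 2 ∂μ - (∫ x, H (x, y) ∂μ) ^ 2) ∂ν := by
  have h1 : Integrable H (μ.prod ν) := integrable_of_integrable_sq hm.aestronglyMeasurable h2
  set A : α → ℝ := fun x => ∫ y, H (x, y) ∂ν with hA
  set B : β → ℝ := fun y => ∫ x, H (x, y) ∂μ with hB
  set m := ∫ z, H z ∂(μ.prod ν) with hmd
  have hAi : Integrable A μ := h1.integral_prod_left
  have hBi : Integrable B ν := h1.integral_prod_right
  have hA2 : Integrable (fun x => A x ^ 2) μ := by
    refine integrable_of_sq_le hAi.aestronglyMeasurable h2.integral_prod_left ?_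
    filter_upwards [h1.prod_right_ae, h2.prod_right_ae] with x hx1 hx2
    exact sq_integral_le_integral_sq hx1 hx2
  have hB2 : Integrable (fun y => B y ^ 2) ν := by
    refine integrable_of_sq_le hBi.aestronglyMeasurable h2.integral_prod_right ?_
    filter_upwards [h1.prod_left_ae, h2.prod_left_ae] with x hx1 hx2
    exact sq_integral_le_integral_sq hx1 hx2
  have hA' : Integrable (fun z : α × β => A z.1) (μ.prod ν) := hAi.comp_fst ν
  have hB' : Integrable (fun z : α × β => B z.2) (μ.prod ν) := hBi.comp_snd μ
  have hA2' : Integrable (fun z : α × β => A z.1 ^ 2) (μ.prod ν) := hA2.comp_fst ν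
  have hB2' : Integrable (fun z : α × β => B z.2 ^ 2) (μ.prod ν) := hB2.comp_snd μ
  have iHA := integrable_mul_of_sq hm.aestronglyMeasurable hA'.aestronglyMeasurable h2 hA2'
  have iHB := integrable_mul_of_sq hm.aestronglyMeasurable hB'.aestronglyMeasurable h2 hB2'
  have iAB := integrable_mul_of_sq hA'.aestronglyMeasurable hB'.aestronglyMeasurable hA2' hB2'
  have mA : ∫ x, A x ∂μ = m := (integral_prod _ h1).symm
  have mB : ∫ y, B y ∂ν = m := (integral_prod_symm _ h1).symm
  have eHA : ∫ z, H z * A z.1 ∂(μ.prod ν) = ∫ x, A x ^ 2 ∂μ := by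
    rw [integral_prod _ iHA]
    refine integral_congr_ae (Filter.Eventually.of_forall fun x => ?_)
    simp only [integral_mul_const, hA]
    ring
  have eHB : ∫ z, H z * B z.2 ∂(μ.prod ν) = ∫ y, B y ^ 2 ∂ν := by
    rw [integral_prod_symm _ iHB]
    refine integral_congr_ae (Filter.Eventually.of_forall fun x => ?_)
    simp only [integral_mul_const, hB]
    ring
  have eAB : ∫ z, A z.1 * B z.2 ∂(μ.prod ν) = m ^ 2 := by
    rw [integral_prod_mul A B, mA, mB]; ring
  have eA2 : ∫ z, A z.1 ^ 2 ∂(μ.prod ν) = ∫ x, A x ^ 2 ∂μ := by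
    rw [integral_prod _ hA2']; simp
  have eB2 : ∫ z, B z.2 ^ 2 ∂(μ.prod ν) = ∫ y, B y ^ 2 ∂ν := by
    rw [integral_prod_symm _ hB2']; simp
  have eA : ∫ z, A z.1 ∂(μ.prod ν) = m := by
    rw [integral_prod _ hA']; simpa using mA
  have eB : ∫ z, B z.2 ∂(μ.prod ν) = m := by
    rw [integral_prod_symm _ hB']; simpa using mB
  -- Efron–Stein: the integral of this square is ∫H² − ∫A² − ∫B² + m², which is exactly the
  -- right-hand side of the claim minus the left.
  have hnn : 0 ≤ ∫ z, (H z - A z.1 - B z.2 + m) ^ 2 ∂(μ.prod ν) :=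
    integral_nonneg fun _ => sq_nonneg _
  have hexp : ∀ z, (H z - A z.1 - B z.2 + m) ^ 2 = (H z ^ 2 + A z.1 ^ 2 + B z.2 ^ 2 + m ^ 2) +
      (-2) * (H z * A z.1) + (-2) * (H z * B z.2) + (2 * m) * H z + 2 * (A z.1 * B z.2) +
      (-2 * m) * A z.1 + (-2 * m) * B z.2 := fun z => by ring
  have hs1 := (h2.fun_add hA2').fun_add hB2'
  have hs2 := hs1.fun_add (integrable_const (μ := μ.prod ν) (m ^ 2))
  have hs3 := hs2.fun_add (iHA.const_mul (-2))
  have hs4 := hs3.fun_add (iHB.const_mul (-2))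
  have hs5 := hs4.fun_add (h1.const_mul (2 * m))
  have hs6 := hs5.fun_add (iAB.const_mul 2)
  have hs7 := hs6.fun_add (hA'.const_mul (-2 * m))
  simp only [hexp] at hnn
  rw [integral_add hs7 (hB'.const_mul _), integral_add hs6 (hA'.const_mul _),
    integral_add hs5 (iAB.const_mul _), integral_add hs4 (h1.const_mul _),
    integral_add hs3 (iHB.const_mul _), integral_add hs2 (iHA.const_mul _),
    integral_add hs1 (integrable_const _), integral_add (h2.fun_add hA2') hB2',
    integral_add h2 hA2'] at hnn
  simp only [integral_const_mul, eHA, eHB, eAB, eA2, eB2, eA, eB, ← hmd, integral_const,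
    probReal_univ, one_smul] at hnn
  rw [integral_sub h2.integral_prod_left hA2, integral_sub h2.integral_prod_right hB2,
    ← integral_prod _ h2, ← integral_prod_symm _ h2]
  nlinarith [hnn]

/-- Tensorization: one-dimensional Poincaré inequalities along the coordinate lines imply the
Poincaré inequality for a power of a probability measure. -/
lemma variance_pi_le {γ : Measure ℝ} [IsProbabilityMeasure γ] {n : ℕ}
    {H : (Fin n → ℝ) → ℝ} {G : Fin n → (Fin n → ℝ) → ℝ}
    (hm : Measurable H) (h2 : Integrable (fun z => H z ^ 2) (Measure.pi fun _ : Fin n => γ))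
    (hG : ∀ i, Integrable (G i) (Measure.pi fun _ : Fin n => γ))
    (hline : ∀ i, ∀ᵐ x ∂(Measure.pi fun _ : Fin n => γ),
      ∫ t, H (Function.update x i t) ^ 2 ∂γ - (∫ t, H (Function.update x i t) ∂γ) ^ 2 ≤
        ∫ t, G i (Function.update x i t) ∂γ) :
    ∫ x, H x ^ 2 ∂(Measure.pi fun _ : Fin n => γ) -
      (∫ x, H x ∂(Measure.pi fun _ : Fin n => γ)) ^ 2 ≤
      ∑ i, ∫ x, G i x ∂(Measure.pi fun _ : Fin n => γ) := by
  induction n with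
  | zero =>
    have h : ∀ x, H x = H default := fun x => congrArg H (Subsingleton.elim _ _)
    simp only [h]
    simp
  | succ n ih =>
    set π := Measure.pi fun _ : Fin n => γ with hπ
    have hmp' := (measurePreserving_piFinSuccAbove (fun _ : Fin (n + 1) => γ) 0).symm
    have hmp : MeasurePreserving (fun z : ℝ × (Fin n → ℝ) => (Fin.cons z.1 z.2 : Fin (n + 1) → ℝ))
        (γ.prod π) (Measure.pi fun _ : Fin (n + 1) => γ) := by
      convert hmp' using 1
      ext z i
      simp [MeasurableEquiv.piFinSuccAbove, Fin.insertNthEquiv]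
    have hemb : MeasurableEmbedding
        (fun z : ℝ × (Fin n → ℝ) => (Fin.cons z.1 z.2 : Fin (n + 1) → ℝ)) := by
      convert ((MeasurableEquiv.piFinSuccAbove (fun _ : Fin (n + 1) => ℝ) 0).symm).measurableEmbedding
        using 1
      ext z i
      simp [MeasurableEquiv.piFinSuccAbove, Fin.insertNthEquiv]
    set H' : ℝ × (Fin n → ℝ) → ℝ := fun z => H (Fin.cons z.1 z.2) with hH'
    have hm' : Measurable H' := hm.comp hmp.measurable
    have h2' : Integrable (fun z => H' z ^ 2) (γ.prod π) :=
      (hmp.integrable_comp_emb hemb).2 h2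
    have hG' : ∀ i, Integrable (fun z : ℝ × (Fin n → ℝ) => G i (Fin.cons z.1 z.2)) (γ.prod π) :=
      fun i => (hmp.integrable_comp_emb hemb).2 (hG i)
    have hl' : ∀ i, ∀ᵐ z ∂(γ.prod π),
        ∫ t, H (Function.update (Fin.cons z.1 z.2) i t) ^ 2 ∂γ -
          (∫ t, H (Function.update (Fin.cons z.1 z.2) i t) ∂γ) ^ 2 ≤
        ∫ t, G i (Function.update (Fin.cons z.1 z.2) i t) ∂γ := fun i =>
      hmp.quasiMeasurePreserving.ae (hline i)
    have key := variance_prod_le hm' h2'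
    rw [hmp.integral_comp hemb (fun x => H x ^ 2), hmp.integral_comp hemb H] at key
    refine key.trans ?_
    rw [Fin.sum_univ_succ, add_comm]
    have h1' : Integrable H' (γ.prod π) := integrable_of_integrable_sq hm'.aestronglyMeasurable h2'
    refine add_le_add ?_ ?_
    · rw [← hmp.integral_comp hemb (G 0), integral_prod_symm _ (hG' 0)]
      have hB2 : Integrable (fun y => (∫ x, H' (x, y) ∂γ) ^ 2) π := by
        refine integrable_of_sq_le h1'.integral_prod_right.aestronglyMeasurable
          h2'.integral_prod_right ?_
        filter_upwards [h1'.prod_left_ae, h2'.prod_left_ae] with x hx1 hx2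
        exact sq_integral_le_integral_sq hx1 hx2
      refine integral_mono_ae (h2'.integral_prod_right.fun_sub hB2) (hG' 0).integral_prod_right ?_
      have h3 := Measure.ae_ae_of_ae_prod
        ((Measure.measurePreserving_swap (μ := π) (ν := γ)).quasiMeasurePreserving.ae (hl' 0))
      filter_upwards [h3] with y hy
      -- The inequality on a line in the first direction does not depend on the first coordinate of
      -- the base point, so one good base point is enough.
      obtain ⟨x, hx⟩ := hy.exists
      simpa only [Prod.swap, Fin.update_cons_zero] using hx
    · have hA2 : Integrable (fun x => (∫ y, H' (x, y) ∂π) ^ 2) γ := by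
        refine integrable_of_sq_le h1'.integral_prod_left.aestronglyMeasurable
          h2'.integral_prod_left ?_
        filter_upwards [h1'.prod_right_ae, h2'.prod_right_ae] with x hx1 hx2
        exact sq_integral_le_integral_sq hx1 hx2
      have e1 : ∀ i : Fin n, ∫ x, G i.succ x ∂(Measure.pi fun _ : Fin (n + 1) => γ) =
          ∫ x, ∫ y, G i.succ (Fin.cons x y) ∂π ∂γ := fun i => by
        rw [← hmp.integral_comp hemb (G i.succ), integral_prod _ (hG' i.succ)]
      simp only [e1]
      rw [← integral_finsetSum _ fun i _ => (hG' i.succ).integral_prod_left]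
      refine integral_mono_ae (h2'.integral_prod_left.fun_sub hA2)
        (integrable_finsetSum _ fun i _ => (hG' i.succ).integral_prod_left) ?_
      have h3 := fun i : Fin n => Measure.ae_ae_of_ae_prod (hl' i.succ)
      have h4 := fun i : Fin n => (hG' i.succ).prod_right_ae
      filter_upwards [ae_all_iff.2 h3, ae_all_iff.2 h4, h2'.prod_right_ae] with x hx1 hx2 hx3
      refine ih (H := fun y => H' (x, y)) (G := fun i y => G i.succ (Fin.cons x y))
        (hm'.comp measurable_prodMk_left) hx3 hx2 fun i => ?_
      filter_upwards [hx1 i] with y hy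
      simpa only [hH', Fin.cons_update] using hy

end Tensorization

/-! ### The Gaussian measure and its one-dimensional Poincaré inequality. -/

section Gaussian

open ProbabilityTheory

lemma gaussianPDFReal_zero_one (x : ℝ) :
    gaussianPDFReal 0 1 x = (√(2 * Real.pi))⁻¹ * Real.exp (-(1 / 2) * x ^ 2) := by
  simp only [gaussianPDFReal, NNReal.coe_one, sub_zero, mul_one]
  congr 2
  ring

lemma integrable_gaussianReal_iff {f : ℝ → ℝ} :
    Integrable f (gaussianReal 0 1) ↔ Integrable (fun x => f x * gaussianPDFReal 0 1 x) := by
  rw [gaussianReal_of_var_ne_zero 0 one_ne_zero,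
    integrable_withDensity_iff_integrable_smul' (measurable_gaussianPDF 0 1)
      (Filter.Eventually.of_forall fun _ => gaussianPDF_lt_top)]
  simp [mul_comm]

lemma integral_gaussianReal (f : ℝ → ℝ) :
    ∫ x, f x ∂(gaussianReal 0 1) = ∫ x, f x * gaussianPDFReal 0 1 x := by
  rw [integral_gaussianReal_eq_integral_smul one_ne_zero]
  simp [mul_comm]

lemma hasDerivAt_gaussianPDFReal (x : ℝ) :
    HasDerivAt (gaussianPDFReal 0 1) (-(x * gaussianPDFReal 0 1 x)) x := by
  have h1 : gaussianPDFReal 0 1 = fun x => (√(2 * Real.pi))⁻¹ * Real.exp (-(1 / 2) * x ^ 2) :=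
    funext gaussianPDFReal_zero_one
  rw [h1]
  refine (((hasDerivAt_pow 2 x).const_mul (-(1 / 2))).exp.const_mul _).congr_deriv ?_
  push_cast
  ring

lemma tendsto_gaussianPDFReal :
    Filter.Tendsto (gaussianPDFReal 0 1) Filter.atTop (nhds 0) := by
  have h1 : gaussianPDFReal 0 1 = fun x => (√(2 * Real.pi))⁻¹ * Real.exp (-(1 / 2) * x ^ 2) :=
    funext gaussianPDFReal_zero_one
  rw [h1, ← mul_zero (√(2 * Real.pi))⁻¹]
  refine Filter.Tendsto.const_mul _ (Real.tendsto_exp_atBot.comp ?_)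
  exact (Filter.tendsto_pow_atTop two_ne_zero).const_mul_atTop_of_neg (by norm_num)

/-- The weighted inequality with T(x) = x: the tail integral of x times the density is the density
itself, so the constant is 1. -/
lemma variance_gaussianReal_le {v v' : ℝ → ℝ} (hv : ∀ x, HasDerivAt v (v' x) x)
    (hv' : Continuous v') (h2 : Integrable (fun x => v x ^ 2) (gaussianReal 0 1))
    (h2' : Integrable (fun x => v' x ^ 2) (gaussianReal 0 1)) :
    ∫ x, v x ^ 2 ∂(gaussianReal 0 1) - (∫ x, v x ∂(gaussianReal 0 1)) ^ 2 ≤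
      ∫ x, v' x ^ 2 ∂(gaussianReal 0 1) := by
  have hc : Continuous (gaussianPDFReal 0 1) :=
    continuous_iff_continuousAt.2 fun x => (hasDerivAt_gaussianPDFReal x).continuousAt
  have h1 : ∫ x, gaussianPDFReal 0 1 x = 1 := integral_gaussianPDFReal_eq_one 0 one_ne_zero
  have hxi : Integrable (fun x : ℝ => x * gaussianPDFReal 0 1 x) := by
    have := (integrable_mul_exp_neg_mul_sq (b := 1 / 2) (by norm_num)).const_mul
      (√(2 * Real.pi))⁻¹
    refine this.congr (Filter.Eventually.of_forall fun x => ?_)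
    simp only [gaussianPDFReal_zero_one]
    ring
  have hx0 : ∫ x, x * gaussianPDFReal 0 1 x = 0 := by
    have := integral_id_gaussianReal (μ := 0) (v := 1)
    rwa [integral_gaussianReal] at this
  have hK : ∀ s, ∫ x in Ici s, x * gaussianPDFReal 0 1 x = gaussianPDFReal 0 1 s := by
    intro s
    have := integral_Ioi_of_hasDerivAt_of_tendsto' (a := s) (f := fun x => -gaussianPDFReal 0 1 x)
      (f' := fun x => x * gaussianPDFReal 0 1 x) (m := 0)
      (fun x _ => by simpa using (hasDerivAt_gaussianPDFReal x).fun_neg)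
      hxi.integrableOn (by simpa using tendsto_gaussianPDFReal.neg)
    rw [integral_Ici_eq_integral_Ioi, this]
    ring
  have := integral_sq_sub_sq_integral_le (p := gaussianPDFReal 0 1) (e := gaussianPDFReal 0 1)
    (T := fun x => x) (T' := fun _ => 1) (C := 1) (v := v) (v' := v') hc
    (gaussianPDFReal_nonneg 0 1) (integrable_gaussianPDFReal 0 1) (fun x => hasDerivAt_id' x)
    continuous_const (fun _ => one_pos) hxi hx0 zero_le_one (gaussianPDFReal_nonneg 0 1)
    (fun s => by rw [hK]; simp) hv hv' (integrable_gaussianReal_iff.1 h2)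
    (by simpa only [mul_comm] using integrable_gaussianReal_iff.1 h2')
  simp only [integral_gaussianReal]
  rw [h1, one_mul, one_mul, one_mul] at this
  simpa only [mul_comm (gaussianPDFReal 0 1 _)] using this

/-- The standard Gaussian measure on `ℝⁿ`. -/
abbrev gaussianPi (n : ℕ) : Measure (Fin n → ℝ) := Measure.pi fun _ => gaussianReal 0 1

lemma gaussianPi_eq_withDensity (n : ℕ) :
    gaussianPi n = (volume : Measure (Fin n → ℝ)).withDensity
      fun x => ENNReal.ofReal (∏ i, gaussianPDFReal 0 1 (x i)) := by
  have hint : Integrable (fun x : Fin n → ℝ => ∏ i, gaussianPDFReal 0 1 (x i)) :=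
    Integrable.fintype_prod (f := fun _ : Fin n => gaussianPDFReal 0 1)
      fun i => integrable_gaussianPDFReal 0 1
  refine Measure.pi_eq fun s hs => ?_
  rw [withDensity_apply _ (MeasurableSet.univ_pi hs), ← ofReal_integral_eq_lintegral_ofReal
    hint.integrableOn (Filter.Eventually.of_forall fun x =>
      Finset.prod_nonneg fun i _ => gaussianPDFReal_nonneg 0 1 _), volume_pi,
    Measure.restrict_pi_pi, integral_fintype_prod_eq_prod (f := fun _ : Fin n => gaussianPDFReal 0 1),
    ENNReal.ofReal_prod_of_nonneg fun i _ => integral_nonneg (gaussianPDFReal_nonneg 0 1)]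
  refine Finset.prod_congr rfl fun i _ => ?_
  rw [gaussianReal_apply_eq_integral 0 one_ne_zero]

/-- The product density depends only on the Euclidean norm; this links the coordinatewise
tensorization to polar coordinates. -/
lemma integral_gaussianPi {n : ℕ} (F : EuclideanSpace ℝ (Fin n) → ℝ) :
    ∫ x, F (WithLp.toLp 2 x) ∂(gaussianPi n) =
      (√(2 * Real.pi))⁻¹ ^ n * ∫ x, F x * Real.exp (-(1 / 2) * ‖x‖ ^ 2) := by
  have hm : Measurable fun x : Fin n → ℝ => Real.toNNReal (∏ i, gaussianPDFReal 0 1 (x i)) := by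
    have := measurable_gaussianPDFReal 0 1
    fun_prop
  rw [gaussianPi_eq_withDensity]
  unfold ENNReal.ofReal
  rw [integral_withDensity_eq_integral_smul hm, ← integral_const_mul,
    ← (PiLp.volume_preserving_toLp (Fin n)).integral_comp
      (MeasurableEquiv.toLp 2 (Fin n → ℝ)).measurableEmbedding]
  refine integral_congr_ae (Filter.Eventually.of_forall fun x => ?_)
  have h : 0 ≤ ∏ i, gaussianPDFReal 0 1 (x i) :=
    Finset.prod_nonneg fun i _ => gaussianPDFReal_nonneg 0 1 _
  simp only [NNReal.smul_def, Real.coe_toNNReal _ h]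
  simp only [smul_eq_mul, gaussianPDFReal_zero_one,
    Finset.prod_mul_distrib, Finset.prod_const, Finset.card_univ, Fintype.card_fin,
    ← Real.exp_sum, ← Finset.mul_sum, EuclideanSpace.norm_sq_eq, Real.norm_eq_abs, sq_abs]
  ring

end Gaussian

/-! ### Separation of radial and spherical integrals. -/

section SphereIntegral

variable {n : ℕ}

/-- No integrability is needed: for a product of functions of separate variables the Bochner
integral over a product measure factors unconditionally. -/
lemma integral_mul_radial (hn : 1 ≤ n) (F : EuclideanSpace ℝ (Fin n) → ℝ) (w : ℝ → ℝ) :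
    ∫ x : EuclideanSpace ℝ (Fin n), F (‖x‖⁻¹ • x) * w ‖x‖ =
      (∫ ξ, F (ξ : EuclideanSpace ℝ (Fin n)) ∂(sphereMeasure n)) *
        ∫ s in Ioi (0 : ℝ), w s * s ^ (n - 1) := by
  have : Nonempty (Fin n) := ⟨⟨0, hn⟩⟩
  set μ := (volume : Measure (EuclideanSpace ℝ (Fin n)))
  have h1 : ∫ x, F (‖x‖⁻¹ • x) * w ‖x‖ = ∫ x : ({(0)}ᶜ : Set (EuclideanSpace ℝ (Fin n))),
      F (‖x.1‖⁻¹ • x.1) * w ‖x.1‖ ∂(μ.comap (↑)) := by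
    rw [integral_subtype_comap (measurableSet_singleton _).compl
      fun x => F (‖x‖⁻¹ • x) * w ‖x‖, restrict_compl_singleton]
  have h2 := μ.measurePreserving_homeomorphUnitSphereProd.integral_comp
        (Homeomorph.measurableEmbedding _)
        (fun z : Sph n × Ioi (0 : ℝ) => F (z.1 : EuclideanSpace ℝ (Fin n)) * w z.2)
  simp only [homeomorphUnitSphereProd_apply_fst_coe, homeomorphUnitSphereProd_apply_snd_coe] at h2
  have hm : Measurable fun a : Ioi (0 : ℝ) => Real.toNNReal ((a : ℝ) ^ (n - 1)) :=
    (measurable_subtype_coe.pow_const _).real_toNNReal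
  rw [h1, h2, integral_prod_mul (fun ξ : Sph n => F (ξ : EuclideanSpace ℝ (Fin n)))
    (fun s : Ioi (0 : ℝ) => w s)]
  congr 1
  simp only [Measure.volumeIoiPow, finrank_euclideanSpace, Fintype.card_fin, ENNReal.ofReal]
  rw [integral_withDensity_eq_integral_smul hm,
    integral_subtype_comap measurableSet_Ioi fun a : ℝ => Real.toNNReal (a ^ (n - 1)) • w a]
  refine setIntegral_congr_fun measurableSet_Ioi fun x hx => ?_
  simp only [NNReal.smul_def, Real.coe_toNNReal _ (pow_nonneg (le_of_lt hx) _), smul_eq_mul,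
    mul_comm]

/-- This is the Gaussian second moment E|x|² = n, obtained from Γ(z+1) = zΓ(z). It supplies the n in
the constant n − 1 on the sphere. -/
lemma integral_Ioi_exp_mul_sq (n : ℕ) (hn : 1 ≤ n) :
    ∫ s in Ioi (0 : ℝ), s ^ 2 * Real.exp (-(1 / 2) * s ^ 2) * s ^ (n - 1) =
      n * ∫ s in Ioi (0 : ℝ), Real.exp (-(1 / 2) * s ^ 2) * s ^ (n - 1) := by
  have hn' : (0 : ℝ) < n := by exact_mod_cast hn
  have e1 : ∀ k : ℕ, ∫ s in Ioi (0 : ℝ), Real.exp (-(1 / 2) * s ^ 2) * s ^ k =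
      (1 / 2 : ℝ) ^ (-((k : ℝ) + 1) / 2) * (1 / 2) * Real.Gamma (((k : ℝ) + 1) / 2) := by
    intro k
    have := integral_rpow_mul_exp_neg_mul_rpow (p := 2) (q := k) (b := 1 / 2) (by norm_num)
      (by have := Nat.cast_nonneg (α := ℝ) k; linarith) (by norm_num)
    rw [← this]
    refine setIntegral_congr_fun measurableSet_Ioi fun x hx => ?_
    simp only [Real.rpow_natCast, Real.rpow_ofNat]
    ring
  obtain ⟨m, rfl⟩ := Nat.exists_eq_add_of_le' hn
  have e2 : ∀ s : ℝ, s ^ 2 * Real.exp (-(1 / 2) * s ^ 2) * s ^ (m + 1 - 1) =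
      Real.exp (-(1 / 2) * s ^ 2) * s ^ (m + 2) := by
    intro s
    rw [Nat.add_sub_cancel]
    ring
  simp only [e2, e1]
  have h3 : (((m + 2 : ℕ) : ℝ) + 1) / 2 = ((m : ℝ) + 1) / 2 + 1 := by push_cast; ring
  have h4 : -(((m + 2 : ℕ) : ℝ) + 1) / 2 = -((m : ℝ) + 1) / 2 - 1 := by push_cast; ring
  rw [h3, h4, Real.Gamma_add_one (by positivity), Real.rpow_sub_one (by norm_num)]
  push_cast
  field_simp

lemma integral_Ioi_exp_pos (n : ℕ) :
    0 < ∫ s in Ioi (0 : ℝ), Real.exp (-(1 / 2) * s ^ 2) * s ^ n := by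
  have := integral_rpow_mul_exp_neg_mul_rpow (p := 2) (q := n) (b := 1 / 2) (by norm_num)
      (by have := Nat.cast_nonneg (α := ℝ) n; linarith) (by norm_num)
  have h2 : ∫ s in Ioi (0 : ℝ), Real.exp (-(1 / 2) * s ^ 2) * s ^ n =
      ∫ x in Ioi (0 : ℝ), x ^ (n : ℝ) * Real.exp (-(1 / 2) * x ^ (2 : ℝ)) := by
    refine setIntegral_congr_fun measurableSet_Ioi fun x hx => ?_
    simp only [Real.rpow_natCast, Real.rpow_ofNat]
    ring
  rw [h2, this]
  have : 0 < Real.Gamma (((n : ℝ) + 1) / 2) := Real.Gamma_pos_of_pos (by positivity)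
  positivity

end SphereIntegral

/-! ### The Poincaré inequality on the Euclidean unit sphere. -/

section SpherePoincare

open ProbabilityTheory

variable {n : ℕ}

/-- A function homogeneous of degree one has partial derivatives homogeneous of degree zero, hence
determined by, and bounded through, their values on the sphere. -/
lemma hasDerivAt_norm_mul_comp_normalize {g : EuclideanSpace ℝ (Fin n) → ℝ}
    (hg : Differentiable ℝ g) (c : ℝ) {l : ℝ → EuclideanSpace ℝ (Fin n)} {i : Fin n} {t : ℝ}
    (hl : HasDerivAt l (EuclideanSpace.single i 1) t) (h0 : l t ≠ 0) :
    HasDerivAt (fun t => ‖l t‖ * (g (‖l t‖⁻¹ • l t) - c))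
      ((‖l t‖⁻¹ • l t) i * (g (‖l t‖⁻¹ • l t) - c) +
        fderiv ℝ g (‖l t‖⁻¹ • l t) (EuclideanSpace.single i 1) -
        (‖l t‖⁻¹ • l t) i * fderiv ℝ g (‖l t‖⁻¹ • l t) (‖l t‖⁻¹ • l t)) t := by
  have hn0 : ‖l t‖ ≠ 0 := norm_ne_zero_iff.2 h0
  have h1 : HasDerivAt (fun t => ‖l t‖) (l t i / ‖l t‖) t := by
    have h2 := (hl.norm_sq).sqrt (by positivity)
    simp only [Real.sqrt_sq (norm_nonneg _)] at h2
    refine h2.congr_deriv ?_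
    rw [EuclideanSpace.inner_single_right]
    simp
    field_simp
  have h3 : HasDerivAt (fun t => ‖l t‖⁻¹ • l t) (‖l t‖⁻¹ • EuclideanSpace.single i 1 +
      (-(l t i / ‖l t‖) / ‖l t‖ ^ 2) • l t) t := (h1.inv hn0).smul hl
  have h4 : HasDerivAt (fun t => g (‖l t‖⁻¹ • l t)) _ t := (hg (‖l t‖⁻¹ • l t)).hasFDerivAt.comp_hasDerivAt t h3
  refine (h1.mul (h4.sub_const c)).congr_deriv ?_
  simp only [map_add, map_smul, PiLp.smul_apply, smul_eq_mul]
  field_simp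
  ring

lemma integrable_sq_gaussianReal : Integrable (fun t : ℝ => t ^ 2) (gaussianReal 0 1) := by
  have := (memLp_id_gaussianReal (μ := 0) (v := 1) 2).integrable_sq
  simpa using this

lemma integrable_norm_sq_gaussianPi :
    Integrable (fun x : Fin n → ℝ => ‖WithLp.toLp 2 x‖ ^ 2) (gaussianPi n) := by
  simp only [EuclideanSpace.norm_sq_eq, Real.norm_eq_abs, sq_abs]
  refine integrable_finsetSum _ fun i _ => ?_
  exact (measurePreserving_eval (fun _ : Fin n => gaussianReal 0 1) i).integrable_comp_of_integrable
    integrable_sq_gaussianReal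

lemma norm_normalize_le (x : EuclideanSpace ℝ (Fin n)) : ‖‖x‖⁻¹ • x‖ ≤ 1 := by
  rw [norm_smul, norm_inv, norm_norm]
  exact inv_mul_le_one

lemma ae_gaussianPi_ne_zero (j : Fin n) : ∀ᵐ x ∂gaussianPi n, x j ≠ 0 := by
  have := nullSingletonClass_gaussianReal (μ := 0) (v := 1) one_ne_zero
  exact Measure.ae_eval_ne (μ := fun _ : Fin n => gaussianReal 0 1) j 0

/-- The Poincaré inequality on the unit sphere of `ℝⁿ`, written with ambient derivatives. -/
theorem sphere_poincare (hn : 2 ≤ n) {g : EuclideanSpace ℝ (Fin n) → ℝ} (hg : ContDiff ℝ 1 g)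
    {c : ℝ} (hc : ∫ ξ, (g (ξ : EuclideanSpace ℝ (Fin n)) - c) ∂(sphereMeasure n) = 0) :
    ((n : ℝ) - 1) * ∫ ξ, (g (ξ : EuclideanSpace ℝ (Fin n)) - c) ^ 2 ∂(sphereMeasure n) ≤
      ∫ ξ, (∑ i, fderiv ℝ g (ξ : EuclideanSpace ℝ (Fin n)) (EuclideanSpace.single i 1) ^ 2 -
        fderiv ℝ g (ξ : EuclideanSpace ℝ (Fin n)) ξ ^ 2) ∂(sphereMeasure n) := by
  have hgc : Continuous g := hg.continuous
  have hfd : Continuous (fderiv ℝ g) := hg.continuous_fderiv one_ne_zero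
  set N : Fin n → EuclideanSpace ℝ (Fin n) → ℝ := fun i y => y i * (g y - c) +
    fderiv ℝ g y (EuclideanSpace.single i 1) - y i * fderiv ℝ g y y with hN
  have hNc : ∀ i, Continuous (N i) := fun i => by
    simp only [hN]
    fun_prop
  -- With degree-one homogeneity the Gaussian energy of H is a multiple of ∫((g − c)² + |∇_tan g|²)
  -- over the sphere, and ∫H² is n times the same multiple of ∫(g − c)². The Gaussian inequality
  -- thus reads n∫(g − c)² ≤ ∫(g − c)² + ∫|∇_tan g|².
  set H : EuclideanSpace ℝ (Fin n) → ℝ := fun x => ‖x‖ * (g (‖x‖⁻¹ • x) - c) with hH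
  have hnm : Measurable fun x : EuclideanSpace ℝ (Fin n) => ‖x‖⁻¹ • x := measurable_norm.inv.smul measurable_id
  have hHm : Measurable H := measurable_norm.mul ((hgc.measurable.comp hnm).sub_const c)
  have hbd : ∀ φ : EuclideanSpace ℝ (Fin n) → ℝ, Continuous φ → ∃ K, 0 ≤ K ∧ ∀ x : EuclideanSpace ℝ (Fin n), φ (‖x‖⁻¹ • x) ^ 2 ≤ K := by
    intro φ hφ
    obtain ⟨K, hK⟩ := (isCompact_closedBall (0 : EuclideanSpace ℝ (Fin n)) 1).exists_bound_of_continuousOn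
      (f := fun x => φ x ^ 2) (by fun_prop)
    have hK' : ∀ x : EuclideanSpace ℝ (Fin n), φ (‖x‖⁻¹ • x) ^ 2 ≤ K := fun x => by
      have := hK (‖x‖⁻¹ • x) (by simpa using norm_normalize_le x)
      exact (le_abs_self _).trans this
    exact ⟨K, (sq_nonneg _).trans (hK' 0), hK'⟩
  obtain ⟨K, hK0, hK⟩ := hbd (fun x => g x - c) (by fun_prop)
  have hHK : ∀ x, H x ^ 2 ≤ K * ‖x‖ ^ 2 := fun x => by
    simp only [hH, mul_pow]
    nlinarith [hK x, sq_nonneg ‖x‖]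
  have htoLp : Measurable fun x : Fin n → ℝ => (WithLp.toLp 2 x : EuclideanSpace ℝ (Fin n)) := by fun_prop
  have hvar := variance_pi_le (γ := gaussianReal 0 1) (n := n) (H := fun x => H (WithLp.toLp 2 x))
    (G := fun i x => N i (‖(WithLp.toLp 2 x : EuclideanSpace ℝ (Fin n))‖⁻¹ • WithLp.toLp 2 x) ^ 2)
    (hHm.comp htoLp)
    (integrable_of_sq_le (hHm.comp htoLp).aestronglyMeasurable
      (integrable_norm_sq_gaussianPi.const_mul K) (Filter.Eventually.of_forall fun x => hHK _))
    (fun i => by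
      obtain ⟨K', hK'0, hK'⟩ := hbd (N i) (hNc i)
      refine integrable_of_sq_le (f := fun x => N i (‖(WithLp.toLp 2 x : EuclideanSpace ℝ (Fin n))‖⁻¹ • WithLp.toLp 2 x))
        (((hNc i).measurable.comp hnm).comp htoLp).aestronglyMeasurable
        (integrable_const K') (Filter.Eventually.of_forall fun x => hK' _))
    (fun i => by
      -- H is not differentiable at the origin. Since n ≥ 2, a second coordinate is nonzero almost
      -- surely and stays fixed, so almost every coordinate line misses the origin.
      obtain ⟨j, hj⟩ : ∃ j : Fin n, j ≠ i := by
        have : Nontrivial (Fin n) := Fin.nontrivial_iff_two_le.2 hn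
        exact exists_ne i
      filter_upwards [ae_gaussianPi_ne_zero j] with x hx
      set l : ℝ → EuclideanSpace ℝ (Fin n) := fun t => WithLp.toLp 2 (Function.update x i t) with hl
      have hl0 : ∀ t, l t ≠ 0 := fun t h0 => hx (by
        have := congrArg (fun z : EuclideanSpace ℝ (Fin n) => z j) h0
        simpa [hl, Function.update_of_ne hj] using this)
      have hld : ∀ t, HasDerivAt l (EuclideanSpace.single i 1) t := fun t => by
        have h1 := (PiLp.continuousLinearEquiv 2 ℝ (fun _ : Fin n => ℝ)).symm.hasFDerivAt
          |>.comp_hasDerivAt t (hasDerivAt_update x i t)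
        refine h1.congr_deriv ?_
        rfl
      have hlc : Continuous l := continuous_iff_continuousAt.2 fun t => (hld t).continuousAt
      have hder := fun t => hasDerivAt_norm_mul_comp_normalize
        (hg.differentiable one_ne_zero) c (hld t) (hl0 t)
      obtain ⟨K', hK'0, hK'⟩ := hbd (N i) (hNc i)
      have hNl : Continuous fun t => N i (‖l t‖⁻¹ • l t) :=
        (hNc i).comp ((hlc.norm.inv₀ fun t => norm_ne_zero_iff.2 (hl0 t)).smul hlc)
      refine variance_gaussianReal_le hder hNl ?_ ?_
      · refine integrable_of_sq_le (g := fun t => K * (‖(WithLp.toLp 2 x : EuclideanSpace ℝ (Fin n))‖ ^ 2 + t ^ 2))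
          (continuous_iff_continuousAt.2 fun t => (hder t).continuousAt).aestronglyMeasurable
          (((integrable_const _).add integrable_sq_gaussianReal).const_mul K)
          (Filter.Eventually.of_forall fun t => (hHK (l t)).trans ?_)
        refine mul_le_mul_of_nonneg_left ?_ hK0
        simp only [EuclideanSpace.norm_sq_eq, Real.norm_eq_abs, sq_abs, hl]
        rw [← Finset.add_sum_erase Finset.univ (fun k => Function.update x i t k ^ 2)
            (Finset.mem_univ i),
          ← Finset.add_sum_erase (a := i) Finset.univ (fun k => x k ^ 2) (Finset.mem_univ i)]
        have : ∑ k ∈ Finset.univ.erase i, Function.update x i t k ^ 2 =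
            ∑ k ∈ Finset.univ.erase i, x k ^ 2 :=
          Finset.sum_congr rfl fun k hk => by
            rw [Function.update_of_ne (Finset.ne_of_mem_erase hk)]
        rw [this, Function.update_self]
        nlinarith [sq_nonneg (x i)]
      · exact integrable_of_sq_le hNl.aestronglyMeasurable (integrable_const K')
          (Filter.Eventually.of_forall fun t => hK' _))
  change ∫ x, H (WithLp.toLp 2 x) ^ 2 ∂gaussianPi n - (∫ x, H (WithLp.toLp 2 x) ∂gaussianPi n) ^ 2 ≤
    ∑ i, ∫ x, N i (‖(WithLp.toLp 2 x : EuclideanSpace ℝ (Fin n))‖⁻¹ • WithLp.toLp 2 x) ^ 2 ∂gaussianPi n at hvar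
  rw [integral_gaussianPi (fun x => H x ^ 2), integral_gaussianPi H] at hvar
  have hn1 : 1 ≤ n := by omega
  set J := ∫ s in Ioi (0 : ℝ), Real.exp (-(1 / 2) * s ^ 2) * s ^ (n - 1) with hJ
  have hJ0 : 0 < J := integral_Ioi_exp_pos _
  have e1 : ∫ x : EuclideanSpace ℝ (Fin n), H x ^ 2 * Real.exp (-(1 / 2) * ‖x‖ ^ 2) =
      (∫ ξ, (g (ξ : EuclideanSpace ℝ (Fin n)) - c) ^ 2 ∂(sphereMeasure n)) * (n * J) := by
    rw [hJ, ← integral_Ioi_exp_mul_sq n hn1, ← integral_mul_radial hn1 (fun x => (g x - c) ^ 2)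
      (fun s => s ^ 2 * Real.exp (-(1 / 2) * s ^ 2))]
    refine integral_congr_ae (Filter.Eventually.of_forall fun x => ?_)
    simp only [hH]
    ring
  have e2 : ∫ x : EuclideanSpace ℝ (Fin n), H x * Real.exp (-(1 / 2) * ‖x‖ ^ 2) = 0 := by
    have := integral_mul_radial hn1 (fun x => g x - c)
      (fun s => s * Real.exp (-(1 / 2) * s ^ 2))
    rw [hc, zero_mul] at this
    rw [← this]
    refine integral_congr_ae (Filter.Eventually.of_forall fun x => ?_)
    simp only [hH]
    ring
  have e3 : ∀ i, ∫ x, N i (‖(WithLp.toLp 2 x : EuclideanSpace ℝ (Fin n))‖⁻¹ • WithLp.toLp 2 x) ^ 2 ∂gaussianPi n =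
      (√(2 * Real.pi))⁻¹ ^ n * ((∫ ξ, N i (ξ : EuclideanSpace ℝ (Fin n)) ^ 2 ∂(sphereMeasure n)) * J) := fun i => by
    rw [integral_gaussianPi (fun x => N i (‖x‖⁻¹ • x) ^ 2), hJ,
      ← integral_mul_radial hn1 (fun x => N i x ^ 2) (fun s => Real.exp (-(1 / 2) * s ^ 2))]
  have hcont : ∀ φ : EuclideanSpace ℝ (Fin n) → ℝ, Continuous φ → Integrable (fun ξ : Sph n => φ ξ) (sphereMeasure n) :=
    fun φ hφ => (hφ.comp continuous_subtype_val).integrable_of_hasCompactSupport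
      (HasCompactSupport.of_compactSpace _)
  simp only [e1, e2, e3] at hvar
  rw [← Finset.mul_sum, ← Finset.sum_mul, ← integral_finsetSum _
    (fun i _ => hcont (fun x => N i x ^ 2) ((hNc i).pow 2))] at hvar
  -- On the sphere the gradient of H is (g − c)ξ plus the tangential gradient of g, and the two are
  -- orthogonal.
  have e4 : ∀ ξ : Sph n, ∑ i, N i (ξ : EuclideanSpace ℝ (Fin n)) ^ 2 = (g (ξ : EuclideanSpace ℝ (Fin n)) - c) ^ 2 +
      (∑ i, fderiv ℝ g (ξ : EuclideanSpace ℝ (Fin n)) (EuclideanSpace.single i 1) ^ 2 - fderiv ℝ g (ξ : EuclideanSpace ℝ (Fin n)) ξ ^ 2) := by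
    intro ξ
    have hξ : ∑ i, (ξ : EuclideanSpace ℝ (Fin n)) i ^ 2 = 1 := by
      have := EuclideanSpace.norm_sq_eq (ξ : EuclideanSpace ℝ (Fin n))
      simp only [Real.norm_eq_abs, sq_abs] at this
      rw [← this, norm_eq_of_mem_sphere ξ, one_pow]
    have ha : ∑ i, (ξ : EuclideanSpace ℝ (Fin n)) i * fderiv ℝ g (ξ : EuclideanSpace ℝ (Fin n)) (EuclideanSpace.single i 1) =
        fderiv ℝ g (ξ : EuclideanSpace ℝ (Fin n)) ξ := by
      have h1 : (ξ : EuclideanSpace ℝ (Fin n)) = ∑ i, (ξ : EuclideanSpace ℝ (Fin n)) i • EuclideanSpace.single i (1 : ℝ) := by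
        ext j
        simp [Finset.sum_apply, Pi.single_apply]
      have h2 := congrArg (fderiv ℝ g (ξ : EuclideanSpace ℝ (Fin n))) h1
      rw [h2, map_sum]
      simp only [map_smul, smul_eq_mul]
    set k := g (ξ : EuclideanSpace ℝ (Fin n)) - c
    set a := fderiv ℝ g (ξ : EuclideanSpace ℝ (Fin n)) ξ
    have e : ∀ i, N i (ξ : EuclideanSpace ℝ (Fin n)) ^ 2 = (k - a) ^ 2 * (ξ : EuclideanSpace ℝ (Fin n)) i ^ 2 + 2 * (k - a) *
        ((ξ : EuclideanSpace ℝ (Fin n)) i * fderiv ℝ g (ξ : EuclideanSpace ℝ (Fin n)) (EuclideanSpace.single i 1)) +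
        fderiv ℝ g (ξ : EuclideanSpace ℝ (Fin n)) (EuclideanSpace.single i 1) ^ 2 := fun i => by
      simp only [hN]
      ring
    simp only [e, Finset.sum_add_distrib, ← Finset.mul_sum, hξ, ha]
    ring
  simp only [e4] at hvar
  rw [integral_add (hcont (fun x => (g x - c) ^ 2) (by fun_prop))
    (hcont (fun x => ∑ i, fderiv ℝ g x (EuclideanSpace.single i 1) ^ 2 - fderiv ℝ g x x ^ 2)
      (by fun_prop))] at hvar
  have hC : 0 < (√(2 * Real.pi))⁻¹ ^ n * J := by positivity
  refine le_of_mul_le_mul_left ?_ hC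
  linarith

end SpherePoincare

/-! ### Inequalities in the latitude variable τ of the gauge sphere. -/

section Latitude

variable {n : ℕ}

lemma hasDerivAt_latitude (τ : ℝ) : HasDerivAt latitude (-(τ * latitude τ ^ 5 / 2)) τ := by
  have h : (0 : ℝ) < 1 + τ ^ 2 := by positivity
  have h1 := ((hasDerivAt_pow 2 τ).const_add 1).rpow_const (p := -1 / 4) (Or.inl h.ne')
  refine h1.congr_deriv ?_
  have h2 : latitude τ ^ 5 = (1 + τ ^ 2) ^ (-1 / 4 - 1 : ℝ) := by
    unfold latitude
    rw [← Real.rpow_natCast, ← Real.rpow_mul h.le]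
    norm_num
  rw [h2]
  push_cast
  ring

lemma hasDerivAt_latitude_pow (k : ℕ) (τ : ℝ) :
    HasDerivAt (fun τ => latitude τ ^ k) (-((k : ℝ) * τ * latitude τ ^ (k + 4) / 2)) τ := by
  refine ((hasDerivAt_latitude τ).pow k).congr_deriv ?_
  rcases k with _ | k
  · simp
  · simp only [Nat.add_sub_cancel]
    ring

lemma latitude_le_one (τ : ℝ) : latitude τ ≤ 1 := by
  refine (pow_le_one_iff_of_nonneg (latitude_pos τ).le (n := 4) (by norm_num)).1 ?_
  nlinarith [latitude_pow_four τ, pow_pos (latitude_pos τ) 4, sq_nonneg τ]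

lemma abs_mul_latitude_sq_le (τ : ℝ) : |τ| * latitude τ ^ 2 ≤ 1 := by
  refine abs_le_of_sq_le_sq' ?_ zero_le_one |>.2
  rw [mul_pow, sq_abs]
  nlinarith [latitude_pow_four τ, pow_pos (latitude_pos τ) 4]

lemma latitude_pow_eight (τ : ℝ) : (1 + τ ^ 2) ^ 2 * latitude τ ^ 8 = 1 := by
  have := latitude_pow_four τ
  calc (1 + τ ^ 2) ^ 2 * latitude τ ^ 8 = (latitude τ ^ 4 * (1 + τ ^ 2)) ^ 2 := by ring
    _ = 1 := by rw [this, one_pow]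

lemma tendsto_latitude_pow_atTop {k : ℕ} (hk : k ≠ 0) :
    Filter.Tendsto (fun τ => latitude τ ^ k) Filter.atTop (nhds 0) := by
  have h1 : Filter.Tendsto latitude Filter.atTop (nhds 0) := by
    have h2 := tendsto_rpow_neg_atTop (y := 1 / 4) (by norm_num)
    have h3 : Filter.Tendsto (fun τ : ℝ => 1 + τ ^ 2) Filter.atTop Filter.atTop :=
      Filter.tendsto_atTop_add_const_left _ _ (Filter.tendsto_pow_atTop two_ne_zero)
    refine (h2.comp h3).congr fun τ => ?_
    simp only [Function.comp_apply, latitude]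
    norm_num
  simpa [hk] using h1.pow k

lemma latitude_neg (τ : ℝ) : latitude (-τ) = latitude τ := by simp [latitude]

lemma tendsto_latitude_pow_atBot {k : ℕ} (hk : k ≠ 0) :
    Filter.Tendsto (fun τ => latitude τ ^ k) Filter.atBot (nhds 0) :=
  ((tendsto_latitude_pow_atTop hk).comp Filter.tendsto_neg_atBot_atTop).congr fun τ => by
    simp [latitude_neg]

/-- The decay is |τ|^(−k/2), so k = 3 is the first integrable power. -/
lemma integrable_latitude_pow {k : ℕ} (hk : 3 ≤ k) : Integrable fun τ => latitude τ ^ k := by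
  have hk' : (3 : ℝ) ≤ k := by exact_mod_cast hk
  have h := integrable_rpow_neg_one_add_norm_sq (E := ℝ) (μ := volume) (r := (k : ℝ) / 2)
    (by simp; linarith)
  refine h.congr (Filter.Eventually.of_forall fun τ => ?_)
  have h0 : (0 : ℝ) < 1 + τ ^ 2 := by positivity
  simp only [latitude, Real.norm_eq_abs, sq_abs]
  rw [← Real.rpow_natCast _ k, ← Real.rpow_mul h0.le]
  congr 1
  ring

lemma integrable_of_abs_le_latitude_pow {F : ℝ → ℝ} (hF : Continuous F) {C : ℝ} {k : ℕ}
    (hk : 3 ≤ k) (h : ∀ τ, |F τ| ≤ C * latitude τ ^ k) : Integrable F :=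
  ((integrable_latitude_pow hk).const_mul C).mono' hF.aestronglyMeasurable
    (Filter.Eventually.of_forall h)

lemma integrable_prod_of_abs_le_latitude_pow {F : Sph n × ℝ → ℝ} (hF : Continuous F) {C : ℝ}
    {k : ℕ} (hk : 3 ≤ k) (h : ∀ z, |F z| ≤ C * latitude z.2 ^ k) :
    Integrable F ((sphereMeasure n).prod volume) :=
  (((integrable_latitude_pow hk).const_mul C).comp_snd (sphereMeasure n)).mono'
    hF.aestronglyMeasurable (Filter.Eventually.of_forall h)

/-- The weight of the squared `τ`-derivative in the Dirichlet form of the gauge sphere. -/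
def latitudeEnergy (n : ℕ) (τ : ℝ) : ℝ := 4 * (1 + τ ^ 2) ^ 2 * latitude τ ^ (n + 4)

lemma continuous_latitudeEnergy : Continuous (latitudeEnergy n) := by
  have := continuous_latitude
  unfold latitudeEnergy
  fun_prop

lemma latitudeEnergy_nonneg (τ : ℝ) : 0 ≤ latitudeEnergy n τ := by
  have := latitude_pos τ
  unfold latitudeEnergy
  positivity

lemma latitudeEnergy_mul_pow_six (τ : ℝ) :
    latitudeEnergy n τ * latitude τ ^ 6 = 4 * latitude τ ^ (n + 2) := by
  unfold latitudeEnergy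
  linear_combination 4 * latitude τ ^ (n + 2) * latitude_pow_eight τ

/-- The energy weight equals 4q^(n−4) with q = `latitude`. The bound Kq³ is the size of
τ-derivatives of functions smooth near the gauge sphere, and the resulting q^(n+2) is integrable. -/
lemma latitudeEnergy_mul_le {x y K τ : ℝ} (hx : |x| ≤ K * latitude τ ^ 3)
    (hy : |y| ≤ K * latitude τ ^ 3) :
    |latitudeEnergy n τ * (x * y)| ≤ 4 * K ^ 2 * latitude τ ^ (n + 2) := by
  rw [abs_mul, abs_mul, abs_of_nonneg (latitudeEnergy_nonneg τ)]
  calc latitudeEnergy n τ * (|x| * |y|)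
      ≤ latitudeEnergy n τ * ((K * latitude τ ^ 3) * (K * latitude τ ^ 3)) := by
        have := latitudeEnergy_nonneg (n := n) τ
        have h3 : 0 ≤ K * latitude τ ^ 3 := (abs_nonneg _).trans hx
        gcongr
    _ = K ^ 2 * (latitudeEnergy n τ * latitude τ ^ 6) := by ring
    _ = 4 * K ^ 2 * latitude τ ^ (n + 2) := by rw [latitudeEnergy_mul_pow_six]; ring

lemma integral_latitude_pow_pos {k : ℕ} (hk : 3 ≤ k) : 0 < ∫ τ, latitude τ ^ k := by
  refine integral_pos_of_integrable_nonneg_nonzero (x := 0) ?_ (integrable_latitude_pow hk) ?_ ?_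
  · exact continuous_latitude.pow k
  · exact fun τ => (pow_pos (latitude_pos τ) k).le
  · exact (pow_pos (latitude_pos 0) k).ne'

lemma integrable_sq_mul_latitude_pow {v : ℝ → ℝ} {K : ℝ} (hv : Continuous v) (hK : ∀ τ, |v τ| ≤ K)
    {k : ℕ} (hk : 3 ≤ k) : Integrable fun τ => v τ ^ 2 * latitude τ ^ k := by
  have hlc := continuous_latitude
  refine integrable_of_abs_le_latitude_pow (C := K ^ 2) (by fun_prop) hk fun τ => ?_
  have := pow_pos (latitude_pos τ) k
  rw [abs_mul, abs_pow, abs_of_pos this]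
  have := hK τ
  gcongr

lemma integrable_latitudeEnergy_mul {v w : ℝ → ℝ} {K : ℝ} (hn : 1 ≤ n) (hv : Continuous v)
    (hw : Continuous w) (hK : ∀ τ, |v τ| ≤ K * latitude τ ^ 3)
    (hK' : ∀ τ, |w τ| ≤ K * latitude τ ^ 3) :
    Integrable fun τ => latitudeEnergy n τ * (v τ * w τ) := by
  have := continuous_latitudeEnergy (n := n)
  exact integrable_of_abs_le_latitude_pow (k := n + 2) (by fun_prop) (by omega)
    fun τ => latitudeEnergy_mul_le (hK τ) (hK' τ)

/-- The Poincaré inequality for functions of the latitude. -/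
lemma latitude_poincare (hn : 1 ≤ n) {v v' : ℝ → ℝ} {K : ℝ} (hv : ∀ τ, HasDerivAt v (v' τ) τ)
    (hv' : Continuous v') (hK : ∀ τ, |v τ| ≤ K) (hK' : ∀ τ, |v' τ| ≤ K * latitude τ ^ 3)
    (hmean : ∫ τ, v τ * latitude τ ^ (n + 4) = 0) :
    ((n : ℝ) + 1) * ∫ τ, v τ ^ 2 * latitude τ ^ (n + 4) ≤
      ∫ τ, latitudeEnergy n τ * v' τ ^ 2 := by
  have hlc := continuous_latitude
  have hvc : Continuous v := continuous_iff_continuousAt.2 fun x => (hv x).continuousAt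
  have hn2 : (0 : ℝ) < (n : ℝ) + 2 := by positivity
  have hK0 : 0 ≤ K := (abs_nonneg _).trans (hK 0)
  have hpi := integrable_latitude_pow (k := n + 4) (by omega)
  have hTp : Integrable fun x => (x * latitude x ^ 2) * latitude x ^ (n + 4) := by
    refine integrable_of_abs_le_latitude_pow (C := 1) (k := n + 4) (by fun_prop) (by omega)
      fun τ => ?_
    have := pow_pos (latitude_pos τ) (n + 4)
    have h2 := pow_pos (latitude_pos τ) 2
    rw [abs_mul, abs_of_pos this, abs_mul, abs_of_pos h2]
    exact mul_le_mul_of_nonneg_right (abs_mul_latitude_sq_le τ) this.le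
  have hprim : ∀ τ, HasDerivAt (fun τ => -(2 / ((n : ℝ) + 2)) * latitude τ ^ (n + 2))
      ((τ * latitude τ ^ 2) * latitude τ ^ (n + 4)) τ := fun τ => by
    refine ((hasDerivAt_latitude_pow (n + 2) τ).const_mul _).congr_deriv ?_
    push_cast
    field_simp
    ring
  have htop : Filter.Tendsto (fun τ => -(2 / ((n : ℝ) + 2)) * latitude τ ^ (n + 2)) Filter.atTop
      (nhds 0) := by
    simpa using (tendsto_latitude_pow_atTop (k := n + 2) (by omega)).const_mul (-(2 / ((n : ℝ) + 2)))
  have hbot : Filter.Tendsto (fun τ => -(2 / ((n : ℝ) + 2)) * latitude τ ^ (n + 2)) Filter.atBot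
      (nhds 0) := by
    simpa using (tendsto_latitude_pow_atBot (k := n + 2) (by omega)).const_mul (-(2 / ((n : ℝ) + 2)))
  have hev : Integrable fun τ => latitudeEnergy n τ * v' τ ^ 2 := by
    simpa only [sq] using integrable_latitudeEnergy_mul hn hv' hv' hK' hK'
  -- T = τq² is the restriction of 2t to the unit gauge sphere. As L_G t = 0 and Zt = 2t, it
  -- satisfies MT = −2(n+2)ψT there, whence the choice C = 1/(2(n+2)). The tail bound on Tp is then
  -- an equality.
  have hmain := integral_sq_sub_sq_integral_le (p := fun τ => latitude τ ^ (n + 4))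
    (T := fun τ => τ * latitude τ ^ 2) (T' := fun τ => latitude τ ^ 6) (e := latitudeEnergy n)
    (C := 1 / (2 * ((n : ℝ) + 2))) (by fun_prop) (fun τ => (pow_pos (latitude_pos τ) _).le) hpi
    (fun τ => by
      refine ((hasDerivAt_id τ).mul (hasDerivAt_latitude_pow 2 τ)).congr_deriv ?_
      simp only [id]
      push_cast
      linear_combination -latitude τ ^ 2 * latitude_pow_four τ)
    (by fun_prop) (fun τ => pow_pos (latitude_pos τ) 6) hTp
    (by rw [integral_of_hasDerivAt_of_tendsto hprim hTp hbot htop, sub_zero]) (by positivity)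
    latitudeEnergy_nonneg
    (fun s => by
      rw [integral_Ici_eq_integral_Ioi, integral_Ioi_of_hasDerivAt_of_tendsto
        (hprim s).continuousAt.continuousWithinAt (fun x _ => hprim x) hTp.integrableOn htop,
        latitudeEnergy_mul_pow_six]
      apply le_of_eq
      field_simp
      ring)
    hv hv' (integrable_sq_mul_latitude_pow hvc hK (by omega)) hev
  rw [hmean, zero_pow two_ne_zero, sub_zero, mul_assoc] at hmain
  have h1 := le_of_mul_le_mul_left hmain (integral_latitude_pow_pos (k := n + 4) (by omega))
  have h2 : 0 ≤ ∫ τ, latitudeEnergy n τ * v' τ ^ 2 :=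
    integral_nonneg fun τ => mul_nonneg (latitudeEnergy_nonneg τ) (sq_nonneg _)
  calc ((n : ℝ) + 1) * ∫ τ, v τ ^ 2 * latitude τ ^ (n + 4)
      ≤ ((n : ℝ) + 1) * (1 / (2 * ((n : ℝ) + 2)) * ∫ τ, latitudeEnergy n τ * v' τ ^ 2) := by
        gcongr
    _ = ((n + 1) / (2 * ((n : ℝ) + 2))) * ∫ τ, latitudeEnergy n τ * v' τ ^ 2 := by ring
    -- The constant obtained is 2(n+2); only the weaker n + 1 is kept.
    _ ≤ 1 * ∫ τ, latitudeEnergy n τ * v' τ ^ 2 := by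
        gcongr
        rw [div_le_one (by positivity)]
        linarith
    _ = _ := one_mul _

/-- The ground state inequality for functions of the latitude vanishing at the poles. -/
lemma latitude_hardy (hn : 2 ≤ n) {w w' : ℝ → ℝ} {K : ℝ} (hw : ∀ τ, HasDerivAt w (w' τ) τ)
    (hw' : Continuous w') (hK : ∀ τ, |w τ| ≤ K * latitude τ)
    (hK' : ∀ τ, |w' τ| ≤ K * latitude τ ^ 3) :
    ((n : ℝ) + 1) * ∫ τ, w τ ^ 2 * latitude τ ^ (n + 4) ≤
      (∫ τ, latitudeEnergy n τ * w' τ ^ 2) +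
        ((n : ℝ) - 1) * ∫ τ, w τ ^ 2 * latitude τ ^ n := by
  have hlc := continuous_latitude
  have hwc : Continuous w := continuous_iff_continuousAt.2 fun x => (hw x).continuousAt
  have hK0 : 0 ≤ K := by
    have := (abs_nonneg _).trans (hK' 0)
    exact nonneg_of_mul_nonneg_left this (pow_pos (latitude_pos 0) 3)
  have hwK : ∀ τ, |w τ| ≤ K := fun τ => (hK τ).trans (mul_le_of_le_one_right hK0 (latitude_le_one τ))
  have hsq : ∀ τ, w τ ^ 2 ≤ K ^ 2 * latitude τ ^ 2 := fun τ => by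
    rw [← sq_abs, ← mul_pow]
    gcongr
    exact hK τ
  have i1 : Integrable fun τ => w τ ^ 2 * latitude τ ^ (n + 4) :=
    integrable_sq_mul_latitude_pow hwc hwK (by omega)
  have i2 : Integrable fun τ => w τ ^ 2 * latitude τ ^ n := by
    refine integrable_of_abs_le_latitude_pow (C := K ^ 2) (k := n + 2) (by fun_prop) (by omega)
      fun τ => ?_
    have := pow_pos (latitude_pos τ) n
    rw [abs_of_nonneg (by positivity)]
    calc w τ ^ 2 * latitude τ ^ n ≤ (K ^ 2 * latitude τ ^ 2) * latitude τ ^ n := by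
          gcongr
          exact hsq τ
      _ = _ := by ring
  have i3 : Integrable fun τ => latitudeEnergy n τ * w' τ ^ 2 := by
    simpa only [sq] using integrable_latitudeEnergy_mul (by omega) hw' hw' hK' hK'
  have i4 : Integrable fun τ => latitudeEnergy n τ * (w' τ * (τ * latitude τ ^ 4 * w τ)) := by
    refine integrable_latitudeEnergy_mul (by omega) hw' (by fun_prop) hK' fun τ => ?_
    have h4 := latitude_pos τ
    rw [abs_mul, abs_mul, abs_of_pos (pow_pos h4 4)]
    calc |τ| * latitude τ ^ 4 * |w τ| ≤ |τ| * latitude τ ^ 4 * (K * latitude τ) := by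
          gcongr
          exact hK τ
      _ = (|τ| * latitude τ ^ 2) * (K * latitude τ ^ 3) := by ring
      _ ≤ 1 * (K * latitude τ ^ 3) := by
          gcongr
          exact abs_mul_latitude_sq_le τ
      _ = _ := one_mul _
  have e4 : ∀ τ, latitudeEnergy n τ * (w' τ * (τ * latitude τ ^ 4 * w τ)) =
      4 * τ * latitude τ ^ n * w τ * w' τ := fun τ => by
    unfold latitudeEnergy
    linear_combination 4 * τ * latitude τ ^ n * w τ * w' τ * latitude_pow_eight τ
  simp only [e4] at i4
  -- This boundary term vanishes at both ends because w decays like q. Its derivative is the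
  -- divergence that turns the difference of the two sides into a square.
  have hder : ∀ τ, HasDerivAt (fun τ => 2 * τ * latitude τ ^ n * w τ ^ 2)
      ((2 - n) * (w τ ^ 2 * latitude τ ^ n) + n * (w τ ^ 2 * latitude τ ^ (n + 4)) +
        4 * τ * latitude τ ^ n * w τ * w' τ) τ := fun τ => by
    refine (((((hasDerivAt_id τ).const_mul 2).mul (hasDerivAt_latitude_pow n τ))).mul
      ((hw τ).pow 2)).congr_deriv ?_
    simp only [id, Pi.mul_apply, Pi.pow_apply]
    push_cast
    linear_combination (-(n : ℝ)) * latitude τ ^ n * w τ ^ 2 * latitude_pow_four τ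
  have iD := ((i2.const_mul (2 - (n : ℝ))).fun_add (i1.const_mul (n : ℝ))).fun_add i4
  have hlim : ∀ {l : Filter ℝ}, Filter.Tendsto (fun τ => latitude τ ^ n) l (nhds 0) →
      Filter.Tendsto (fun τ => 2 * τ * latitude τ ^ n * w τ ^ 2) l (nhds 0) := fun {l} hl => by
    refine squeeze_zero_norm (a := fun τ => 2 * K ^ 2 * latitude τ ^ n) (fun τ => ?_)
      (by simpa using hl.const_mul (2 * K ^ 2))
    have h4 := latitude_pos τ
    rw [Real.norm_eq_abs, abs_mul, abs_mul, abs_mul, abs_of_pos (pow_pos h4 n),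
      abs_of_nonneg (sq_nonneg (w τ)), abs_two]
    calc 2 * |τ| * latitude τ ^ n * w τ ^ 2
        ≤ 2 * |τ| * latitude τ ^ n * (K ^ 2 * latitude τ ^ 2) := by
          gcongr
          exact hsq τ
      _ = (|τ| * latitude τ ^ 2) * (2 * K ^ 2 * latitude τ ^ n) := by ring
      _ ≤ 1 * (2 * K ^ 2 * latitude τ ^ n) := by
          gcongr
          exact abs_mul_latitude_sq_le τ
      _ = _ := one_mul _
  have h0 := integral_of_hasDerivAt_of_tendsto hder iD
    (hlim (tendsto_latitude_pow_atBot (by omega))) (hlim (tendsto_latitude_pow_atTop (by omega)))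
  rw [sub_zero] at h0
  -- The expression is q^(n+4)(2(1+τ²)w' + τw)², which vanishes exactly for multiples of the ground
  -- state q, the latitude profile of the functions xᵢ.
  have hpt : ∀ τ, 0 ≤ latitudeEnergy n τ * w' τ ^ 2 + ((n : ℝ) - 1) * (w τ ^ 2 * latitude τ ^ n) -
      ((n : ℝ) + 1) * (w τ ^ 2 * latitude τ ^ (n + 4)) +
      ((2 - n) * (w τ ^ 2 * latitude τ ^ n) + n * (w τ ^ 2 * latitude τ ^ (n + 4)) +
        4 * τ * latitude τ ^ n * w τ * w' τ) := fun τ => by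
    have h5 : 0 ≤ latitude τ ^ (n + 4) * (2 * (1 + τ ^ 2) * w' τ + τ * w τ) ^ 2 :=
      mul_nonneg (pow_pos (latitude_pos τ) _).le (sq_nonneg _)
    refine h5.trans (le_of_eq ?_)
    unfold latitudeEnergy
    linear_combination (latitude τ ^ n * w τ ^ 2 + 4 * τ * latitude τ ^ n * w τ * w' τ) *
      latitude_pow_four τ
  have h6 : 0 ≤ ∫ τ, (latitudeEnergy n τ * w' τ ^ 2 +
      ((n : ℝ) - 1) * (w τ ^ 2 * latitude τ ^ n) -
      ((n : ℝ) + 1) * (w τ ^ 2 * latitude τ ^ (n + 4)) +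
      ((2 - n) * (w τ ^ 2 * latitude τ ^ n) + n * (w τ ^ 2 * latitude τ ^ (n + 4)) +
        4 * τ * latitude τ ^ n * w τ * w' τ)) := integral_nonneg hpt
  rw [integral_add ((i3.fun_add (i2.const_mul _)).fun_sub (i1.const_mul _)) iD, h0,
    integral_sub (i3.fun_add (i2.const_mul _)) (i1.const_mul _),
    integral_add i3 (i2.const_mul _), integral_const_mul, integral_const_mul] at h6
  linarith

end Latitude

/-! ### Functions on the cylinder Sⁿ⁻¹ × ℝ: splitting into spherical mean and fluctuation. -/

section Cylinder

variable {n : ℕ}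

lemma sphereMeasure_real_univ_pos (hn : 1 ≤ n) : 0 < (sphereMeasure n).real univ := by
  have : Nonempty (Fin n) := ⟨⟨0, hn⟩⟩
  rw [Measure.toSphere_real_apply_univ]
  have h1 : 0 < (volume : Measure (EuclideanSpace ℝ (Fin n))).real (Metric.ball 0 1) :=
    ENNReal.toReal_pos (Metric.measure_ball_pos _ _ one_pos).ne' measure_ball_lt_top.ne
  have h2 : (0 : ℝ) < Module.finrank ℝ (EuclideanSpace ℝ (Fin n)) := by
    simp only [finrank_euclideanSpace_fin]
    exact_mod_cast hn
  positivity

/-- The mean of a function on the cylinder `Sⁿ⁻¹ × ℝ` over the sphere. -/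
def sphereMean (v : Sph n × ℝ → ℝ) (τ : ℝ) : ℝ :=
  ((sphereMeasure n).real univ)⁻¹ * ∫ ξ, v (ξ, τ) ∂(sphereMeasure n)

lemma integrable_section {v : Sph n × ℝ → ℝ} (hv : Continuous v) (τ : ℝ) :
    Integrable (fun ξ => v (ξ, τ)) (sphereMeasure n) :=
  (hv.comp (by fun_prop : Continuous fun ξ : Sph n => (ξ, τ))).integrable_of_hasCompactSupport
    (HasCompactSupport.of_compactSpace _)

lemma integral_section_eq (hn : 1 ≤ n) (v : Sph n × ℝ → ℝ) (τ : ℝ) :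
    ∫ ξ, v (ξ, τ) ∂(sphereMeasure n) = (sphereMeasure n).real univ * sphereMean v τ := by
  have := sphereMeasure_real_univ_pos hn
  unfold sphereMean
  field_simp

lemma integral_sub_sphereMean (hn : 1 ≤ n) {v : Sph n × ℝ → ℝ} (hv : Continuous v) (τ : ℝ) :
    ∫ ξ, (v (ξ, τ) - sphereMean v τ) ∂(sphereMeasure n) = 0 := by
  rw [integral_sub (integrable_section hv τ) (integrable_const _), integral_section_eq hn,
    integral_const, smul_eq_mul, sub_self]

lemma abs_sphereMean_le (hn : 1 ≤ n) {v : Sph n × ℝ → ℝ} {τ B : ℝ} (h : ∀ ξ, |v (ξ, τ)| ≤ B) :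
    |sphereMean v τ| ≤ B := by
  have hS := sphereMeasure_real_univ_pos hn
  have h1 := norm_integral_le_of_norm_le_const (μ := sphereMeasure n) (f := fun ξ => v (ξ, τ))
    (C := B) (Filter.Eventually.of_forall h)
  rw [integral_section_eq hn, Real.norm_eq_abs, abs_mul, abs_of_pos hS, mul_comm B] at h1
  exact le_of_mul_le_mul_left h1 hS

lemma abs_sub_sphereMean_le (hn : 1 ≤ n) {v : Sph n × ℝ → ℝ} (hv : Continuous v) {τ B : ℝ}
    {ξ : Sph n} (h : ∀ η, |v (ξ, τ) - v (η, τ)| ≤ B) : |v (ξ, τ) - sphereMean v τ| ≤ B := by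
  have h1 : sphereMean (fun z => v (ξ, z.2) - v z) τ = v (ξ, τ) - sphereMean v τ := by
    have hS := sphereMeasure_real_univ_pos hn
    unfold sphereMean
    simp only
    rw [integral_sub (integrable_const _) (integrable_section hv τ), integral_const, smul_eq_mul]
    field_simp
  rw [← h1]
  exact abs_sphereMean_le hn h

lemma continuous_sphereMean {v : Sph n × ℝ → ℝ} (hv : Continuous v) :
    Continuous (sphereMean v) := by
  have h := continuous_parametric_integral_of_continuous (μ := sphereMeasure n)
    (f := fun (τ : ℝ) (ξ : Sph n) => v (ξ, τ)) (by fun_prop) isCompact_univ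
  simp only [Measure.restrict_univ] at h
  exact h.const_mul _

lemma hasDerivAt_sphereMean {v v' : Sph n × ℝ → ℝ} (hv : Continuous v) (hv' : Continuous v')
    {K : ℝ} (hK : ∀ z, |v' z| ≤ K)
    (h : ∀ ξ τ, HasDerivAt (fun τ => v (ξ, τ)) (v' (ξ, τ)) τ) (τ : ℝ) :
    HasDerivAt (sphereMean v) (sphereMean v' τ) τ := by
  refine HasDerivAt.const_mul _ ?_
  exact (hasDerivAt_integral_of_dominated_loc_of_deriv_le (bound := fun _ => K)
    (F := fun τ ξ => v (ξ, τ)) (F' := fun τ ξ => v' (ξ, τ)) Filter.univ_mem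
    (Filter.Eventually.of_forall fun τ => (integrable_section hv τ).aestronglyMeasurable)
    (integrable_section hv τ) (integrable_section hv' τ).aestronglyMeasurable
    (Filter.Eventually.of_forall fun ξ τ _ => hK _) (integrable_const _)
    (Filter.Eventually.of_forall fun ξ τ _ => h ξ τ)).2

/-- Orthogonality of functions of τ alone to functions with zero mean on every sphere; it makes all
quadratic integrals additive in the splitting. -/
lemma integral_prod_mul_eq_zero {w : Sph n × ℝ → ℝ} {α : ℝ → ℝ}
    (hi : Integrable (fun z => α z.2 * w z) ((sphereMeasure n).prod volume))
    (hw : ∀ τ, ∫ ξ, w (ξ, τ) ∂(sphereMeasure n) = 0) :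
    ∫ z, α z.2 * w z ∂((sphereMeasure n).prod volume) = 0 := by
  rw [integral_prod_symm _ hi]
  simp only [integral_const_mul, hw, mul_zero, integral_zero]

/-- Write v = m(τ) + w with m the spherical mean. The mean m has weighted mean zero in τ, so
`latitude_poincare` applies to it. The fluctuation w inherits decay of order q from the oscillation
bound, so `latitude_hardy` applies on every line of fixed ξ. Its price, the term with factor n − 1,
is what the Poincaré inequality of the sphere pays for. -/
theorem cylinder_poincare (hn : 2 ≤ n) {v v' : Sph n × ℝ → ℝ} {K : ℝ} (hv : Continuous v)
    (hv' : Continuous v') (hder : ∀ ξ τ, HasDerivAt (fun τ => v (ξ, τ)) (v' (ξ, τ)) τ)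
    (hK : ∀ z, |v z| ≤ K) (hosc : ∀ ξ η τ, |v (ξ, τ) - v (η, τ)| ≤ K * latitude τ)
    (hK' : ∀ z, |v' z| ≤ K * latitude z.2 ^ 3)
    (hmean : ∫ z, latitude z.2 ^ (n + 4) * v z ∂((sphereMeasure n).prod volume) = 0) :
    ((n : ℝ) + 1) * ∫ z, v z ^ 2 * latitude z.2 ^ (n + 4) ∂((sphereMeasure n).prod volume) ≤
      ∫ z, latitudeEnergy n z.2 * v' z ^ 2 ∂((sphereMeasure n).prod volume) +
        ((n : ℝ) - 1) * ∫ z, (v z - sphereMean v z.2) ^ 2 * latitude z.2 ^ n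
          ∂((sphereMeasure n).prod volume) := by
  have hn1 : 1 ≤ n := by omega
  have hlc := continuous_latitude
  have hEc := continuous_latitudeEnergy (n := n)
  have hK0 : 0 ≤ K := by
    have hne : Nonempty (Sph n) := by
      have : Nonempty (Fin n) := ⟨⟨0, hn1⟩⟩
      exact (NormedSpace.sphere_nonempty.2 zero_le_one).to_subtype
    exact (abs_nonneg _).trans (hK (Classical.arbitrary _, 0))
  have hqle := latitude_le_one
  have hq0 := latitude_pos
  have hK'1 : ∀ z, |v' z| ≤ K := fun z => (hK' z).trans
    (mul_le_of_le_one_right hK0 (pow_le_one₀ (hq0 _).le (hqle _)))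
  set m := sphereMean v with hm
  set m' := sphereMean v' with hm'
  have hmc : Continuous m := continuous_sphereMean hv
  have hmc' : Continuous m' := continuous_sphereMean hv'
  have hmd : ∀ τ, HasDerivAt m (m' τ) τ := hasDerivAt_sphereMean hv hv' hK'1 hder
  have hmK : ∀ τ, |m τ| ≤ K := fun τ => abs_sphereMean_le hn1 fun ξ => hK _
  have hmK' : ∀ τ, |m' τ| ≤ K * latitude τ ^ 3 := fun τ => abs_sphereMean_le hn1 fun ξ => hK' (ξ, τ)
  set μ := (sphereMeasure n).prod (volume : Measure ℝ) with hμ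
  set w : Sph n × ℝ → ℝ := fun z => v z - m z.2 with hw
  set w' : Sph n × ℝ → ℝ := fun z => v' z - m' z.2 with hw'
  have hwc : Continuous w := by fun_prop
  have hwc' : Continuous w' := by fun_prop
  have hwK : ∀ z, |w z| ≤ 2 * K * latitude z.2 := fun z => by
    have := abs_sub_sphereMean_le hn1 hv (ξ := z.1) (τ := z.2) (fun η => hosc z.1 η z.2)
    refine this.trans ?_
    nlinarith [mul_nonneg hK0 (hq0 z.2).le]
  have hwK1 : ∀ z, |w z| ≤ 2 * K := fun z =>
    (hwK z).trans (mul_le_of_le_one_right (by positivity) (hqle _))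
  have hwK' : ∀ z, |w' z| ≤ 2 * K * latitude z.2 ^ 3 := fun z => by
    have := abs_sub (v' z) (m' z.2)
    have h1 := hK' z
    have h2 := hmK' z.2
    simp only [hw']
    linarith
  have hmK2 : ∀ τ, |m' τ| ≤ 2 * K * latitude τ ^ 3 := fun τ => by
    have := hmK' τ
    nlinarith [mul_nonneg hK0 (pow_pos (hq0 τ) 3).le]
  have hwz : ∀ τ, ∫ ξ, w (ξ, τ) ∂(sphereMeasure n) = 0 := integral_sub_sphereMean hn1 hv
  have hwz' : ∀ τ, ∫ ξ, w' (ξ, τ) ∂(sphereMeasure n) = 0 := integral_sub_sphereMean hn1 hv'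
  have iq : ∀ {F : Sph n × ℝ → ℝ} {C : ℝ}, Continuous F → (∀ z, |F z| ≤ C) →
      Integrable (fun z => F z * latitude z.2 ^ (n + 4)) μ := fun {F C} hF hC => by
    refine integrable_prod_of_abs_le_latitude_pow (C := C) (k := n + 4) (by fun_prop) (by omega)
      fun z => ?_
    have := pow_pos (hq0 z.2) (n + 4)
    rw [abs_mul, abs_of_pos this]
    exact mul_le_mul_of_nonneg_right (hC z) this.le
  have iE : ∀ {F G : Sph n × ℝ → ℝ}, Continuous F → Continuous G →
      (∀ z, |F z| ≤ 2 * K * latitude z.2 ^ 3) → (∀ z, |G z| ≤ 2 * K * latitude z.2 ^ 3) →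
      Integrable (fun z => latitudeEnergy n z.2 * (F z * G z)) μ := fun {F G} hF hG h1 h2 =>
    integrable_prod_of_abs_le_latitude_pow (k := n + 2) (by fun_prop) (by omega)
      fun z => latitudeEnergy_mul_le (h1 z) (h2 z)
  have hprod : ∀ {x y A B : ℝ}, |x| ≤ A → |y| ≤ B → |x * y| ≤ A * B := fun {x y A B} h1 h2 => by
    rw [abs_mul]
    exact mul_le_mul h1 h2 (abs_nonneg _) ((abs_nonneg _).trans h1)
  have i1 : Integrable (fun z => w z ^ 2 * latitude z.2 ^ (n + 4)) μ := by
    simpa only [sq] using iq (F := fun z => w z * w z) (by fun_prop) fun z => hprod (hwK1 z) (hwK1 z)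
  have i2 : Integrable (fun z => latitudeEnergy n z.2 * w' z ^ 2) μ := by
    simpa only [sq] using iE hwc' hwc' hwK' hwK'
  have i3 : Integrable (fun z => w z ^ 2 * latitude z.2 ^ n) μ := by
    refine integrable_prod_of_abs_le_latitude_pow (C := (2 * K) ^ 2) (k := n + 2) (by fun_prop)
      (by omega) fun z => ?_
    have := pow_pos (hq0 z.2) n
    rw [abs_mul, abs_of_pos this, abs_pow]
    calc |w z| ^ 2 * latitude z.2 ^ n ≤ (2 * K * latitude z.2) ^ 2 * latitude z.2 ^ n := by
          gcongr
          exact hwK z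
      _ = _ := by ring
  have i4 : Integrable (fun z : Sph n × ℝ => m z.2 ^ 2 * latitude z.2 ^ (n + 4)) μ := by
    simpa only [sq] using iq (F := fun z => m z.2 * m z.2) (by fun_prop)
      fun z => hprod (hmK z.2) (hmK z.2)
  have i5 : Integrable (fun z : Sph n × ℝ => latitudeEnergy n z.2 * m' z.2 ^ 2) μ := by
    simpa only [sq] using iE (F := fun z => m' z.2) (G := fun z => m' z.2) (by fun_prop)
      (by fun_prop) (fun z => hmK2 z.2) (fun z => hmK2 z.2)
  have i6 : Integrable (fun z : Sph n × ℝ => (m z.2 * latitude z.2 ^ (n + 4)) * w z) μ :=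
    (iq (F := fun z => m z.2 * w z) (by fun_prop) fun z => hprod (hmK z.2) (hwK1 z)).congr
      (Filter.Eventually.of_forall fun z => by ring)
  have i7 : Integrable (fun z : Sph n × ℝ => (latitudeEnergy n z.2 * m' z.2) * w' z) μ :=
    (iE (F := fun z => m' z.2) (by fun_prop) hwc' (fun z => hmK2 z.2) hwK').congr
      (Filter.Eventually.of_forall fun z => by ring)
  have h1 : ((n : ℝ) + 1) * ∫ z, w z ^ 2 * latitude z.2 ^ (n + 4) ∂μ ≤
      ∫ z, latitudeEnergy n z.2 * w' z ^ 2 ∂μ +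
        ((n : ℝ) - 1) * ∫ z, w z ^ 2 * latitude z.2 ^ n ∂μ := by
    rw [integral_prod _ i1, integral_prod _ i2, integral_prod _ i3, ← integral_const_mul,
      ← integral_const_mul, ← integral_add i2.integral_prod_left
        (i3.integral_prod_left.const_mul _)]
    refine integral_mono (i1.integral_prod_left.const_mul _)
      (i2.integral_prod_left.add (i3.integral_prod_left.const_mul _)) fun ξ => ?_
    exact latitude_hardy hn (w := fun τ => w (ξ, τ)) (w' := fun τ => w' (ξ, τ))
      (fun τ => (hder ξ τ).fun_sub (hmd τ)) (by fun_prop) (fun τ => hwK (ξ, τ))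
      (fun τ => hwK' (ξ, τ))
  have hmz : ∫ τ, m τ * latitude τ ^ (n + 4) = 0 := by
    have i8 : Integrable (fun z => latitude z.2 ^ (n + 4) * v z) μ :=
      (iq hv hK).congr (Filter.Eventually.of_forall fun z => mul_comm _ _)
    rw [integral_prod_symm _ i8] at hmean
    simp only [integral_const_mul, integral_section_eq hn1] at hmean
    have h3 : ∀ τ, latitude τ ^ (n + 4) * ((sphereMeasure n).real univ * sphereMean v τ) =
        (sphereMeasure n).real univ * (m τ * latitude τ ^ (n + 4)) := fun τ => by
      rw [hm]; ring
    simp only [h3, integral_const_mul] at hmean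
    exact (mul_eq_zero.1 hmean).resolve_left (sphereMeasure_real_univ_pos hn1).ne'
  have h2 : ((n : ℝ) + 1) * ∫ z : Sph n × ℝ, m z.2 ^ 2 * latitude z.2 ^ (n + 4) ∂μ ≤
      ∫ z : Sph n × ℝ, latitudeEnergy n z.2 * m' z.2 ^ 2 ∂μ := by
    rw [integral_prod _ i4, integral_prod _ i5, ← integral_const_mul]
    refine integral_mono (i4.integral_prod_left.const_mul _) i5.integral_prod_left fun ξ => ?_
    exact latitude_poincare hn1 hmd hmc' hmK hmK' hmz
  have h3 : ∫ z, v z ^ 2 * latitude z.2 ^ (n + 4) ∂μ =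
      ∫ z, w z ^ 2 * latitude z.2 ^ (n + 4) ∂μ +
        ∫ z : Sph n × ℝ, m z.2 ^ 2 * latitude z.2 ^ (n + 4) ∂μ := by
    rw [← integral_add i1 i4, ← sub_eq_zero, ← integral_sub (by
      simpa only [sq] using iq (F := fun z => v z * v z) (by fun_prop) fun z => hprod (hK z) (hK z)) (i1.fun_add i4),
      ← mul_zero 2, ← integral_prod_mul_eq_zero
        (α := fun τ => m τ * latitude τ ^ (n + 4)) i6 hwz, ← integral_const_mul]
    refine integral_congr_ae (Filter.Eventually.of_forall fun z => ?_)
    simp only [hw]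
    ring
  have h4 : ∫ z, latitudeEnergy n z.2 * v' z ^ 2 ∂μ =
      ∫ z, latitudeEnergy n z.2 * w' z ^ 2 ∂μ +
        ∫ z : Sph n × ℝ, latitudeEnergy n z.2 * m' z.2 ^ 2 ∂μ := by
    have i9 : Integrable (fun z => latitudeEnergy n z.2 * v' z ^ 2) μ := by
      have hv2 : ∀ z, |v' z| ≤ 2 * K * latitude z.2 ^ 3 := fun z => by
        have := hK' z
        nlinarith [mul_nonneg hK0 (pow_pos (hq0 z.2) 3).le]
      simpa only [sq] using iE hv' hv' hv2 hv2
    rw [← integral_add i2 i5, ← sub_eq_zero, ← integral_sub i9 (i2.fun_add i5),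
      ← mul_zero 2, ← integral_prod_mul_eq_zero
        (α := fun τ => latitudeEnergy n τ * m' τ) i7 hwz', ← integral_const_mul]
    refine integral_congr_ae (Filter.Eventually.of_forall fun z => ?_)
    simp only [hw']
    ring
  rw [h3, h4]
  linarith

end Cylinder

/-! ### The Poincaré inequality on the unit gauge sphere. -/

section GaugeSphere

variable {n : ℕ}

lemma angleMeasure_eq_withDensity : angleMeasure n =
    ((sphereMeasure n).prod volume).withDensity
      fun z => ENNReal.ofReal (latitude z.2 ^ (n + 2) / 2) := by
  have := continuous_latitude
  exact prod_withDensity_right (by fun_prop)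

lemma integral_angleMeasure (F : Sph n × ℝ → ℝ) :
    ∫ z, F z ∂(angleMeasure n) =
      ∫ z, F z * (latitude z.2 ^ (n + 2) / 2) ∂((sphereMeasure n).prod volume) := by
  have h0 := continuous_latitude.measurable
  have h1 : Measurable fun z : Sph n × ℝ => Real.toNNReal (latitude z.2 ^ (n + 2) / 2) := by
    fun_prop
  rw [angleMeasure_eq_withDensity]
  unfold ENNReal.ofReal
  rw [integral_withDensity_eq_integral_smul h1]
  refine integral_congr_ae (Filter.Eventually.of_forall fun z => ?_)
  have := latitude_pos z.2
  simp only [NNReal.smul_def, Real.coe_toNNReal _ (by positivity : 0 ≤ latitude z.2 ^ (n + 2) / 2),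
    smul_eq_mul, mul_comm]

lemma integrable_angleMeasure_iff (F : Sph n × ℝ → ℝ) :
    Integrable F (angleMeasure n) ↔
      Integrable (fun z => F z * (latitude z.2 ^ (n + 2) / 2)) ((sphereMeasure n).prod volume) := by
  have h0 := continuous_latitude.measurable
  have h1 : Measurable fun z : Sph n × ℝ => Real.toNNReal (latitude z.2 ^ (n + 2) / 2) := by
    fun_prop
  rw [angleMeasure_eq_withDensity]
  unfold ENNReal.ofReal
  rw [integrable_withDensity_iff_integrable_smul h1]
  refine integrable_congr (Filter.Eventually.of_forall fun z => ?_)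
  have := latitude_pos z.2
  simp only [NNReal.smul_def, Real.coe_toNNReal _ (by positivity : 0 ≤ latitude z.2 ^ (n + 2) / 2),
    smul_eq_mul, mul_comm]

lemma isFiniteMeasure_angleMeasure (hn : 1 ≤ n) : IsFiniteMeasure (angleMeasure n) := by
  have h : Integrable (fun _ => (1 : ℝ)) (angleMeasure n) := by
    rw [integrable_angleMeasure_iff]
    have := continuous_latitude
    refine integrable_prod_of_abs_le_latitude_pow (C := 1 / 2) (k := n + 2) (by fun_prop)
      (by omega) fun z => ?_
    have := pow_pos (latitude_pos z.2) (n + 2)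
    rw [abs_of_nonneg (by positivity)]
    linarith
  exact (integrable_const_iff_isFiniteMeasure one_ne_zero).1 h

lemma integrable_angleMeasure_of_bounded (hn : 1 ≤ n) {F : Sph n × ℝ → ℝ} (hF : Continuous F)
    {C : ℝ} (hC : ∀ z, |F z| ≤ C) : Integrable F (angleMeasure n) := by
  have := isFiniteMeasure_angleMeasure hn
  exact (integrable_const C).mono' hF.aestronglyMeasurable (Filter.Eventually.of_forall hC)

lemma spherePt_mem_closedBall (θ : Sph n × ℝ) : spherePt θ ∈ Metric.closedBall (0 : Space n) 1 := by
  have h1 := norm_fst_le_gaugeNorm (spherePt θ)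
  have h2 := abs_snd_le_gaugeNorm_sq (spherePt θ)
  rw [gaugeNorm_spherePt] at h1 h2
  rw [mem_closedBall_zero_iff, Prod.norm_def]
  refine max_le h1 ?_
  rw [Real.norm_eq_abs]
  linarith

/-- The derivative of `spherePt (ξ, τ)` in `τ`. -/
def spherePtDeriv (θ : Sph n × ℝ) : Space n :=
  (-(θ.2 * latitude θ.2 ^ 5 / 2) • (θ.1 : EuclideanSpace ℝ (Fin n)), latitude θ.2 ^ 6 / 2)

lemma continuous_spherePtDeriv : Continuous (spherePtDeriv (n := n)) := by
  have := continuous_latitude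
  unfold spherePtDeriv
  fun_prop

lemma hasDerivAt_spherePt (ξ : Sph n) (τ : ℝ) :
    HasDerivAt (fun τ => spherePt (ξ, τ)) (spherePtDeriv (ξ, τ)) τ := by
  unfold spherePt spherePtDeriv
  refine ((hasDerivAt_latitude τ).smul_const (ξ : EuclideanSpace ℝ (Fin n))).prodMk ?_
  refine (((hasDerivAt_id τ).mul (hasDerivAt_latitude_pow 2 τ)).div_const 2).congr_deriv ?_
  simp only [id]
  push_cast
  linear_combination -latitude τ ^ 2 / 2 * latitude_pow_four τ

lemma norm_spherePtDeriv_le (θ : Sph n × ℝ) : ‖spherePtDeriv θ‖ ≤ latitude θ.2 ^ 3 := by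
  have h0 := latitude_pos θ.2
  have h1 : ‖(θ.1 : EuclideanSpace ℝ (Fin n))‖ = 1 := by simp
  have h3 := pow_pos h0 3
  rw [Prod.norm_def]
  refine max_le ?_ ?_
  · simp only [spherePtDeriv, norm_smul, h1, mul_one, Real.norm_eq_abs, abs_neg, abs_div, abs_mul,
      abs_of_pos (pow_pos h0 5), abs_two]
    nlinarith [mul_le_mul_of_nonneg_right (abs_mul_latitude_sq_le θ.2) h3.le]
  · simp only [spherePtDeriv, Real.norm_eq_abs, abs_div, abs_of_pos (pow_pos h0 6), abs_two]
    nlinarith [mul_le_mul_of_nonneg_right (pow_le_one₀ h0.le (latitude_le_one θ.2) (n := 3)) h3.le]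

/-- In the coordinates `(ξ, τ)` the form `Γ(U, U)` on the gauge sphere splits into a spherical and
a latitudinal part. -/
lemma latitude_pow_mul_angularForm_spherePt (U : Space n → ℝ) (θ : Sph n × ℝ) :
    latitude θ.2 ^ (n + 2) * angularForm U U (spherePt θ) =
      latitudeEnergy n θ.2 * fderiv ℝ U (spherePt θ) (spherePtDeriv θ) ^ 2 +
      latitude θ.2 ^ (n + 2) * (∑ i, partialX i U (spherePt θ) ^ 2 -
        fderiv ℝ U (spherePt θ) (((θ.1 : EuclideanSpace ℝ (Fin n)), 0) : Space n) ^ 2) := by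
  have h1 := gradSq_eq_angularForm U (spherePt_ne_zero θ)
  rw [gaugeNorm_spherePt, angularWeight_spherePt] at h1
  set q := latitude θ.2 with hq
  have hq0 : 0 < q := latitude_pos _
  set a := fderiv ℝ U (spherePt θ) (((θ.1 : EuclideanSpace ℝ (Fin n)), 0) : Space n) with ha
  set b := fderiv ℝ U (spherePt θ) ((0, 1) : Space n) with hb
  have hsplit : ∀ x y : ℝ, fderiv ℝ U (spherePt θ)
      ((x • (θ.1 : EuclideanSpace ℝ (Fin n)), y) : Space n) = x * a + y * b := fun x y => by
    have : ((x • (θ.1 : EuclideanSpace ℝ (Fin n)), y) : Space n) =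
        x • ((θ.1 : EuclideanSpace ℝ (Fin n)), (0 : ℝ)) + y • ((0 : EuclideanSpace ℝ (Fin n)), (1 : ℝ)) := by
      ext <;> simp
    rw [this, map_add, map_smul, map_smul, smul_eq_mul, smul_eq_mul]
  have h2 : euler U (spherePt θ) = q * a + θ.2 * q ^ 2 * b := by
    rw [← hsplit]
    refine congrArg (fderiv ℝ U (spherePt θ)) (Prod.ext rfl ?_)
    simp only [spherePt]
    ring
  have h3 : fderiv ℝ U (spherePt θ) (spherePtDeriv θ) = -(θ.2 * q ^ 5 / 2) * a + q ^ 6 / 2 * b := by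
    rw [← hsplit]
    rfl
  have h4 : gradSq U (spherePt θ) = ∑ i, partialX i U (spherePt θ) ^ 2 + (q * b) ^ 2 := by
    have h1 : ‖(θ.1 : EuclideanSpace ℝ (Fin n))‖ = 1 := by simp
    have h5 : ‖(spherePt θ).1‖ = q := by
      simp [spherePt, norm_smul, h1, abs_of_pos (latitude_pos _), hq]
    rw [gradSq, h5]
    rfl
  rw [h4, h2] at h1
  rw [h3, latitudeEnergy, ← hq]
  have h6 : q ^ 4 * (1 + θ.2 ^ 2) = 1 := latitude_pow_four θ.2
  have h7 : (1 + θ.2 ^ 2) ^ 2 * q ^ 8 = 1 := latitude_pow_eight θ.2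
  have h8 : angularForm U U (spherePt θ) = ∑ i, partialX i U (spherePt θ) ^ 2 + (q * b) ^ 2 -
      q ^ 2 * (q * a + θ.2 * q ^ 2 * b) ^ 2 := by
    simp only [div_one, one_pow] at h1
    linarith
  rw [h8]
  linear_combination -(q ^ (n + 2) * (a ^ 2 + q ^ 2 * b ^ 2)) * h6 -
    q ^ (n + 6) * (q * b - θ.2 * a) ^ 2 * h7

/-- The Poincaré inequality on the unit gauge sphere. -/
theorem gaugeSphere_poincare (hn : 2 ≤ n) {U : Space n → ℝ} (hU : ContDiff ℝ 1 U) {c : ℝ}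
    (hc : ∫ θ, angularWeight (spherePt θ) * (U (spherePt θ) - c) ∂(angleMeasure n) = 0) :
    ((n : ℝ) + 1) * ∫ θ, angularWeight (spherePt θ) * (U (spherePt θ) - c) ^ 2 ∂(angleMeasure n) ≤
      ∫ θ, angularForm U U (spherePt θ) ∂(angleMeasure n) := by
  have hn1 : 1 ≤ n := by omega
  have hUc : Continuous U := hU.continuous
  have hfd : Continuous (fderiv ℝ U) := hU.continuous_fderiv one_ne_zero
  have hlc := continuous_latitude
  have hEc := continuous_latitudeEnergy (n := n)
  have hsc := continuous_spherePt (n := n)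
  have hsdc := continuous_spherePtDeriv (n := n)
  have hq0 := latitude_pos
  obtain ⟨K₁, hK₁⟩ := (isCompact_closedBall (0 : Space n) 1).exists_bound_of_continuousOn
    (f := fun p => U p - c) (by fun_prop)
  obtain ⟨K₂, hK₂⟩ := (isCompact_closedBall (0 : Space n) 1).exists_bound_of_continuousOn
    (f := fderiv ℝ U) (by fun_prop)
  have hK₁0 : 0 ≤ K₁ := (norm_nonneg _).trans (hK₁ 0 (by simp))
  have hK₂0 : 0 ≤ K₂ := (norm_nonneg _).trans (hK₂ 0 (by simp))
  set K := K₁ + 2 * K₂ with hKdef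
  set v : Sph n × ℝ → ℝ := fun z => U (spherePt z) - c with hv
  set v' : Sph n × ℝ → ℝ := fun z => fderiv ℝ U (spherePt z) (spherePtDeriv z) with hv'
  have hvc : Continuous v := by fun_prop
  have hvc' : Continuous v' := by fun_prop
  have hder : ∀ ξ τ, HasDerivAt (fun τ => v (ξ, τ)) (v' (ξ, τ)) τ := fun ξ τ =>
    (((hU.differentiable one_ne_zero) (spherePt (ξ, τ))).hasFDerivAt.comp_hasDerivAt τ
      (hasDerivAt_spherePt ξ τ)).sub_const c
  have hK : ∀ z, |v z| ≤ K := fun z =>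
    (hK₁ _ (spherePt_mem_closedBall z)).trans (by linarith)
  -- At fixed τ the section of the gauge sphere is a Euclidean sphere of radius q(τ), so its points
  -- are at most 2q apart.
  have hosc : ∀ ξ η τ, |v (ξ, τ) - v (η, τ)| ≤ K * latitude τ := fun ξ η τ => by
    have h1 := (convex_closedBall (0 : Space n) 1).norm_image_sub_le_of_norm_fderiv_le (𝕜 := ℝ)
      (f := U) (fun p _ => hU.differentiable one_ne_zero p) hK₂ (spherePt_mem_closedBall (η, τ))
      (spherePt_mem_closedBall (ξ, τ))
    have h2 : ‖spherePt (ξ, τ) - spherePt (η, τ)‖ ≤ 2 * latitude τ := by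
      have h3 : ‖(ξ : EuclideanSpace ℝ (Fin n)) - η‖ ≤ 2 :=
        (norm_sub_le _ _).trans (by simp; norm_num)
      rw [Prod.norm_def]
      refine max_le ?_ ?_
      · simp only [spherePt, Prod.fst_sub, ← smul_sub, norm_smul, Real.norm_eq_abs,
          abs_of_pos (hq0 τ)]
        nlinarith [hq0 τ]
      · simp [spherePt, (hq0 τ).le]
    have h4 : v (ξ, τ) - v (η, τ) = U (spherePt (ξ, τ)) - U (spherePt (η, τ)) := by
      simp only [hv]
      ring
    rw [h4]
    refine h1.trans ?_
    nlinarith [mul_le_mul_of_nonneg_left h2 hK₂0, mul_nonneg hK₁0 (hq0 τ).le]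
  have hK' : ∀ z, |v' z| ≤ K * latitude z.2 ^ 3 := fun z => by
    have h3 := pow_pos (hq0 z.2) 3
    calc |v' z| ≤ ‖fderiv ℝ U (spherePt z)‖ * ‖spherePtDeriv z‖ :=
          (fderiv ℝ U (spherePt z)).le_opNorm _
      _ ≤ K₂ * latitude z.2 ^ 3 := mul_le_mul (hK₂ _ (spherePt_mem_closedBall z))
          (norm_spherePtDeriv_le z) (norm_nonneg _) hK₂0
      _ ≤ K * latitude z.2 ^ 3 := mul_le_mul_of_nonneg_right (by linarith) h3.le
  set μ := (sphereMeasure n).prod (volume : Measure ℝ) with hμ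
  have hw : ∀ z : Sph n × ℝ, ∀ x : ℝ, angularWeight (spherePt z) * x * (latitude z.2 ^ (n + 2) / 2) =
      1 / 2 * (x * latitude z.2 ^ (n + 4)) := fun z x => by
    rw [angularWeight_spherePt]
    ring
  have hmean : ∫ z, latitude z.2 ^ (n + 4) * v z ∂μ = 0 := by
    rw [integral_angleMeasure] at hc
    simp only [hw, integral_const_mul] at hc
    simp only [mul_comm (latitude _ ^ (n + 4)), hv]
    linarith
  have hmain := cylinder_poincare hn hvc hvc' hder hK hosc hK' hmean
  set D : Sph n × ℝ → ℝ := fun z => ∑ i, partialX i U (spherePt z) ^ 2 -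
    fderiv ℝ U (spherePt z) (((z.1 : EuclideanSpace ℝ (Fin n)), 0) : Space n) ^ 2 with hD
  have hDc : Continuous D := by
    simp only [hD, partialX]
    fun_prop
  obtain ⟨B, hB⟩ : ∃ B, ∀ z, |D z| ≤ B := by
    obtain ⟨B, hB⟩ := ((isCompact_closedBall (0 : Space n) 1).prod
      (isCompact_univ (X := Sph n))).exists_bound_of_continuousOn
      (f := fun x : Space n × Sph n => ∑ i, fderiv ℝ U x.1 (EuclideanSpace.single i 1, 0) ^ 2 -
        fderiv ℝ U x.1 (((x.2 : EuclideanSpace ℝ (Fin n)), 0) : Space n) ^ 2) (by fun_prop)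
    exact ⟨B, fun z => hB (spherePt z, z.1) ⟨spherePt_mem_closedBall z, mem_univ _⟩⟩
  have iE : Integrable (fun z => latitudeEnergy n z.2 * v' z ^ 2) μ := by
    simpa only [sq] using integrable_prod_of_abs_le_latitude_pow
      (F := fun z => latitudeEnergy n z.2 * (v' z * v' z)) (k := n + 2) (by fun_prop) (by omega)
      fun z => latitudeEnergy_mul_le (hK' z) (hK' z)
  have iD : Integrable (fun z => latitude z.2 ^ (n + 2) * D z) μ := by
    refine integrable_prod_of_abs_le_latitude_pow (C := B) (k := n + 2) (by fun_prop) (by omega)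
      fun z => ?_
    have := pow_pos (hq0 z.2) (n + 2)
    rw [abs_mul, abs_of_pos this, mul_comm]
    exact mul_le_mul_of_nonneg_right (hB z) this.le
  have hmc := continuous_sphereMean hvc
  have iS : Integrable (fun z => latitude z.2 ^ n * (v z - sphereMean v z.2) ^ 2) μ := by
    refine integrable_prod_of_abs_le_latitude_pow (C := K ^ 2) (k := n + 2) (by fun_prop)
      (by omega) fun z => ?_
    have := pow_pos (hq0 z.2) n
    have h1 := abs_sub_sphereMean_le hn1 hvc (ξ := z.1) (τ := z.2) (fun η => hosc z.1 η z.2)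
    rw [abs_mul, abs_of_pos this, abs_pow]
    calc latitude z.2 ^ n * |v z - sphereMean v z.2| ^ 2
        ≤ latitude z.2 ^ n * (K * latitude z.2) ^ 2 := by gcongr
      _ = _ := by ring
  have hsph : ((n : ℝ) - 1) * ∫ z, latitude z.2 ^ n * (v z - sphereMean v z.2) ^ 2 ∂μ ≤
      ∫ z, latitude z.2 ^ (n + 2) * D z ∂μ := by
    rw [integral_prod_symm _ iS, integral_prod_symm _ iD, ← integral_const_mul]
    refine integral_mono (iS.integral_prod_right.const_mul _) iD.integral_prod_right fun τ => ?_
    simp only [integral_const_mul]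
    -- The chain rule for x ↦ qx gives a factor q² in the spherical energy; it converts the weight
    -- qⁿ of the fluctuation into the weight q^(n+2) carried by Γ.
    set g : EuclideanSpace ℝ (Fin n) → ℝ := fun x =>
      U (latitude τ • x, τ * latitude τ ^ 2 / 2) - c with hg
    have hgd : ContDiff ℝ 1 g := (hU.comp (by fun_prop)).sub contDiff_const
    have hgf : ∀ x y, fderiv ℝ g x y =
        latitude τ * fderiv ℝ U (latitude τ • x, τ * latitude τ ^ 2 / 2) (y, 0) := fun x y => by
      have h1 : HasFDerivAt (fun x : EuclideanSpace ℝ (Fin n) =>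
          ((latitude τ • x, τ * latitude τ ^ 2 / 2) : Space n))
          ((latitude τ • ContinuousLinearMap.id ℝ (EuclideanSpace ℝ (Fin n))).prod 0) x :=
        ((hasFDerivAt_id x).const_smul (latitude τ)).prodMk (hasFDerivAt_const _ _)
      have h2 := (((hU.differentiable one_ne_zero) _).hasFDerivAt.comp x h1).sub_const c
      refine (congrArg (fun L => L y) h2.fderiv).trans ?_
      have h3 : ((latitude τ • y, (0 : ℝ)) : Space n) = latitude τ • (y, (0 : ℝ)) := by simp
      change fderiv ℝ U _ (latitude τ • y, (0 : ℝ)) = _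
      rw [h3, map_smul, smul_eq_mul]
    have h1 := sphere_poincare hn hgd (c := sphereMean v τ) (integral_sub_sphereMean hn1 hvc τ)
    simp only [hgf, mul_pow, ← Finset.mul_sum, ← mul_sub, integral_const_mul] at h1
    have h2 := mul_le_mul_of_nonneg_left h1 (pow_pos (hq0 τ) n).le
    calc ((n : ℝ) - 1) * (latitude τ ^ n *
          ∫ ξ, (v (ξ, τ) - sphereMean v τ) ^ 2 ∂(sphereMeasure n))
        = latitude τ ^ n * (((n : ℝ) - 1) *
          ∫ ξ, (v (ξ, τ) - sphereMean v τ) ^ 2 ∂(sphereMeasure n)) := by ring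
      _ ≤ latitude τ ^ n * (latitude τ ^ 2 * ∫ ξ, D (ξ, τ) ∂(sphereMeasure n)) := h2
      _ = _ := by ring
  rw [integral_angleMeasure, integral_angleMeasure]
  have hΓ : ∀ z : Sph n × ℝ, angularForm U U (spherePt z) * (latitude z.2 ^ (n + 2) / 2) =
      1 / 2 * (latitudeEnergy n z.2 * v' z ^ 2 + latitude z.2 ^ (n + 2) * D z) := fun z => by
    rw [← latitude_pow_mul_angularForm_spherePt]
    ring
  simp only [hΓ, hw]
  rw [integral_const_mul, integral_const_mul, integral_add iE iD]
  simp only [mul_comm (latitude _ ^ n)] at hsph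
  linarith

end GaugeSphere

/-! ### Integrals over annuli and the decomposition of the integrands. -/

section Annulus

variable {n : ℕ} {R : EReal} {V W f g : ℝ → ℝ} {a b a₁ b₁ : ℝ} {F u h : Space n → ℝ}

lemma SupportedIn.mono (hs : SupportedIn a₁ b₁ F) (ha : a ≤ a₁) (hb : b₁ ≤ b) :
    SupportedIn a b F := fun p hp => hs p fun hp' => hp (Icc_subset_Icc ha hb hp')

lemma SupportedIn.gradSq (hs : SupportedIn a b u) : SupportedIn a b (gradSq u) := fun p hp => by
  simp [Grushin.gradSq, hs.partialX _ p hp, hs.partialT p hp]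

lemma SupportedIn.angularX (hs : SupportedIn a b u) (i : Fin n) :
    SupportedIn a b (angularX i u) := fun p hp => by
  simp [Grushin.angularX, hs.partialX i p hp, hs.euler p hp]

lemma SupportedIn.angularT (hs : SupportedIn a b u) : SupportedIn a b (angularT u) :=
  fun p hp => by simp [Grushin.angularT, hs.partialT p hp, hs.euler p hp]

lemma gaugeNorm_dilation_spherePt {r : ℝ} (hr : 0 ≤ r) (θ : Sph n × ℝ) :
    gaugeNorm (dilation r (spherePt θ)) = r := by
  rw [gaugeNorm_dilation hr, gaugeNorm_spherePt, mul_one]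

lemma dilation_spherePt_ne_zero {r : ℝ} (hr : 0 < r) (θ : Sph n × ℝ) :
    dilation r (spherePt θ) ≠ 0 :=
  ne_zero_of_gaugeNorm_pos (by rwa [gaugeNorm_dilation_spherePt hr.le])

lemma continuous_dilation (p : Space n) : Continuous fun r : ℝ => dilation r p := by
  unfold dilation
  fun_prop

lemma integral_radialMeasure_eq_intervalIntegral {G : ℝ → ℝ} (ha : 0 < a) (hab : a ≤ b)
    (hG : ∀ r ∉ Icc a b, 0 < r → G r = 0) :
    ∫ r, G r ∂(radialMeasure n) = ∫ r in a..b, G r * r ^ (n + 1) := by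
  rw [integral_radialMeasure, intervalIntegral.integral_of_le hab, ← integral_Icc_eq_integral_Ioc]
  refine (setIntegral_eq_of_subset_of_forall_sdiff_eq_zero measurableSet_Ioi
    (fun r hr => ha.trans_le hr.1) fun r hr => ?_)
  rw [hG r hr.2 hr.1, zero_mul]

lemma SupportedIn.comp_dilation_eq_zero (hs : SupportedIn a b F) (θ : Sph n × ℝ) {r : ℝ}
    (hr : r ∉ Icc a b) (hr0 : 0 < r) : F (dilation r (spherePt θ)) = 0 :=
  hs _ (by rwa [gaugeNorm_dilation_spherePt hr0.le])

lemma integral_eq_integral_ray (hn : 1 ≤ n) (ha : 0 < a) (hab : a ≤ b) (hs : SupportedIn a b F)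
    (hF : Integrable F) :
    ∫ p, F p = ∫ θ, (∫ r in a..b, F (dilation r (spherePt θ)) * r ^ (n + 1))
      ∂(angleMeasure n) := by
  rw [integral_polar hn hF, integral_prod _ (integrable_polar hn hF)]
  refine integral_congr_ae (Filter.Eventually.of_forall fun θ => ?_)
  exact integral_radialMeasure_eq_intervalIntegral ha hab
    fun r hr hr0 => hs.comp_dilation_eq_zero θ hr hr0

lemma integral_nonneg_of_sphere (hn : 1 ≤ n) (hs : SupportedIn a b F)
    (hF : Integrable F)
    (h : ∀ r ∈ Icc a b, 0 ≤ ∫ θ, F (dilation r (spherePt θ)) ∂(angleMeasure n)) :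
    0 ≤ ∫ p, F p := by
  rw [integral_polar hn hF, integral_prod_symm _ (integrable_polar hn hF), integral_radialMeasure]
  refine setIntegral_nonneg measurableSet_Ioi fun r hr => ?_
  have hr0 : (0 : ℝ) < r := hr
  refine mul_nonneg ?_ (by positivity)
  by_cases hr' : r ∈ Icc a b
  · exact h r hr'
  · simp only [hs.comp_dilation_eq_zero _ hr' hr0, integral_zero, le_refl]

lemma continuousAt_comp_gaugeNorm (hg : ContinuousOn g (radialInterval R)) {p : Space n}
    (hp : gaugeNorm p ∈ radialInterval R) : ContinuousAt (fun p => g (gaugeNorm p)) p :=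
  (hg.continuousAt ((isOpen_radialInterval R).mem_nhds hp)).comp continuous_gaugeNorm.continuousAt

lemma ne_zero_of_mem_radialInterval {p : Space n} (hp : gaugeNorm p ∈ radialInterval R) : p ≠ 0 :=
  ne_zero_of_gaugeNorm_pos hp.1

lemma SupportedIn.integrable_weight (hs : SupportedIn a b F) (hsub : Icc a b ⊆ radialInterval R)
    (hg : ContinuousOn g (radialInterval R)) (hF : ∀ p : Space n, p ≠ 0 → ContinuousAt F p) :
    Integrable fun p => g (gaugeNorm p) * F p :=
  (hs.mul_left _).integrable fun p hp => (continuousAt_comp_gaugeNorm hg (hsub hp)).mul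
    (hF p (ne_zero_of_mem_radialInterval (hsub hp)))

lemma continuousAt_angularWeight {p : Space n} (hp : p ≠ 0) :
    ContinuousAt (angularWeight (n := n)) p :=
  (contDiffAt_angularWeight hp (k := 0)).continuousAt

lemma continuousAt_angularForm (hh : ContDiff ℝ ∞ h) (hu : ContDiff ℝ ∞ u) {p : Space n}
    (hp : p ≠ 0) : ContinuousAt (angularForm h u) p := by
  have h1 := continuous_gaugeNorm (n := n)
  have h2 := fun i => (contDiff_partialX hh i).continuous
  have h3 := fun i => (contDiff_partialX hu i).continuous
  have h4 := (contDiff_partialT hh).continuous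
  have h5 := (contDiff_partialT hu).continuous
  have h6 := (contDiff_euler hh).continuous
  have h7 := (contDiff_euler hu).continuous
  unfold angularForm
  refine ContinuousAt.sub (Continuous.continuousAt (by fun_prop)) ?_
  exact (continuousAt_angularWeight hp).mul (h6.mul h7).continuousAt

lemma continuousAt_angularX (hu : ContDiff ℝ ∞ u) (i : Fin n) {p : Space n} (hp : p ≠ 0) :
    ContinuousAt (angularX i u) p := by
  have h1 := continuous_gaugeNorm (n := n)
  have h3 := (contDiff_partialX hu i).continuous
  have h7 := (contDiff_euler hu).continuous
  unfold angularX
  refine ContinuousAt.sub (h1.mul h3).continuousAt (ContinuousAt.mul (ContinuousAt.div ?_ ?_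
    (pow_ne_zero 3 (gaugeNorm_pos hp).ne')) h7.continuousAt) <;>
  exact Continuous.continuousAt (by fun_prop)

lemma continuousAt_angularT (hu : ContDiff ℝ ∞ u) {p : Space n} (hp : p ≠ 0) :
    ContinuousAt (angularT u) p := by
  have h1 := continuous_gaugeNorm (n := n)
  have h3 := (contDiff_partialT hu).continuous
  have h7 := (contDiff_euler hu).continuous
  unfold angularT
  refine ContinuousAt.mul (Continuous.continuousAt (by fun_prop))
    (ContinuousAt.sub (h1.mul h3).continuousAt (ContinuousAt.mul (ContinuousAt.div ?_ ?_
    (pow_ne_zero 3 (gaugeNorm_pos hp).ne')) h7.continuousAt)) <;>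
  exact Continuous.continuousAt (by fun_prop)

lemma continuousOn_div_pow (hg : ContinuousOn g (radialInterval R)) (k : ℕ) :
    ContinuousOn (fun r => g r / r ^ k) (radialInterval R) :=
  hg.div (continuous_pow k).continuousOn fun _ hr => pow_ne_zero k hr.1.ne'

/-- The radial part of `ϱ² L_G u / ψ`. -/
def radialPart (u : Space n → ℝ) (p : Space n) : ℝ := euler (euler u) p + n * euler u p

lemma contDiff_radialPart (hu : ContDiff ℝ ∞ u) : ContDiff ℝ ∞ (radialPart u) :=
  (contDiff_euler (contDiff_euler hu)).add (contDiff_const.mul (contDiff_euler hu))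

lemma SupportedIn.radialPart (hs : SupportedIn a b u) : SupportedIn a b (radialPart u) :=
  fun p hp => by simp [Grushin.radialPart, hs.euler p hp, hs.euler.euler p hp]

lemma fderiv_radialPart (hu : ContDiff ℝ ∞ u) (p v : Space n) : fderiv ℝ (radialPart u) p v =
    fderiv ℝ (euler (euler u)) p v + n * fderiv ℝ (euler u) p v := by
  have h1 := ((contDiff_euler (contDiff_euler hu)).differentiable (by simp) p).hasFDerivAt
  have h2 := ((contDiff_euler hu).differentiable (by simp) p).hasFDerivAt
  refine (congrArg (fun L => L v) (h1.fun_add (h2.const_mul (n : ℝ))).fderiv).trans ?_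
  simp

lemma angularForm_radialPart (hu : ContDiff ℝ ∞ u) (w : Space n → ℝ) (p : Space n) :
    angularForm (radialPart u) w p =
      angularForm (euler (euler u)) w p + n * angularForm (euler u) w p := by
  have hx : ∀ i, partialX i (radialPart u) p =
      partialX i (euler (euler u)) p + n * partialX i (euler u) p :=
    fun i => fderiv_radialPart hu p _
  have ht : partialT (radialPart u) p = partialT (euler (euler u)) p + n * partialT (euler u) p :=
    fderiv_radialPart hu p _
  have he : euler (radialPart u) p = euler (euler (euler u)) p + n * euler (euler u) p :=
    fderiv_radialPart hu p _
  simp only [angularForm, hx, ht, he, add_mul, Finset.sum_add_distrib, mul_assoc,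
    ← Finset.mul_sum]
  ring

lemma hardyTerm_eq (W : ℝ → ℝ) (u : Space n → ℝ) {p : Space n} (hp : p ≠ 0) :
    hardyTerm W u p = W (gaugeNorm p) / gaugeNorm p ^ 2 * (angularWeight p * euler u p ^ 2) +
      W (gaugeNorm p) / gaugeNorm p ^ 2 * angularForm u u p := by
  rw [hardyTerm, gradSq_eq_angularForm u hp]
  ring

/-- Since u_ϱ/(ϱf) = Zu/(ϱ²f), the radial factor k = 1/(ϱ²f) passes through Γ, and in the radial
part its logarithmic derivative ϱk'/k = −(2 + ϱf'/f) appears. -/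
lemma remainderTerm_eq (V : ℝ → ℝ) (hf : ContDiffOn ℝ 1 f (radialInterval R))
    (hf0 : ∀ r ∈ radialInterval R, 0 < f r) (hu : ContDiff ℝ ∞ u) {p : Space n}
    (hp : gaugeNorm p ∈ radialInterval R) :
    remainderTerm V f u p =
      V (gaugeNorm p) / gaugeNorm p ^ 4 * (angularWeight p * (euler (euler u) p -
        (2 + gaugeNorm p * deriv f (gaugeNorm p) / f (gaugeNorm p)) * euler u p) ^ 2) +
      V (gaugeNorm p) / gaugeNorm p ^ 4 * angularForm (euler u) (euler u) p := by
  have hp0 := ne_zero_of_mem_radialInterval hp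
  have hr : 0 < gaugeNorm p := hp.1
  have hfp := hf0 _ hp
  have hq : (fun q => radialDeriv u q / (gaugeNorm q * f (gaugeNorm q))) =
      fun q => (fun s => (s ^ 2 * f s)⁻¹) (gaugeNorm q) * euler u q := by
    funext q
    rw [radialDeriv_eq (hu.differentiable (by simp)), div_div, div_eq_inv_mul]
    ring_nf
  have hk : HasDerivAt (fun s => (s ^ 2 * f s)⁻¹)
      (-(2 * gaugeNorm p * f (gaugeNorm p) + gaugeNorm p ^ 2 * deriv f (gaugeNorm p)) /
        (gaugeNorm p ^ 2 * f (gaugeNorm p)) ^ 2) (gaugeNorm p) := by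
    have h1 := ((hasDerivAt_pow 2 (gaugeNorm p)).mul (hasDerivAt_of_contDiffOn hf hp)).inv
      (by simp only [Pi.mul_apply]; positivity)
    refine h1.congr_deriv ?_
    simp
  have hd : DifferentiableAt ℝ (euler u) p := (contDiff_euler hu).differentiable (by simp) p
  rw [remainderTerm, hq, gradSq_eq_angularForm _ hp0, euler_radial_mul hp0 hk hd,
    angularForm_radial_mul _ hp0 hk hd, angularForm_comm,
    angularForm_radial_mul _ hp0 hk hd]
  field_simp
  ring

end Annulus

/-! ### Ray inequalities integrated over the gauge sphere. -/

section Identities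

variable {n : ℕ} {R : EReal} {V W f : ℝ → ℝ} {a b a₁ b₁ : ℝ} {u : Space n → ℝ}

lemma continuousOn_logDeriv (hf : ContDiffOn ℝ 1 f (radialInterval R))
    (hf0 : ∀ r ∈ radialInterval R, 0 < f r) :
    ContinuousOn (fun r => 2 + r * deriv f r / f r) (radialInterval R) :=
  continuousOn_const.add ((continuousOn_id.mul (continuousOn_deriv_of_contDiffOn hf)).div
    hf.continuousOn fun r hr => (hf0 r hr).ne')

lemma continuousAt_radialRemainder (hf : ContDiffOn ℝ 1 f (radialInterval R))
    (hf0 : ∀ r ∈ radialInterval R, 0 < f r) (hu : ContDiff ℝ ∞ u) {p : Space n}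
    (hp : gaugeNorm p ∈ radialInterval R) :
    ContinuousAt (fun p => angularWeight p * (euler (euler u) p -
      (2 + gaugeNorm p * deriv f (gaugeNorm p) / f (gaugeNorm p)) * euler u p) ^ 2) p := by
  have h1 := (contDiff_euler hu).continuous.continuousAt (x := p)
  have h2 := (contDiff_euler (contDiff_euler hu)).continuous.continuousAt (x := p)
  have h3 := continuousAt_comp_gaugeNorm (continuousOn_logDeriv hf hf0) hp
  exact (continuousAt_angularWeight (ne_zero_of_mem_radialInterval hp)).mul
    ((h2.sub (h3.mul h1)).pow 2)

lemma integrable_radialRemainder (hV : ContinuousOn V (radialInterval R))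
    (hf : ContDiffOn ℝ 1 f (radialInterval R)) (hf0 : ∀ r ∈ radialInterval R, 0 < f r)
    (hu : ContDiff ℝ ∞ u) (hs : SupportedIn a b u) (hsub : Icc a b ⊆ radialInterval R) :
    Integrable fun p => V (gaugeNorm p) / gaugeNorm p ^ 4 * (angularWeight p *
      (euler (euler u) p - (2 + gaugeNorm p * deriv f (gaugeNorm p) / f (gaugeNorm p)) *
        euler u p) ^ 2) := by
  refine SupportedIn.integrable (a := a) (b := b) (fun p hp => ?_) fun p hp => ?_
  · simp [hs.euler p hp, hs.euler.euler p hp]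
  · exact (continuousAt_comp_gaugeNorm (continuousOn_div_pow hV 4) (hsub hp)).mul
      (continuousAt_radialRemainder hf hf0 hu (hsub hp))

lemma integrable_angularForm_weight {g : ℝ → ℝ} (k : ℕ) (hg : ContinuousOn g (radialInterval R))
    {h : Space n → ℝ} (hh : ContDiff ℝ ∞ h)
    (hu : ContDiff ℝ ∞ u) (hs : SupportedIn a b u) (hsub : Icc a b ⊆ radialInterval R) :
    Integrable fun p => g (gaugeNorm p) / gaugeNorm p ^ k * angularForm h u p :=
  (hs.angularForm h).integrable_weight hsub (continuousOn_div_pow hg k)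
    fun _ hp => continuousAt_angularForm hh hu hp

lemma integrable_angularWeight_sq {g : ℝ → ℝ} (k : ℕ) (hg : ContinuousOn g (radialInterval R))
    {h : Space n → ℝ} (hh : Continuous h) (hs : SupportedIn a b h)
    (hsub : Icc a b ⊆ radialInterval R) :
    Integrable fun p => g (gaugeNorm p) / gaugeNorm p ^ k * (angularWeight p * h p ^ 2) := by
  refine SupportedIn.integrable_weight (a := a) (b := b) (F := fun p => angularWeight p * h p ^ 2)
    (fun p hp => ?_) hsub (continuousOn_div_pow hg k)
    fun p hp => (continuousAt_angularWeight hp).mul (hh.pow 2).continuousAt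
  simp [hs p hp]

lemma hasDerivAt_euler_div_ray (hu : ContDiff ℝ ∞ u) (θ : Sph n × ℝ) {r : ℝ} (hr : 0 < r) :
    HasDerivAt (fun r => euler u (dilation r (spherePt θ)) / r)
      ((euler (euler u) (dilation r (spherePt θ)) - euler u (dilation r (spherePt θ))) / r ^ 2)
      r := by
  have h1 := hasDerivAt_comp_dilation hr.ne' (u := euler u) (p := spherePt θ)
    ((contDiff_euler hu).differentiable (by simp) _)
  refine (h1.div (hasDerivAt_id r) hr.ne').congr_deriv ?_
  simp only [id]
  field_simp

/-- The one-dimensional Rellich identity integrated over the rays. -/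
lemma integral_radialPart_eq (hn : 1 ≤ n) (hV : ContDiffOn ℝ 1 V (radialInterval R))
    (hW : ContinuousOn W (radialInterval R))
    (hf : IsPositiveSolution (homDim n + 2) R V
      (fun r => W r + (homDim n : ℝ) * (deriv V r / r)) f)
    (ha : 0 < a) (haa : a < a₁) (hab : a₁ ≤ b₁) (hbb : b₁ < b) (hsub : Icc a b ⊆ radialInterval R)
    (hu : ContDiff ℝ ∞ u) (hs : SupportedIn a₁ b₁ u) :
    ∫ p, V (gaugeNorm p) / gaugeNorm p ^ 4 * (angularWeight p * radialPart u p ^ 2) =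
      (∫ p, W (gaugeNorm p) / gaugeNorm p ^ 2 * (angularWeight p * euler u p ^ 2)) +
      ∫ p, V (gaugeNorm p) / gaugeNorm p ^ 4 * (angularWeight p * (euler (euler u) p -
        (2 + gaugeNorm p * deriv f (gaugeNorm p) / f (gaugeNorm p)) * euler u p) ^ 2) := by
  have hab' : a ≤ b := by linarith
  have hs' : SupportedIn a b u := hs.mono haa.le hbb.le
  have hZ := contDiff_euler hu
  have hZZ := contDiff_euler hZ
  have i1 := integrable_angularWeight_sq 4 hV.continuousOn (contDiff_radialPart hu).continuous
    hs'.radialPart hsub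
  have i2 := integrable_angularWeight_sq 2 hW hZ.continuous hs'.euler hsub
  have i3 := integrable_radialRemainder hV.continuousOn hf.contDiffOn hf.pos hu hs' hsub
  rw [← sub_eq_zero, ← integral_add i2 i3, ← integral_sub i1 (i2.fun_add i3),
    integral_eq_integral_ray hn ha hab' _ (i1.fun_sub (i2.fun_add i3))]
  · refine integral_eq_zero_of_ae (Filter.Eventually.of_forall fun θ => ?_)
    have h0 : ∀ {r}, 0 < r → r ∉ Icc a₁ b₁ → euler u (dilation r (spherePt θ)) = 0 :=
      fun hr0 hr => hs.euler.comp_dilation_eq_zero θ hr hr0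
    -- On the ray y = Zu/r = u_ϱ, and y' + (n+1)y/r = (Z²u + nZu)/r². The factor ψ is constant along
    -- the ray and comes out of the integral.
    have h1 := integral_radial_rellich hV hW hf hab' hsub
      (y := fun r => euler u (dilation r (spherePt θ)) / r)
      (fun r hr => hasDerivAt_euler_div_ray hu θ (ha.trans_le hr.1))
      (ContinuousOn.div (Continuous.continuousOn
        ((hZZ.continuous.comp (continuous_dilation _)).sub
          (hZ.continuous.comp (continuous_dilation _)))) (continuous_pow 2).continuousOn
        fun r hr => pow_ne_zero 2 (ha.trans_le hr.1).ne')
      (by simp only [h0 ha fun h => absurd h.1 (not_le.2 haa), zero_div])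
      (by simp only [h0 (ha.trans_le hab') fun h => absurd h.2 (not_le.2 hbb), zero_div])
    rw [Pi.zero_apply, ← mul_zero (angularWeight (spherePt θ)), ← h1,
      ← intervalIntegral.integral_const_mul]
    refine intervalIntegral.integral_congr fun r hr => ?_
    rw [uIcc_of_le hab'] at hr
    have hr0 : 0 < r := ha.trans_le hr.1
    have hfr := hf.pos r (hsub hr)
    simp only [gaugeNorm_dilation_spherePt hr0.le, angularWeight_dilation hr0, radialPart]
    field_simp
    ring
  · intro p hp
    simp [hs'.radialPart p hp, hs'.euler p hp, hs'.euler.euler p hp]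

/-- The one-dimensional angular inequality integrated over the rays, for one component of the
angular gradient. -/
lemma integral_angular_component_nonneg (hn : 1 ≤ n) (hV : ContDiffOn ℝ 1 V (radialInterval R))
    (hW : ContinuousOn W (radialInterval R))
    (hf : IsPositiveSolution (homDim n + 2) R V
      (fun r => W r + (homDim n : ℝ) * (deriv V r / r)) f)
    (hV0 : ∀ r ∈ radialInterval R, 0 ≤ V r)
    (hV' : ∀ r ∈ radialInterval R, DifferentiableAt ℝ (deriv V) r)
    (hVV : ∀ r ∈ radialInterval R,
      0 ≤ ((homDim n : ℝ) - 5) * (V r / r ^ 2) + 3 * (deriv V r / r) - deriv (deriv V) r)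
    (ha : 0 < a) (haa : a < a₁) (hab : a₁ ≤ b₁) (hbb : b₁ < b) (hsub : Icc a b ⊆ radialInterval R)
    {X₀ X₁ X₂ : Space n → ℝ} (hX₀ : ∀ p, p ≠ 0 → ContinuousAt X₀ p)
    (hX₁ : ∀ p, p ≠ 0 → ContinuousAt X₁ p) (hX₂ : ∀ p, p ≠ 0 → ContinuousAt X₂ p)
    (hs : SupportedIn a₁ b₁ X₀) (hs₁ : SupportedIn a₁ b₁ X₁)
    (h₁ : ∀ θ r, 0 < r → HasDerivAt (fun r => X₀ (dilation r (spherePt θ)))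
      (X₁ (dilation r (spherePt θ)) / r) r)
    (h₂ : ∀ θ r, 0 < r → HasDerivAt (fun r => X₁ (dilation r (spherePt θ)))
      (X₂ (dilation r (spherePt θ)) / r) r) :
    Integrable (fun p => V (gaugeNorm p) / gaugeNorm p ^ 4 * (-2 * (X₀ p * (X₂ p + n * X₁ p)) +
      (n + 1) * X₀ p ^ 2 - X₁ p ^ 2) - W (gaugeNorm p) / gaugeNorm p ^ 2 * X₀ p ^ 2) ∧
    0 ≤ ∫ p, (V (gaugeNorm p) / gaugeNorm p ^ 4 * (-2 * (X₀ p * (X₂ p + n * X₁ p)) +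
      (n + 1) * X₀ p ^ 2 - X₁ p ^ 2) - W (gaugeNorm p) / gaugeNorm p ^ 2 * X₀ p ^ 2) := by
  have hab' : a ≤ b := by linarith
  have hs' := hs.mono haa.le hbb.le
  have hs₁' := hs₁.mono haa.le hbb.le
  have i1 : Integrable (fun p => V (gaugeNorm p) / gaugeNorm p ^ 4 *
      (-2 * (X₀ p * (X₂ p + n * X₁ p)) + (n + 1) * X₀ p ^ 2 - X₁ p ^ 2)) := by
    refine SupportedIn.integrable_weight (a := a) (b := b) (F := fun p =>
      -2 * (X₀ p * (X₂ p + n * X₁ p)) + (n + 1) * X₀ p ^ 2 - X₁ p ^ 2) (fun p hp => ?_) hsub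
      (continuousOn_div_pow hV.continuousOn 4) fun p hp => ?_
    · simp [hs' p hp, hs₁' p hp]
    · have c0 := hX₀ p hp
      have c1 := hX₁ p hp
      have c2 := hX₂ p hp
      fun_prop
  have i2 : Integrable (fun p => W (gaugeNorm p) / gaugeNorm p ^ 2 * X₀ p ^ 2) := by
    refine SupportedIn.integrable_weight (a := a) (b := b) (F := fun p => X₀ p ^ 2)
      (fun p hp => ?_) hsub (continuousOn_div_pow hW 2) fun p hp => (hX₀ p hp).pow 2
    simp [hs' p hp]
  refine ⟨i1.fun_sub i2, ?_⟩
  rw [integral_eq_integral_ray hn ha hab' _ (i1.fun_sub i2)]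
  · refine integral_nonneg fun θ => ?_
    have hray := integral_angular_nonneg hV hW hf hV0 hV' hVV hab' hsub
      (g := fun r => X₀ (dilation r (spherePt θ)))
      (fun r hr => h₁ θ r (ha.trans_le hr.1)) (fun r hr => h₂ θ r (ha.trans_le hr.1))
      (fun r hr => (ContinuousAt.comp (f := fun r => dilation r (spherePt θ))
        (hX₂ _ (dilation_spherePt_ne_zero (ha.trans_le hr.1) θ))
        (continuous_dilation _).continuousAt).continuousWithinAt)
      (hs.comp_dilation_eq_zero θ (fun h => absurd h.1 (not_le.2 haa)) ha)
      (hs.comp_dilation_eq_zero θ (fun h => absurd h.2 (not_le.2 hbb)) (ha.trans_le hab'))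
    refine hray.trans_eq (intervalIntegral.integral_congr fun r hr => ?_)
    rw [uIcc_of_le hab'] at hr
    have hr0 : 0 < r := ha.trans_le hr.1
    simp only [gaugeNorm_dilation_spherePt hr0.le]
    ring
  · intro p hp
    simp [hs' p hp, hs₁' p hp]

/-- The one-dimensional angular inequality integrated over the rays. -/
lemma integral_angularForm_nonneg (hn : 1 ≤ n) (hV : ContDiffOn ℝ 1 V (radialInterval R))
    (hW : ContinuousOn W (radialInterval R))
    (hf : IsPositiveSolution (homDim n + 2) R V
      (fun r => W r + (homDim n : ℝ) * (deriv V r / r)) f)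
    (hV0 : ∀ r ∈ radialInterval R, 0 ≤ V r)
    (hV' : ∀ r ∈ radialInterval R, DifferentiableAt ℝ (deriv V) r)
    (hVV : ∀ r ∈ radialInterval R,
      0 ≤ ((homDim n : ℝ) - 5) * (V r / r ^ 2) + 3 * (deriv V r / r) - deriv (deriv V) r)
    (ha : 0 < a) (haa : a < a₁) (hab : a₁ ≤ b₁) (hbb : b₁ < b) (hsub : Icc a b ⊆ radialInterval R)
    (hu : ContDiff ℝ ∞ u) (hs : SupportedIn a₁ b₁ u) :
    2 * (∫ p, V (gaugeNorm p) / gaugeNorm p ^ 4 * angularForm (radialPart u) u p) +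
      (∫ p, W (gaugeNorm p) / gaugeNorm p ^ 2 * angularForm u u p) +
      (∫ p, V (gaugeNorm p) / gaugeNorm p ^ 4 * angularForm (euler u) (euler u) p) ≤
      (n + 1) * ∫ p, V (gaugeNorm p) / gaugeNorm p ^ 4 * angularForm u u p := by
  have hs' : SupportedIn a b u := hs.mono haa.le hbb.le
  have hZ := contDiff_euler hu
  have hZZ := contDiff_euler hZ
  have hVc := hV.continuousOn
  -- Along rays r∂ᵣ carries each angular component of u to the same component of Zu, then of Z²u.
  -- These are the functions g, g₁, g₂ of the one-dimensional inequality.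
  have hx := fun i => integral_angular_component_nonneg hn hV hW hf hV0 hV' hVV ha haa hab hbb hsub
    (fun p hp => continuousAt_angularX hu i hp) (fun p hp => continuousAt_angularX hZ i hp)
    (fun p hp => continuousAt_angularX hZZ i hp) (hs.angularX i) (hs.euler.angularX i)
    (fun θ r hr => hasDerivAt_angularX_dilation hu i hr (spherePt_ne_zero θ))
    (fun θ r hr => hasDerivAt_angularX_dilation hZ i hr (spherePt_ne_zero θ))
  have ht := integral_angular_component_nonneg hn hV hW hf hV0 hV' hVV ha haa hab hbb hsub
    (fun p hp => continuousAt_angularT hu hp) (fun p hp => continuousAt_angularT hZ hp)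
    (fun p hp => continuousAt_angularT hZZ hp) hs.angularT hs.euler.angularT
    (fun θ r hr => hasDerivAt_angularT_dilation hu hr (spherePt_ne_zero θ))
    (fun θ r hr => hasDerivAt_angularT_dilation hZ hr (spherePt_ne_zero θ))
  have hsum := add_nonneg (Finset.sum_nonneg fun i (_ : i ∈ Finset.univ) => (hx i).2) ht.2
  rw [← integral_finsetSum _ fun i _ => (hx i).1,
    ← integral_add (integrable_finsetSum _ fun i _ => (hx i).1) ht.1] at hsum
  have i1 := integrable_angularForm_weight 4 hVc (contDiff_radialPart hu) hu hs' hsub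
  have i2 := integrable_angularForm_weight 2 hW hu hu hs' hsub
  have i3 := integrable_angularForm_weight 4 hVc hZ hZ hs'.euler hsub
  have i4 := integrable_angularForm_weight 4 hVc hu hu hs' hsub
  rw [← sub_nonneg, ← integral_const_mul, ← integral_const_mul, ← integral_add (i1.const_mul 2) i2,
    ← integral_add ((i1.const_mul 2).fun_add i2) i3,
    ← integral_sub (i4.const_mul _) (((i1.const_mul 2).fun_add i2).fun_add i3)]
  refine hsum.trans_eq (integral_congr_ae ?_)
  filter_upwards [compl_mem_ae_iff.2 (measure_singleton (0 : Space n))] with p hp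
  have hp0 : p ≠ 0 := hp
  simp only [angularForm_radialPart hu, angularForm_eq_sum _ _ hp0]
  set v := V (gaugeNorm p) / gaugeNorm p ^ 4
  set w := W (gaugeNorm p) / gaugeNorm p ^ 2
  have hsplit : ∑ i, (v * (-2 * (angularX i u p * (angularX i (euler (euler u)) p +
        n * angularX i (euler u) p)) + (n + 1) * angularX i u p ^ 2 - angularX i (euler u) p ^ 2) -
      w * angularX i u p ^ 2) =
      v * (-2 * (∑ i, angularX i (euler (euler u)) p * angularX i u p +
        n * ∑ i, angularX i (euler u) p * angularX i u p) +
        (n + 1) * ∑ i, angularX i u p * angularX i u p -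
        ∑ i, angularX i (euler u) p * angularX i (euler u) p) -
      w * ∑ i, angularX i u p * angularX i u p := by
    simp only [Finset.mul_sum, ← Finset.sum_add_distrib, ← Finset.sum_sub_distrib]
    exact Finset.sum_congr rfl fun i _ => by ring
  rw [hsplit]
  ring

end Identities

/-! ### Means over gauge spheres and the Poincaré inequality at every radius. -/

section AngularMean

variable {n : ℕ} {R : EReal} {V w : ℝ → ℝ} {a b : ℝ} {F u h : Space n → ℝ}

lemma continuous_angularWeight_spherePt :
    Continuous fun θ : Sph n × ℝ => angularWeight (spherePt θ) := by
  have := continuous_latitude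
  simp only [angularWeight_spherePt]
  fun_prop

lemma continuous_dilation_spherePt (r : ℝ) :
    Continuous fun θ : Sph n × ℝ => dilation r (spherePt θ) :=
  ((continuous_fst.comp continuous_spherePt).const_smul r).prodMk
    (continuous_const.mul (continuous_snd.comp continuous_spherePt))

lemma SupportedIn.integrable_dilation_spherePt (hn : 1 ≤ n) (hs : SupportedIn a b F) (ha : 0 < a)
    (hF : ∀ p, p ≠ 0 → ContinuousAt F p) (r : ℝ) :
    Integrable (fun θ => F (dilation r (spherePt θ))) (angleMeasure n) := by
  have hc : Continuous F := hs.continuous fun p hp =>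
    hF p (ne_zero_of_gaugeNorm_pos (ha.trans_le hp.1))
  obtain ⟨C, hC⟩ := hs.hasCompactSupport.exists_bound_of_continuous hc
  exact integrable_angleMeasure_of_bounded hn (hc.comp (continuous_dilation_spherePt r))
    fun θ => hC _

/-- The total mass of `ψ` on the unit gauge sphere. -/
def angularMass (n : ℕ) : ℝ := ∫ θ, angularWeight (spherePt θ) ∂(angleMeasure n)

lemma angularMass_pos (hn : 1 ≤ n) : 0 < angularMass n := by
  have h1 : ∀ z : Sph n × ℝ, angularWeight (spherePt z) * (latitude z.2 ^ (n + 2) / 2) =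
      1 * (1 / 2 * latitude z.2 ^ (n + 4)) := fun z => by
    rw [angularWeight_spherePt]
    ring
  unfold angularMass
  rw [integral_angleMeasure]
  simp only [h1]
  rw [integral_prod_mul (fun _ : Sph n => (1 : ℝ)) (fun τ => 1 / 2 * latitude τ ^ (n + 4)),
    integral_const_mul]
  have h2 := integral_latitude_pow_pos (k := n + 4) (by omega)
  have h3 := sphereMeasure_real_univ_pos hn
  simp only [integral_const, smul_eq_mul, mul_one]
  positivity

/-- The mean of `u` with weight `ψ` over the gauge sphere of radius `r`. -/
def angularMean (u : Space n → ℝ) (r : ℝ) : ℝ := (angularMass n)⁻¹ *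
  ∫ θ, angularWeight (spherePt θ) * u (dilation r (spherePt θ)) ∂(angleMeasure n)

lemma angularMean_eq_zero (hs : SupportedIn a b u) {r : ℝ} (hr0 : 0 < r) (hr : r ∉ Icc a b) :
    angularMean u r = 0 := by
  simp only [angularMean, hs.comp_dilation_eq_zero _ hr hr0, mul_zero, integral_zero]

lemma abs_angularWeight_spherePt_mul_le {x C : ℝ} (hx : |x| ≤ C) (θ : Sph n × ℝ) :
    |angularWeight (spherePt θ) * x| ≤ C := by
  have h1 := latitude_pos θ.2
  rw [angularWeight_spherePt, abs_mul, abs_of_pos (pow_pos h1 2)]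
  calc latitude θ.2 ^ 2 * |x| ≤ 1 * |x| := by
        gcongr
        exact pow_le_one₀ h1.le (latitude_le_one _)
    _ ≤ C := by rwa [one_mul]

lemma continuous_angularWeight_mul_dilation (hu : Continuous u) (r : ℝ) :
    Continuous fun θ : Sph n × ℝ => angularWeight (spherePt θ) * u (dilation r (spherePt θ)) :=
  continuous_angularWeight_spherePt.mul (hu.comp (continuous_dilation_spherePt r))

lemma integrable_angularWeight_mul_dilation (hn : 1 ≤ n) (hu : Continuous u)
    (hs : SupportedIn a b u) (r : ℝ) :
    Integrable (fun θ => angularWeight (spherePt θ) * u (dilation r (spherePt θ)))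
      (angleMeasure n) := by
  obtain ⟨C, hC⟩ := hs.hasCompactSupport.exists_bound_of_continuous hu
  exact integrable_angleMeasure_of_bounded hn (continuous_angularWeight_mul_dilation hu r)
    fun θ => abs_angularWeight_spherePt_mul_le (hC _) θ

lemma hasDerivAt_angularMean (hn : 1 ≤ n) (hu : ContDiff ℝ ∞ u) (hs : SupportedIn a b u) {r : ℝ}
    (hr : 0 < r) : HasDerivAt (angularMean u) (angularMean (euler u) r / r) r := by
  have hfin := isFiniteMeasure_angleMeasure hn
  have hZ := contDiff_euler hu
  obtain ⟨C, hC⟩ := hs.euler.hasCompactSupport.exists_bound_of_continuous hZ.continuous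
  have hC0 : 0 ≤ C := (norm_nonneg _).trans (hC 0)
  have key := (hasDerivAt_integral_of_dominated_loc_of_deriv_le (μ := angleMeasure n)
    (bound := fun _ => C / (r / 2))
    (F := fun s θ => angularWeight (spherePt θ) * u (dilation s (spherePt θ)))
    (F' := fun s θ => angularWeight (spherePt θ) * (euler u (dilation s (spherePt θ)) / s))
    -- The neighbourhood s > r/2 bounds the factor 1/s in the derivative along the ray.
    (Ioi_mem_nhds (half_lt_self hr))
    (Filter.Eventually.of_forall fun s =>
      (continuous_angularWeight_mul_dilation hu.continuous s).aestronglyMeasurable)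
    (integrable_angularWeight_mul_dilation hn hu.continuous hs r)
    (by
      simp only [← mul_div_assoc]
      exact ((continuous_angularWeight_mul_dilation hZ.continuous r).div_const
        r).aestronglyMeasurable)
    (Filter.Eventually.of_forall fun θ s hs => by
      refine abs_angularWeight_spherePt_mul_le ?_ θ
      have hs0 : 0 < r / 2 := half_pos hr
      rw [abs_div, abs_of_pos (hs0.trans hs)]
      exact div_le_div₀ hC0 (hC _) hs0 (le_of_lt hs))
    (integrable_const _)
    (Filter.Eventually.of_forall fun θ s hs =>
      (hasDerivAt_comp_dilation ((half_pos hr).trans hs).ne'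
        (hu.differentiable (by simp) _)).const_mul _)).2
  refine (key.const_mul (angularMass n)⁻¹).congr_deriv ?_
  simp only [angularMean, ← mul_div_assoc, integral_div]

lemma contDiffOn_angularMean (hn : 1 ≤ n) (hu : ContDiff ℝ ∞ u) (hs : SupportedIn a b u) :
    ContDiffOn ℝ 1 (angularMean u) (Ioi 0) := by
  have hd : ∀ r ∈ Ioi (0 : ℝ), HasDerivAt (angularMean u) (angularMean (euler u) r / r) r :=
    fun r hr => hasDerivAt_angularMean hn hu hs hr
  have hcont : ContinuousOn (deriv (angularMean u)) (Ioi 0) := by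
    refine ContinuousOn.congr (f := fun r => angularMean (euler u) r / r) ?_
      fun r hr => (hd r hr).deriv
    refine ContinuousOn.div (fun r hr => ?_) continuousOn_id fun r hr => ne_of_gt hr
    exact (hasDerivAt_angularMean hn (contDiff_euler hu) hs.euler
      hr).continuousAt.continuousWithinAt
  rw [show (1 : WithTop ℕ∞) = 0 + 1 from rfl, contDiffOn_succ_iff_deriv_of_isOpen isOpen_Ioi]
  exact ⟨fun r hr => (hd r hr).differentiableAt.differentiableWithinAt, by simp,
    contDiffOn_zero.2 hcont⟩

lemma fderiv_comp_dilation (hu : Differentiable ℝ u) (r : ℝ) (p v : Space n) :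
    fderiv ℝ (fun q => u (dilation r q)) p v = fderiv ℝ u (dilation r p) (dilation r v) := by
  have h1 : HasFDerivAt (fun q : Space n => dilation r q)
      ((r • ContinuousLinearMap.fst ℝ (EuclideanSpace ℝ (Fin n)) ℝ).prod
        (r ^ 2 • ContinuousLinearMap.snd ℝ (EuclideanSpace ℝ (Fin n)) ℝ)) p :=
    (hasFDerivAt_fst.const_smul r).prodMk (hasFDerivAt_snd.const_smul (r ^ 2))
  exact congrArg (fun L => L v) ((hu (dilation r p)).hasFDerivAt.comp p h1).fderiv

/-- Γ has degree zero under dilations, so the inequality on the unit gauge sphere holds on every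
gauge sphere with the same constant. -/
lemma angularForm_comp_dilation (hu : Differentiable ℝ u) {r : ℝ} (hr : 0 < r) (p : Space n) :
    angularForm (fun q => u (dilation r q)) (fun q => u (dilation r q)) p =
      angularForm u u (dilation r p) := by
  have hx : ∀ i, partialX i (fun q => u (dilation r q)) p = r * partialX i u (dilation r p) :=
    fun i => by
      rw [partialX, fderiv_comp_dilation hu, partialX, ← smul_eq_mul, ← map_smul]
      simp [dilation]
  have ht : partialT (fun q => u (dilation r q)) p = r ^ 2 * partialT u (dilation r p) := by
    rw [partialT, fderiv_comp_dilation hu, partialT, ← smul_eq_mul, ← map_smul]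
    simp [dilation]
  have he : euler (fun q => u (dilation r q)) p = euler u (dilation r p) := by
    rw [euler, fderiv_comp_dilation hu, euler]
    simp only [dilation]
    ring_nf
  have hnorm : ‖(dilation r p).1‖ = r * ‖p.1‖ := by
    simp [dilation, norm_smul, abs_of_pos hr]
  simp only [angularForm, hx, ht, he, gaugeNorm_dilation hr.le, angularWeight_dilation hr, hnorm]
  have h1 : ∑ i, r * partialX i u (dilation r p) * (r * partialX i u (dilation r p)) =
      r ^ 2 * ∑ i, partialX i u (dilation r p) * partialX i u (dilation r p) := by
    rw [Finset.mul_sum]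
    exact Finset.sum_congr rfl fun i _ => by ring
  rw [h1]
  ring

/-- The Poincaré inequality on gauge spheres, integrated over the radius. -/
lemma integral_variance_le (hn : 2 ≤ n) (hV : ContinuousOn V (radialInterval R))
    (hV0 : ∀ r ∈ radialInterval R, 0 ≤ V r) (hsub : Icc a b ⊆ radialInterval R) (ha : 0 < a)
    (hu : ContDiff ℝ ∞ u) (hs : SupportedIn a b u) :
    Integrable (fun p => V (gaugeNorm p) / gaugeNorm p ^ 4 *
      (angularWeight p * (u p - angularMean u (gaugeNorm p)) ^ 2)) ∧
    ((n : ℝ) + 1) * ∫ p, V (gaugeNorm p) / gaugeNorm p ^ 4 *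
      (angularWeight p * (u p - angularMean u (gaugeNorm p)) ^ 2) ≤
      ∫ p, V (gaugeNorm p) / gaugeNorm p ^ 4 * angularForm u u p := by
  have hn1 : 1 ≤ n := by omega
  have hmc : ∀ p : Space n, p ≠ 0 → ContinuousAt (fun p => angularMean u (gaugeNorm p)) p :=
    fun p hp => (hasDerivAt_angularMean hn1 hu hs (gaugeNorm_pos hp)).continuousAt.comp
      continuous_gaugeNorm.continuousAt
  set N : Space n → ℝ := fun p => angularWeight p * (u p - angularMean u (gaugeNorm p)) ^ 2 with hN
  have hNs : SupportedIn a b N := fun p hp => by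
    -- At the origin the weight is 0/0 = 0, so the value of the mean at radius 0 is irrelevant.
    by_cases hp0 : p = 0
    · simp [hN, hp0, angularWeight]
    · simp [hN, hs p hp, angularMean_eq_zero hs (gaugeNorm_pos hp0) hp]
  have hNc : ∀ p, p ≠ 0 → ContinuousAt N p := fun p hp =>
    (continuousAt_angularWeight hp).mul ((hu.continuous.continuousAt.sub (hmc p hp)).pow 2)
  have iN : Integrable fun p => V (gaugeNorm p) / gaugeNorm p ^ 4 * N p :=
    hNs.integrable_weight hsub (continuousOn_div_pow hV 4) hNc
  have iΓ := integrable_angularForm_weight 4 hV hu hu hs hsub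
  refine ⟨iN, ?_⟩
  rw [← sub_nonneg, ← integral_const_mul, ← integral_sub iΓ (iN.const_mul _)]
  refine integral_nonneg_of_sphere hn1 (a := a) (b := b) (fun p hp => ?_)
    (iΓ.fun_sub (iN.const_mul _)) fun r hr => ?_
  · simp [hs.angularForm u p hp, hNs p hp]
  · have hr0 : 0 < r := ha.trans_le hr.1
    have hmass := angularMass_pos hn1
    have hψ : Integrable (fun θ => angularWeight (spherePt θ)) (angleMeasure n) :=
      integrable_angleMeasure_of_bounded hn1 continuous_angularWeight_spherePt (C := 1) fun θ => by
        simpa using abs_angularWeight_spherePt_mul_le (x := 1) (C := 1) (by simp) θ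
    have hp := gaugeSphere_poincare hn (U := fun q => u (dilation r q)) (c := angularMean u r)
      ((hu.of_le (by simp)).comp ((contDiff_fst.const_smul r).prodMk
        (contDiff_const.mul contDiff_snd)))
      (by
        simp only [mul_sub]
        rw [integral_sub (integrable_angularWeight_mul_dilation hn1 hu.continuous hs r)
          (hψ.mul_const _), integral_mul_const]
        change _ - angularMass n * _ = 0
        unfold angularMean
        field_simp
        ring)
    simp only [angularForm_comp_dilation (hu.differentiable (by simp)) hr0] at hp
    have hNθ : ∀ θ, N (dilation r (spherePt θ)) =
        angularWeight (spherePt θ) * (u (dilation r (spherePt θ)) - angularMean u r) ^ 2 :=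
      fun θ => by
        simp only [hN, gaugeNorm_dilation_spherePt hr0.le, angularWeight_dilation hr0]
    simp only [gaugeNorm_dilation_spherePt hr0.le]
    rw [integral_sub, integral_const_mul, integral_const_mul, integral_const_mul]
    · simp only [hNθ]
      have h4 : 0 ≤ V r / r ^ 4 := div_nonneg (hV0 r (hsub hr)) (by positivity)
      nlinarith [mul_le_mul_of_nonneg_left hp h4]
    · exact ((hs.angularForm u).integrable_dilation_spherePt hn1 ha
        (fun p hp => continuousAt_angularForm hu hu hp) r).const_mul _
    · exact ((hNs.integrable_dilation_spherePt hn1 ha hNc r).const_mul _).const_mul _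

lemma integrable_radial_mul_angularOp (hw : ContinuousOn w (radialInterval R))
    (hh : Continuous h) (hu : ContDiff ℝ ∞ u) (hs : SupportedIn a b u)
    (hsub : Icc a b ⊆ radialInterval R) :
    Integrable fun p => w (gaugeNorm p) * (h p * angularOp u p) :=
  (hs.angularOp.mul_left h).integrable_weight hsub hw fun _ hp =>
    hh.continuousAt.mul (contDiffAt_angularOp hu hp).continuousAt

/-- Integration by parts against a radial weight. -/
lemma integral_radial_mul_angularOp (hw : ContDiffOn ℝ 1 w (radialInterval R))
    (hh : ContDiff ℝ ∞ h) (hu : ContDiff ℝ ∞ u) (hs : SupportedIn a b u)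
    (hsub : Icc a b ⊆ radialInterval R) (ha : 0 < a) :
    ∫ p, w (gaugeNorm p) * (h p * angularOp u p) =
      -∫ p, w (gaugeNorm p) * angularForm h u p := by
  -- Nothing is known about w outside (0,R), but there Γ vanishes because u does.
  have hform : ∀ p, angularForm (fun q => w (gaugeNorm q) * h q) u p =
      w (gaugeNorm p) * angularForm h u p := fun p => by
    by_cases hp : gaugeNorm p ∈ Icc a b
    · exact angularForm_radial_mul u (ne_zero_of_mem_radialInterval (hsub hp))
        (hasDerivAt_of_contDiffOn hw (hsub hp)) (hh.differentiable (by simp) p)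
    · rw [hs.angularForm _ p hp, hs.angularForm _ p hp, mul_zero]
  have key := integral_mul_angularOp hu ha hs (h := fun q => w (gaugeNorm q) * h q)
    fun p hp => ((hw.contDiffAt ((isOpen_radialInterval R).mem_nhds (hsub hp))).comp p
      (contDiffAt_gaugeNorm (ne_zero_of_mem_radialInterval (hsub hp)))).mul
      (hh.contDiffAt.of_le (by simp))
  simp only [hform, mul_assoc] at key
  rw [integral_add (integrable_radial_mul_angularOp hw.continuousOn hh.continuous hu hs hsub)
    ((hs.angularForm h).integrable_weight hsub hw.continuousOn
      fun _ hp => continuousAt_angularForm hh hu hp)] at key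
  linarith

lemma angularForm_const (c : ℝ) (u : Space n → ℝ) (p : Space n) :
    angularForm (fun _ => c) u p = 0 := by
  simp [angularForm, partialX, partialT, euler]

end AngularMean

/-! ### Radial functions have no angular part. -/

section Radial

variable {n : ℕ} {a b : ℝ} {u : Space n → ℝ}

/-- The trivial factor 1 puts u into the form required by the product rules for radial factors. -/
lemma IsRadial.eq_comp_gaugeNorm (hr : IsRadial u) (θ : Sph n × ℝ) :
    u = fun q => (fun s => u (dilation s (spherePt θ))) (gaugeNorm q) * (fun _ => (1 : ℝ)) q := by
  funext q
  simp only [mul_one]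
  exact hr _ _ (gaugeNorm_dilation_spherePt (gaugeNorm_nonneg q) θ).symm

lemma nonempty_sph (hn : 1 ≤ n) : Nonempty (Sph n) := by
  have : Nonempty (Fin n) := ⟨⟨0, hn⟩⟩
  exact (NormedSpace.sphere_nonempty.2 zero_le_one).to_subtype

lemma IsRadial.angularForm_eq_zero (hn : 1 ≤ n) (hr : IsRadial u) (hu : Differentiable ℝ u)
    (w : Space n → ℝ) {p : Space n} (hp : p ≠ 0) : angularForm u w p = 0 := by
  obtain ⟨ξ⟩ := nonempty_sph hn
  rw [hr.eq_comp_gaugeNorm (ξ, 0), angularForm_radial_mul w hp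
    (hasDerivAt_comp_dilation (gaugeNorm_pos hp).ne' (hu _)) (differentiableAt_const _),
    angularForm_const, mul_zero]

lemma IsRadial.euler (hn : 1 ≤ n) (hr : IsRadial u) (hu : Differentiable ℝ u) :
    IsRadial (euler u) := by
  obtain ⟨ξ⟩ := nonempty_sph hn
  have h : ∀ p : Space n, p ≠ 0 →
      Grushin.euler u p = Grushin.euler u (dilation (gaugeNorm p) (spherePt (ξ, 0))) := by
    intro p hp
    have h0 := gaugeNorm_pos hp
    conv_lhs => rw [hr.eq_comp_gaugeNorm (ξ, 0)]
    rw [euler_radial_mul hp (hasDerivAt_comp_dilation h0.ne' (hu _)) (differentiableAt_const _)]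
    simp only [mul_one]
    have h1 : Grushin.euler (fun _ : Space n => (1 : ℝ)) p = 0 := by simp [Grushin.euler]
    rw [h1]
    field_simp
    ring
  intro p q hpq
  by_cases hp : p = 0
  · have hq : q = 0 := by
      by_contra hq
      rw [hp, gaugeNorm_zero] at hpq
      exact (gaugeNorm_pos hq).ne hpq
    rw [hp, hq]
  · have hq : q ≠ 0 := ne_zero_of_gaugeNorm_pos (hpq ▸ gaugeNorm_pos hp)
    rw [h p hp, h q hq, hpq]

/-- Testing Mu against itself gives ∫(Mu)² = −∫Γ(Mu,u) = 0, since Γ(·,u) = 0 for radial u. No second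
derivatives of ϱ are computed. -/
lemma IsRadial.angularOp_ae_eq_zero (hn : 1 ≤ n) (hr : IsRadial u) (hu : ContDiff ℝ ∞ u)
    (ha : 0 < a) (hs : SupportedIn a b u) : ∀ᵐ p, angularOp u p = 0 := by
  have key := integral_mul_angularOp hu ha hs (h := angularOp u) fun p hp =>
    (contDiffAt_angularOp hu (ne_zero_of_gaugeNorm_pos (ha.trans_le hp.1))).of_le (by simp)
  have h0 : ∀ p, angularForm (angularOp u) u p = 0 := fun p => by
    by_cases hp : p = 0
    · refine hs.angularForm _ p fun h => ?_
      rw [hp, gaugeNorm_zero] at h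
      exact absurd h.1 (not_le.2 ha)
    · rw [angularForm_comm]
      exact hr.angularForm_eq_zero hn (hu.differentiable (by simp)) _ hp
  simp only [h0, add_zero] at key
  rw [integral_eq_zero_iff_of_nonneg (fun p => mul_self_nonneg _)] at key
  · filter_upwards [key] with p hp
    exact mul_self_eq_zero.1 hp
  · refine (hs.angularOp.mul_left _).integrable fun p hp => ?_
    have := (contDiffAt_angularOp hu (ne_zero_of_gaugeNorm_pos (ha.trans_le hp.1))).continuousAt
    exact this.mul this

end Radial

/-! ### The lower bound for the Rellich integral. -/

section Main

variable {n : ℕ} {R : EReal} {V W f : ℝ → ℝ} {a b : ℝ} {u : Space n → ℝ}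

lemma ae_fst_ne_zero (hn : 1 ≤ n) : ∀ᵐ p : Space n, p.1 ≠ 0 := by
  have : Nonempty (Fin n) := ⟨⟨0, hn⟩⟩
  have h : ∀ᵐ x : EuclideanSpace ℝ (Fin n), x ≠ 0 :=
    compl_mem_ae_iff.2 (measure_singleton (0 : EuclideanSpace ℝ (Fin n)))
  exact Measure.quasiMeasurePreserving_fst.ae h

lemma angularWeight_pos {p : Space n} (hp : p.1 ≠ 0) : 0 < angularWeight p := by
  have h0 : p ≠ 0 := fun h => hp (by rw [h]; rfl)
  have h1 := gaugeNorm_pos h0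
  have h2 := norm_pos_iff.2 hp
  unfold angularWeight
  positivity

lemma rellichTerm_eq (V : ℝ → ℝ) (u : Space n → ℝ) {p : Space n} (hp : p.1 ≠ 0) :
    rellichTerm V u p = V (gaugeNorm p) / gaugeNorm p ^ 4 *
      ((angularOp u p + angularWeight p * radialPart u p) ^ 2 / angularWeight p) := by
  have h0 : p ≠ 0 := fun h => hp (by rw [h]; rfl)
  have h1 := gaugeNorm_pos h0
  have h2 : angularOp u p + angularWeight p * radialPart u p = gaugeNorm p ^ 2 * grushinOp u p := by
    simp only [angularOp, radialPart]
    ring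
  rw [rellichTerm, gradSq_gaugeNorm h0, h2]
  have h3 := angularWeight_pos hp
  field_simp

lemma SupportedIn.rellichTerm (hs : SupportedIn a b u) (V : ℝ → ℝ) :
    SupportedIn a b (rellichTerm V u) := fun p hp => by
  simp [Grushin.rellichTerm, hs.grushinOp p hp]

lemma SupportedIn.hardyTerm (hs : SupportedIn a b u) (W : ℝ → ℝ) :
    SupportedIn a b (hardyTerm W u) := hs.gradSq.mul_left _

lemma SupportedIn.remainderTerm (hs : SupportedIn a b u) (hu : Differentiable ℝ u)
    (V f : ℝ → ℝ) : SupportedIn a b (remainderTerm V f u) := fun p hp => by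
  have h1 : SupportedIn a b fun q => radialDeriv u q / (gaugeNorm q * f (gaugeNorm q)) :=
    fun q hq => by simp [radialDeriv_eq hu, hs.euler q hq]
  simp [Grushin.remainderTerm, h1.gradSq p hp]

lemma SupportedIn.hardyTerm_eq (hs : SupportedIn a b u) (ha : 0 < a) (W : ℝ → ℝ) (p : Space n) :
    Grushin.hardyTerm W u p =
      W (gaugeNorm p) / gaugeNorm p ^ 2 * (angularWeight p * Grushin.euler u p ^ 2) +
      W (gaugeNorm p) / gaugeNorm p ^ 2 * Grushin.angularForm u u p := by
  by_cases hp : gaugeNorm p ∈ Icc a b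
  · exact Grushin.hardyTerm_eq W u (ne_zero_of_gaugeNorm_pos (ha.trans_le hp.1))
  · simp [hs.hardyTerm W p hp, hs.euler p hp, hs.angularForm u p hp]

lemma SupportedIn.remainderTerm_eq (hs : SupportedIn a b u) (hsub : Icc a b ⊆ radialInterval R)
    (hu : ContDiff ℝ ∞ u) (V : ℝ → ℝ) (hf : ContDiffOn ℝ 1 f (radialInterval R))
    (hf0 : ∀ r ∈ radialInterval R, 0 < f r) (p : Space n) :
    Grushin.remainderTerm V f u p =
      V (gaugeNorm p) / gaugeNorm p ^ 4 * (angularWeight p * (Grushin.euler (Grushin.euler u) p -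
        (2 + gaugeNorm p * deriv f (gaugeNorm p) / f (gaugeNorm p)) * Grushin.euler u p) ^ 2) +
      V (gaugeNorm p) / gaugeNorm p ^ 4 *
        Grushin.angularForm (Grushin.euler u) (Grushin.euler u) p := by
  by_cases hp : gaugeNorm p ∈ Icc a b
  · exact Grushin.remainderTerm_eq V hf hf0 hu (hsub hp)
  · simp [hs.remainderTerm (hu.differentiable (by simp)) V f p hp, hs.euler p hp,
      hs.euler.euler p hp, hs.euler.angularForm _ p hp]

lemma SupportedIn.setIntegral_gaugeBall {F : Space n → ℝ} (hs : SupportedIn a b F)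
    (hsub : Icc a b ⊆ radialInterval R) : ∫ p in gaugeBall n R, F p = ∫ p, F p :=
  setIntegral_eq_integral_of_forall_compl_eq_zero fun p hp =>
    hs p fun h => hp (hsub h).2

/-- Only the minorant has to be integrable; the majorant may have infinite integral, as (Mu)²/ψ may
near x = 0. -/
lemma coe_integral_le_lintegral {α : Type*} [MeasurableSpace α] {μ : Measure α} {I F : α → ℝ}
    (hI : Integrable I μ) (h : ∀ᵐ p ∂μ, I p ≤ F p) :
    ((∫ p, I p ∂μ : ℝ) : EReal) ≤ ((∫⁻ p, ENNReal.ofReal (F p) ∂μ : ENNReal) : EReal) := by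
  have h1 : ∫⁻ p, ENNReal.ofReal (I p) ∂μ ≤ ∫⁻ p, ENNReal.ofReal (F p) ∂μ :=
    lintegral_mono_ae (h.mono fun p hp => ENNReal.ofReal_le_ofReal hp)
  have h2 : ∫⁻ p, ENNReal.ofReal (I p) ∂μ ≠ ⊤ :=
    (hI.lintegral_lt_top).ne
  have h3 : ∫ p, I p ∂μ ≤ (∫⁻ p, ENNReal.ofReal (I p) ∂μ).toReal := by
    rw [integral_eq_lintegral_pos_part_sub_lintegral_neg_part hI]
    linarith [ENNReal.toReal_nonneg (a := ∫⁻ p, ENNReal.ofReal (-I p) ∂μ)]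
  calc ((∫ p, I p ∂μ : ℝ) : EReal) ≤ ((∫⁻ p, ENNReal.ofReal (I p) ∂μ).toReal : EReal) :=
        EReal.coe_le_coe_iff.2 h3
    _ = ((∫⁻ p, ENNReal.ofReal (I p) ∂μ : ENNReal) : EReal) := EReal.coe_ennreal_toReal h2
    _ ≤ _ := EReal.coe_ennreal_le_coe_ennreal_iff.2 h1

lemma integrable_hardyTerm (hW : ContinuousOn W (radialInterval R)) (ha : 0 < a)
    (hsub : Icc a b ⊆ radialInterval R) (hu : ContDiff ℝ ∞ u) (hs : SupportedIn a b u) :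
    Integrable (hardyTerm W u) := by
  rw [funext (hs.hardyTerm_eq ha W)]
  exact (integrable_angularWeight_sq 2 hW (contDiff_euler hu).continuous hs.euler hsub).fun_add
    (integrable_angularForm_weight 2 hW hu hu hs hsub)

lemma integrable_remainderTerm (hV : ContinuousOn V (radialInterval R))
    (hf : ContDiffOn ℝ 1 f (radialInterval R)) (hf0 : ∀ r ∈ radialInterval R, 0 < f r)
    (hsub : Icc a b ⊆ radialInterval R) (hu : ContDiff ℝ ∞ u) (hs : SupportedIn a b u) :
    Integrable (remainderTerm V f u) := by
  rw [funext (hs.remainderTerm_eq hsub hu V hf hf0)]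
  exact (integrable_radialRemainder hV hf hf0 hu hs hsub).fun_add
    (integrable_angularForm_weight 4 hV (contDiff_euler hu) (contDiff_euler hu) hs.euler hsub)

/-- A lower bound of the Rellich integrand by terms that can be integrated by parts. -/
def rellichMinorant (V : ℝ → ℝ) (u : Space n → ℝ) (p : Space n) : ℝ :=
  V (gaugeNorm p) / gaugeNorm p ^ 4 * (angularWeight p * radialPart u p ^ 2) +
    2 * (V (gaugeNorm p) / gaugeNorm p ^ 4 * (radialPart u p * angularOp u p)) -
    2 * (n + 1) * (V (gaugeNorm p) / gaugeNorm p ^ 4 * (u p * angularOp u p)) +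
    2 * (n + 1) * (V (gaugeNorm p) / gaugeNorm p ^ 4 * angularMean u (gaugeNorm p) *
      (1 * angularOp u p)) -
    (n + 1) ^ 2 * (V (gaugeNorm p) / gaugeNorm p ^ 4 *
      (angularWeight p * (u p - angularMean u (gaugeNorm p)) ^ 2))

lemma SupportedIn.rellichMinorant (hs : SupportedIn a b u) (V : ℝ → ℝ) :
    SupportedIn a b (rellichMinorant V u) := fun p hp => by
  have h1 : angularWeight p * (u p - angularMean u (gaugeNorm p)) ^ 2 = 0 := by
    by_cases hp0 : p = 0
    · simp [hp0, angularWeight]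
    · simp [hs p hp, angularMean_eq_zero hs (gaugeNorm_pos hp0) hp]
  simp [Grushin.rellichMinorant, hs.radialPart p hp, hs.angularOp p hp, h1]

/-- The difference of the two sides is v(Mu + (n+1)ψ(u − m))²/ψ, where v = V/ϱ⁴ ≥ 0 and ψ > 0 off
the axis x = 0. -/
lemma rellichMinorant_le (hs : SupportedIn a b u) (hV0 : ∀ r ∈ Icc a b, 0 ≤ V r) {p : Space n}
    (hp : p.1 ≠ 0) : rellichMinorant V u p ≤ rellichTerm V u p := by
  by_cases hr : gaugeNorm p ∈ Icc a b
  · have h1 := angularWeight_pos hp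
    have h2 : 0 ≤ V (gaugeNorm p) / gaugeNorm p ^ 4 :=
      div_nonneg (hV0 _ hr) (pow_nonneg (gaugeNorm_nonneg p) 4)
    rw [rellichTerm_eq V u hp, rellichMinorant]
    set ψ := angularWeight p
    set v := V (gaugeNorm p) / gaugeNorm p ^ 4
    set M := angularOp u p
    set B := radialPart u p
    set m := angularMean u (gaugeNorm p)
    have h3 : v * ((M + ψ * B) ^ 2 / ψ) = v * (ψ * B ^ 2) + 2 * (v * (B * M)) -
        2 * (n + 1) * (v * (u p * M)) + 2 * (n + 1) * (v * m * (1 * M)) -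
        (n + 1) ^ 2 * (v * (ψ * (u p - m) ^ 2)) + v * ((M + (n + 1) * ψ * (u p - m)) ^ 2 / ψ) := by
      field_simp
      ring
    rw [h3]
    exact le_add_of_nonneg_right (by positivity)
  · rw [hs.rellichMinorant V p hr, hs.rellichTerm V p hr]

lemma contDiffOn_div_pow {g : ℝ → ℝ} (hg : ContDiffOn ℝ 1 g (radialInterval R)) (k : ℕ) :
    ContDiffOn ℝ 1 (fun r => g r / r ^ k) (radialInterval R) :=
  hg.div (contDiff_id.pow k).contDiffOn fun _ hr => pow_ne_zero k hr.1.ne'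

/-- Integrating by parts, the u·Mu term gives 2(n+1)∫vΓ(u,u) and the m·Mu term vanishes, because vm
is a radial weight tested against the constant 1. The Poincaré inequality bounds (n+1)²∫vψ(u − m)²
by (n+1)∫vΓ(u,u), so one multiple (n+1)∫vΓ(u,u) survives. -/
lemma integral_rellichMinorant_ge (hn : 2 ≤ n) (hV : ContDiffOn ℝ 1 V (radialInterval R))
    (hV0 : ∀ r ∈ radialInterval R, 0 ≤ V r) (ha : 0 < a) (hsub : Icc a b ⊆ radialInterval R)
    (hu : ContDiff ℝ ∞ u) (hs : SupportedIn a b u) :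
    Integrable (rellichMinorant V u) ∧
    (∫ p, V (gaugeNorm p) / gaugeNorm p ^ 4 * (angularWeight p * radialPart u p ^ 2)) -
      2 * (∫ p, V (gaugeNorm p) / gaugeNorm p ^ 4 * angularForm (radialPart u) u p) +
      (n + 1) * (∫ p, V (gaugeNorm p) / gaugeNorm p ^ 4 * angularForm u u p) ≤
      ∫ p, rellichMinorant V u p := by
  have hn1 : 1 ≤ n := by omega
  have hw := contDiffOn_div_pow hV 4
  have hm : ContDiffOn ℝ 1 (fun r => V r / r ^ 4 * angularMean u r) (radialInterval R) :=
    hw.mul ((contDiffOn_angularMean hn1 hu hs).mono fun r hr => hr.1)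
  have hB := contDiff_radialPart hu
  have i0 := integrable_angularWeight_sq 4 hV.continuousOn hB.continuous hs.radialPart hsub
  have i1 := integrable_radial_mul_angularOp hw.continuousOn hB.continuous hu hs hsub
  have i2 := integrable_radial_mul_angularOp hw.continuousOn hu.continuous hu hs hsub
  have i3 := integrable_radial_mul_angularOp hm.continuousOn (h := fun _ => 1) continuous_const hu
    hs hsub
  obtain ⟨i4, hN⟩ := integral_variance_le hn hV.continuousOn hV0 hsub ha hu hs
  have e1 := integral_radial_mul_angularOp hw hB hu hs hsub ha
  have e2 := integral_radial_mul_angularOp hw hu hu hs hsub ha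
  have e3 := integral_radial_mul_angularOp hm (h := fun _ => 1) contDiff_const hu hs hsub ha
  simp only [angularForm_const, mul_zero, integral_zero, neg_zero] at e3
  have j1 := i0.fun_add (i1.const_mul 2)
  have j2 := j1.fun_sub (i2.const_mul (2 * ((n : ℝ) + 1)))
  have j3 := j2.fun_add (i3.const_mul (2 * ((n : ℝ) + 1)))
  refine ⟨j3.fun_sub (i4.const_mul (((n : ℝ) + 1) ^ 2)), ?_⟩
  unfold rellichMinorant
  rw [integral_sub j3 (i4.const_mul _), integral_add j2 (i3.const_mul _),
    integral_sub j1 (i2.const_mul _), integral_add i0 (i1.const_mul _), integral_const_mul,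
    integral_const_mul, integral_const_mul, integral_const_mul, e1, e2, e3]
  have hn0 : (0 : ℝ) ≤ (n : ℝ) + 1 := by positivity
  nlinarith [mul_le_mul_of_nonneg_left hN hn0]

end Main

end Grushin

end

/-! ### Assembly of the identity and the inequality. -/

theorem proposition7p1 (n : ℕ) (hn : 2 ≤ n) (R : EReal) (hR : 0 < R) (V W f : ℝ → ℝ)
    (hVW : Grushin.IsBesselPair (Grushin.homDim n + 2) R V
      (fun r => W r + (Grushin.homDim n : ℝ) * (deriv V r / r)))
    (hf : Grushin.IsPositiveSolution (Grushin.homDim n + 2) R V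
      (fun r => W r + (Grushin.homDim n : ℝ) * (deriv V r / r)) f) :
    (∀ u : Grushin.Space n → ℝ, Grushin.IsTestFunction R u → Grushin.IsRadial u →
      IntegrableOn (Grushin.rellichTerm V u) (Grushin.gaugeBall n R) ∧
      IntegrableOn (Grushin.hardyTerm W u) (Grushin.gaugeBall n R) ∧
      IntegrableOn (Grushin.remainderTerm V f u) (Grushin.gaugeBall n R) ∧
      ∫ p in Grushin.gaugeBall n R, Grushin.rellichTerm V u p =
        (∫ p in Grushin.gaugeBall n R, Grushin.hardyTerm W u p) +
          ∫ p in Grushin.gaugeBall n R, Grushin.remainderTerm V f u p) ∧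
    ((∀ r ∈ Grushin.radialInterval R, 0 ≤ V r) →
      (∀ r ∈ Grushin.radialInterval R, DifferentiableAt ℝ (deriv V) r) →
      (∀ r ∈ Grushin.radialInterval R,
        0 ≤ ((Grushin.homDim n : ℝ) - 5) * (V r / r ^ 2) + 3 * (deriv V r / r)
          - deriv (deriv V) r) →
      ∀ u : Grushin.Space n → ℝ, Grushin.IsTestFunction R u →
        IntegrableOn (Grushin.hardyTerm W u) (Grushin.gaugeBall n R) ∧
        IntegrableOn (Grushin.remainderTerm V f u) (Grushin.gaugeBall n R) ∧
        ((((∫ p in Grushin.gaugeBall n R, Grushin.hardyTerm W u p) +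
            ∫ p in Grushin.gaugeBall n R, Grushin.remainderTerm V f u p : ℝ)) : EReal) ≤
          ((∫⁻ p in Grushin.gaugeBall n R,
            ENNReal.ofReal (Grushin.rellichTerm V u p) : ENNReal) : EReal)) := by
  have hn1 : 1 ≤ n := by omega
  have hV := hVW.contDiffOn_left
  have hW := Grushin.continuousOn_weight hV hVW.contDiffOn_right
  refine ⟨fun u hu hrad => ?_, fun hV0 hV' hVV u hu => ?_⟩
  · obtain ⟨a, a₁, b₁, b, ha, haa, hab, hbb, hsub, hs⟩ := hu.exists_supportedIn hR
    have hu := hu.smooth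
    have ha₁ : 0 < a₁ := ha.trans haa
    have hsub₁ : Icc a₁ b₁ ⊆ Grushin.radialInterval R :=
      (Icc_subset_Icc haa.le hbb.le).trans hsub
    have hd := hu.differentiable (by simp)
    have hZ := Grushin.contDiff_euler hu
    have iH := Grushin.integrable_hardyTerm hW ha₁ hsub₁ hu hs
    have iR := Grushin.integrable_remainderTerm hV.continuousOn hf.contDiffOn hf.pos hsub₁ hu hs
    have i0 := Grushin.integrable_angularWeight_sq 4 hV.continuousOn
      (Grushin.contDiff_radialPart hu).continuous hs.radialPart hsub₁
    -- The equality is only almost everywhere: the axis x = 0, where ψ vanishes, is a null set, and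
    -- Mu = 0 is known almost everywhere.
    have hrel : Grushin.rellichTerm V u =ᵐ[volume] fun p => V (Grushin.gaugeNorm p) /
        Grushin.gaugeNorm p ^ 4 * (Grushin.angularWeight p * Grushin.radialPart u p ^ 2) := by
      filter_upwards [Grushin.ae_fst_ne_zero hn1, hrad.angularOp_ae_eq_zero hn1 hu ha₁ hs]
        with p hp hM
      have h1 := Grushin.angularWeight_pos hp
      rw [Grushin.rellichTerm_eq V u hp, hM]
      field_simp
      ring
    have hz : ∀ {w : Grushin.Space n → ℝ}, Grushin.IsRadial w → ContDiff ℝ ∞ w →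
        Grushin.SupportedIn a₁ b₁ w → ∀ p, Grushin.angularForm w w p = 0 := by
      intro w hw hwd hws p
      by_cases hp : Grushin.gaugeNorm p ∈ Icc a₁ b₁
      · exact hw.angularForm_eq_zero hn1 (hwd.differentiable (by simp)) w
          (Grushin.ne_zero_of_mem_radialInterval (hsub₁ hp))
      · exact hws.angularForm w p hp
    refine ⟨(i0.congr hrel.symm).integrableOn, iH.integrableOn, iR.integrableOn, ?_⟩
    rw [(hs.rellichTerm V).setIntegral_gaugeBall hsub₁, (hs.hardyTerm W).setIntegral_gaugeBall hsub₁,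
      (hs.remainderTerm hd V f).setIntegral_gaugeBall hsub₁, integral_congr_ae hrel,
      Grushin.integral_radialPart_eq hn1 hV hW hf ha haa hab hbb hsub hu hs]
    simp only [hs.hardyTerm_eq ha₁ W, hs.remainderTerm_eq hsub₁ hu V hf.contDiffOn hf.pos,
      hz hrad hu hs, hz (hrad.euler hn1 hd) hZ hs.euler, mul_zero, add_zero]
  · obtain ⟨a, a₁, b₁, b, ha, haa, hab, hbb, hsub, hs⟩ := hu.exists_supportedIn hR
    have hu := hu.smooth
    have ha₁ : 0 < a₁ := ha.trans haa
    have hsub₁ : Icc a₁ b₁ ⊆ Grushin.radialInterval R :=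
      (Icc_subset_Icc haa.le hbb.le).trans hsub
    have hd := hu.differentiable (by simp)
    have hZ := Grushin.contDiff_euler hu
    have iH := Grushin.integrable_hardyTerm hW ha₁ hsub₁ hu hs
    have iR := Grushin.integrable_remainderTerm hV.continuousOn hf.contDiffOn hf.pos hsub₁ hu hs
    obtain ⟨iI, hI⟩ := Grushin.integral_rellichMinorant_ge hn hV hV0 ha₁ hsub₁ hu hs
    refine ⟨iH.integrableOn, iR.integrableOn, ?_⟩
    -- Hardy and remainder terms split into radial and angular parts. The radial parts match vψB²
    -- exactly; the angular parts are dominated by (n+1)∫vΓ(u,u) − 2∫vΓ(B,u).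
    have hle : (∫ p, Grushin.hardyTerm W u p) + ∫ p, Grushin.remainderTerm V f u p ≤
        ∫ p, Grushin.rellichMinorant V u p := by
      have h1 := Grushin.integral_radialPart_eq hn1 hV hW hf ha haa hab hbb hsub hu hs
      have h2 := Grushin.integral_angularForm_nonneg hn1 hV hW hf hV0 hV' hVV ha haa hab hbb hsub
        hu hs
      simp only [hs.hardyTerm_eq ha₁ W, hs.remainderTerm_eq hsub₁ hu V hf.contDiffOn hf.pos]
      rw [integral_add (Grushin.integrable_angularWeight_sq 2 hW hZ.continuous hs.euler hsub₁)
        (Grushin.integrable_angularForm_weight 2 hW hu hu hs hsub₁),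
        integral_add (Grushin.integrable_radialRemainder hV.continuousOn hf.contDiffOn hf.pos hu hs
          hsub₁) (Grushin.integrable_angularForm_weight 4 hV.continuousOn hZ hZ hs.euler hsub₁)]
      linarith
    rw [(hs.hardyTerm W).setIntegral_gaugeBall hsub₁,
      (hs.remainderTerm hd V f).setIntegral_gaugeBall hsub₁]
    refine (EReal.coe_le_coe_iff.2 hle).trans ?_
    rw [← (hs.rellichMinorant V).setIntegral_gaugeBall hsub₁]
    refine Grushin.coe_integral_le_lintegral iI.integrableOn (ae_restrict_of_ae ?_)
    filter_upwards [Grushin.ae_fst_ne_zero hn1] with p hp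
    exact Grushin.rellichMinorant_le hs (fun r hr => hV0 r (hsub₁ hr)) hp
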